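/- Let $n\ge 3$. For a Lebesgue measurable set $E\subset\mathbb{R}^n$ let $P(E)=\sup\{\int_E \operatorname{div}T : T\in C^1_c(\mathbb{R}^n;\mathbb{R}^n),\ |T|\le 1\}\in[0,\infty]$ be its perimeter and, for $\beta\ge 1$, put $a_E=\mathbf 1_{E^c}+\beta\mathbf 1_E$. Let $D^1(\mathbb{R}^n)$ be the completion of $C_c^\infty(\mathbb{R}^n)$ with respect to the norm $\|\nabla\varphi\|_{L^2}$, regarded as a space of functions in $L^{2n/(n-2)}(\mathbb{R}^n)$, and let $\mathcal A(E)$ be the set of pairs $(u,\rho)\in D^1(\mathbb{R}^n)\times L^2(\mathbb{R}^n)$ with $\rho\mathbf 1_{E^c}=0$, $\int\rho=1$ and $-\operatorname{div}(a_E\nabla u)=\rho$ in $\mathcal D'(\mathbb{R}^n)$. Set \[ \mathcal G_{\beta,K}(E)=\inf_{(u,\rho)\in\mathcal A(E)}\Big\{\int_{\mathbb{R}^n}a_E|\nabla u|^2+K\int_E\rho^2\Big\},\qquad \mathcal F_{\beta,K,Q}(E)=P(E)+Q^2\,\mathcal G_{\beta,K}(E), \] and, for $R\ge 1$, with $B_r$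 the ball of radius $r$ centred at the origin, consider the problem \[ (\mathcal P_{\beta,K,Q,R})\qquad \min\{\mathcal F_{\beta,K,Q}(E) : |E|=|B_1|,\ E\subset B_R\}. \] Let $K_h,Q_h\in\mathbb{R}$, $\beta_h\ge 1$ and $R_h\ge 1$ ($h\in\mathbb{N}$) be such that $K_h\to K>0$, $\beta_h\to\beta\ge 1$, $R_h\to R\ge 1$ and $Q_h\to Q\ge 0$. For every $h$ let $E_h$ be a minimizer of $(\mathcal P_{\beta_h,K_h,Q_h,R_h})$. Then, up to passing to a subsequence (not relabelled), there exists a set of finite perimeter $E$ such that $|E\Delta E_h|\to 0$. Moreover $E$ is a minimizer of $(\mathcal P_{\beta,K,Q,R})$, and along the subsequence \[ \mathcal F_{\beta,K,Q}(E)=\lim_{h\to\infty}\mathcal F_{\beta_h,K_h,Q_h}(E_h)\qquad\text{and}\qquad P(E_h)\to P(E). \] -/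

import Mathlib

open Filter Topology MeasureTheory
open scoped ENNReal ContDiff

namespace ChargedDrop

noncomputable section

/-- Euclidean space `ℝⁿ`; `volume` on it is Lebesgue measure. -/
abbrev Space (n : ℕ) : Type := EuclideanSpace ℝ (Fin n)

/-- The divergence `∑ᵢ ∂ᵢ Tᵢ` of a vector field. -/
def divergence {n : ℕ} (T : Space n → Space n) (x : Space n) : ℝ :=
  ∑ i : Fin n, (fderiv ℝ T x (EuclideanSpace.single i 1)) i

/-- The (De Giorgi) perimeter
`P(E) = sup {∫_E div T : T ∈ C¹_c(ℝⁿ; ℝⁿ), |T| ≤ 1}`, with values in `[0, ∞]`. -/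
def perimeter {n : ℕ} (E : Set (Space n)) : ℝ≥0∞ :=
  ⨆ (T : Space n → Space n) (_ : ContDiff ℝ 1 T) (_ : HasCompactSupport T)
    (_ : ∀ x, ‖T x‖ ≤ 1), ENNReal.ofReal (∫ x in E, divergence T x)

/-- A test function: an element of `C_c^∞(ℝⁿ)`. -/
def IsTestFunction {n : ℕ} (φ : Space n → ℝ) : Prop :=
  ContDiff ℝ ∞ φ ∧ HasCompactSupport φ

/-- The Sobolev exponent `2* = 2n/(n-2)` (meaningful for `n ≥ 3`). -/
def sobolevExponent (n : ℕ) : ℝ≥0∞ :=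
  ENNReal.ofReal (2 * (n : ℝ) / ((n : ℝ) - 2))

/-- `MemD1 u g`: the function `u` belongs to `D¹(ℝⁿ)` and `g` is its gradient. Here `D¹(ℝⁿ)` is
the completion of `C_c^∞(ℝⁿ)` for the norm `‖∇φ‖_{L²}`, realised for `n ≥ 3` as a space of functions
in `L^{2*}`: by the Sobolev inequality a sequence of test functions whose gradients converge in
`L²` converges in `L^{2*}`, so elements of the completion are the limits `u` of such sequences. -/
structure MemD1 {n : ℕ} (u : Space n → ℝ) (g : Space n → Space n) : Prop where
  memLp : MemLp u (sobolevExponent n) volume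
  grad_memLp : MemLp g 2 volume
  approx : ∃ φ : ℕ → Space n → ℝ, (∀ k, IsTestFunction (φ k)) ∧
    Tendsto (fun k => eLpNorm (fun x => φ k x - u x) (sobolevExponent n) volume) atTop (𝓝 0) ∧
    Tendsto (fun k => eLpNorm (fun x => gradient (φ k) x - g x) 2 volume) atTop (𝓝 0)

open scoped Classical in
/-- The permittivity coefficient `a_E = 1_{Eᶜ} + β 1_E`. -/
def permittivity {n : ℕ} (β : ℝ) (E : Set (Space n)) (x : Space n) : ℝ :=
  if x ∈ E then β else 1

/-- `(u, ρ) ∈ 𝒜(E)`, where `g = ∇u`: `u ∈ D¹(ℝⁿ)`, `ρ ∈ L²(ℝⁿ)` vanishes (a.e.) outside `E`,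
`∫ ρ = 1`, and `-div (a_E ∇u) = ρ` in the sense of distributions. -/
structure Admissible {n : ℕ} (β : ℝ) (E : Set (Space n))
    (u : Space n → ℝ) (g : Space n → Space n) (ρ : Space n → ℝ) : Prop where
  memD1 : MemD1 u g
  memLp : MemLp ρ 2 volume
  eq_zero : ∀ᵐ x ∂(volume : Measure (Space n)), x ∉ E → ρ x = 0
  integral_eq_one : ∫ x, ρ x = 1
  equation : ∀ φ : Space n → ℝ, IsTestFunction φ →
    ∫ x, permittivity β E x * inner ℝ (g x) (gradient φ x) = ∫ x, ρ x * φ x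

/-- `𝒢_{β,K}(E) = inf {∫ a_E |∇u|² + K ∫_E ρ² : (u, ρ) ∈ 𝒜(E)}` (the infimum of the empty set
being `+∞`). Both integrals are finite for admissible pairs. -/
def electrostaticEnergy {n : ℕ} (β K : ℝ) (E : Set (Space n)) : EReal :=
  ⨅ (u : Space n → ℝ) (g : Space n → Space n) (ρ : Space n → ℝ) (_ : Admissible β E u g ρ),
    (((∫ x, permittivity β E x * ‖g x‖ ^ 2) + K * ∫ x in E, ρ x ^ 2 : ℝ) : EReal)

/-- `ℱ_{β,K,Q}(E) = P(E) + Q² 𝒢_{β,K}(E)`. -/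
def energy {n : ℕ} (β K Q : ℝ) (E : Set (Space n)) : EReal :=
  (perimeter E : EReal) + ((Q ^ 2 : ℝ) : EReal) * electrostaticEnergy β K E

/-- The competitors: Lebesgue measurable sets `E ⊆ B_R` with `|E| = |B_1|`. -/
structure IsCompetitor {n : ℕ} (R : ℝ) (E : Set (Space n)) : Prop where
  measurable : NullMeasurableSet E volume
  subset_ball : E ⊆ Metric.ball 0 R
  volume_eq : volume E = volume (Metric.ball (0 : Space n) 1)

/-- `E` is a minimizer of `min {ℱ_{β,K,Q}(E) : |E| = |B_1|, E ⊆ B_R}`. -/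
def IsMinimizer {n : ℕ} (β K Q R : ℝ) (E : Set (Space n)) : Prop :=
  IsCompetitor R E ∧ ∀ F : Set (Space n), IsCompetitor R F → energy β K Q E ≤ energy β K Q F

end

end ChargedDrop

/-!
The theorem follows from a compactness argument and a comparison of the minimizers with recovery
sequences. The point is that the electrostatic term is *continuous* for convergence of bounded sets
in measure, while the perimeter is lower semicontinuous.

*Compactness.* Comparing with the unit ball bounds `P(E_h)`. Translating a set of finite perimeter
by `z` changes it by measure at most `|z| P(E)` (`volume_symmDiff_translate_le`), so averaging
over balls of radius `δ` costs `δ P(E)` in `L¹`. For fixed `δ` the averages `x ↦ |E_h ∩ B_δ(x)|`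
converge pointwise along a subsequence, and hence the sets are Cauchy in measure
(`exists_subseq_tendsto_of_perimeter_le`).

*Continuity of the electrostatic energy.* Let `u ∈ D¹` be the weak solution of
`-div (a_E ∇u) = K⁻¹ 1_E (1 - u)`, obtained by an orthogonal projection (`exists_isPotential`), and
let `m = K⁻¹ ∫_E (1 - u)`. Expanding squares shows that the infimum defining `𝒢_{β,K}(E)` is
attained at `m⁻¹ (u, K⁻¹ 1_E (1 - u))` and equals `1 / m` (`IsPotential.electrostaticEnergy_eq`). If `u'`
and `m'` belong to other data `β', K', E'`, then testing each equation with the other solution gives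
`m - m' = ∫ (a_E - a_{E'}) ∇u · ∇u' + ∫ (K⁻¹ 1_E - K'⁻¹ 1_{E'}) (1 - u) (1 - u')`
(`IsPotential.totalCharge_sub_eq`). For data converging to those of `u` the coefficient differences,
multiplied by the fixed functions `∇u` and `1 - u`, tend to zero in `L²`, while the remaining
factors are bounded in `L²` by the Sobolev inequality; so `m' → m` (`tendsto_electrostaticEnergy`).

*Recovery sequences.* A competitor `F` for the radius `R` is approximated in measure by competitors
`F_h` for the radii `R_h`, with `P(F_h) ≤ P(F) + ε`: shrink `F` into `B_{R_h}`, then restore the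
volume by adding a ball of small radius `r`, which adds at most `C r^{n-1}` to the perimeter
(`exists_recovery`). This last bound needs no structure theory of sets of finite perimeter, as the
fields `(1 - ψ) T`, with `ψ` a smooth approximation of the indicator of the ball, are admissible in
the definition of `P(F)` (`exists_perimeter_union_ball_le`).

*Conclusion.* The limit `E` is a competitor up to a null set. Comparing `E_h` with a recovery
sequence of `E` and cancelling the electrostatic terms, which have the same limit, gives
`limsup P(E_h) ≤ P(E)`, so `P(E_h) → P(E)` and the energies converge. Comparing with a recovery
sequence of another competitor gives minimality of `E` (`isMinimizer_of_tendsto`).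
-/

namespace ChargedDrop

open scoped Pointwise

/-! ### Integrals over sets that are close in measure -/

lemma norm_setIntegral_sub_le {X : Type*} [MeasurableSpace X] {μ : Measure X} {f : X → ℝ}
    (hf : Integrable f μ) {E F : Set X} (hE : NullMeasurableSet E μ)
    (hF : NullMeasurableSet F μ) :
    ‖(∫ x in E, f x ∂μ) - ∫ x in F, f x ∂μ‖ ≤ ∫ x in symmDiff E F, ‖f x‖ ∂μ := by
  rw [← integral_indicator₀ hE, ← integral_indicator₀ hF,
    ← integral_indicator₀ (hE.symmDiff hF), ← integral_sub (hf.indicator₀ hE) (hf.indicator₀ hF)]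
  refine (norm_integral_le_integral_norm _).trans (integral_mono_of_nonneg ?_ ?_ ?_)
  · exact Eventually.of_forall fun x => norm_nonneg _
  · exact hf.norm.indicator₀ (hE.symmDiff hF)
  · refine Eventually.of_forall fun x => ?_
    by_cases h1 : x ∈ E <;> by_cases h2 : x ∈ F <;>
      simp [Set.indicator, h1, h2, Set.mem_symmDiff]

lemma tendsto_setIntegral_of_symmDiff {X : Type*} [MeasurableSpace X] {μ : Measure X} {f : X → ℝ}
    (hf : Integrable f μ) {E : Set X} {F : ℕ → Set X} (hE : NullMeasurableSet E μ)
    (hF : ∀ k, NullMeasurableSet (F k) μ)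
    (h : Tendsto (fun k => μ (symmDiff E (F k))) atTop (𝓝 0)) :
    Tendsto (fun k => ∫ x in F k, f x ∂μ) atTop (𝓝 (∫ x in E, f x ∂μ)) := by
  rw [tendsto_iff_norm_sub_tendsto_zero]
  refine squeeze_zero (fun _ => norm_nonneg _) (fun k => ?_)
    (hf.norm.tendsto_setIntegral_nhds_zero h)
  rw [norm_sub_rev]
  exact norm_setIntegral_sub_le hf hE (hF k)

/-! ### Elementary properties of the perimeter -/

variable {n : ℕ}

lemma sum_single_smul (v : Space n) :
    ∑ i, v i • (EuclideanSpace.single i (1 : ℝ) : Space n) = v := by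
  ext j
  simp [Finset.sum_apply, Pi.single_apply]

lemma continuous_divergence {T : Space n → Space n} (hT : ContDiff ℝ 1 T) :
    Continuous (divergence T) := by
  have h := hT.continuous_fderiv one_ne_zero
  unfold divergence
  fun_prop

lemma hasCompactSupport_divergence {T : Space n → Space n} (hT : HasCompactSupport T) :
    HasCompactSupport (divergence T) := by
  refine (hT.fderiv ℝ).comp_left (g := fun L : Space n →L[ℝ] Space n =>
    ∑ i : Fin n, (L (EuclideanSpace.single i 1)) i) (by simp)

lemma integrable_divergence {T : Space n → Space n} (hT : ContDiff ℝ 1 T)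
    (hc : HasCompactSupport T) : Integrable (divergence T) :=
  (continuous_divergence hT).integrable_of_hasCompactSupport (hasCompactSupport_divergence hc)

lemma divergence_smul {ψ : Space n → ℝ} {T : Space n → Space n} (hψ : ContDiff ℝ 1 ψ)
    (hT : ContDiff ℝ 1 T) (x : Space n) :
    divergence (fun y => ψ y • T y) x = ψ x * divergence T x + fderiv ℝ ψ x (T x) := by
  have h1 := (hψ.differentiable one_ne_zero) x
  have h2 := (hT.differentiable one_ne_zero) x
  unfold divergence
  rw [fderiv_fun_smul h1 h2]
  conv_rhs => rw [← sum_single_smul (T x)]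
  simp only [map_sum, map_smul, Finset.mul_sum, smul_eq_mul]
  rw [← Finset.sum_add_distrib]
  refine Finset.sum_congr rfl fun i _ => ?_
  simp [ContinuousLinearMap.smulRight_apply, mul_comm]

lemma divergence_const_smul {T : Space n → Space n} (hT : ContDiff ℝ 1 T) (c : ℝ) (x : Space n) :
    divergence (fun y => c • T y) x = c * divergence T x := by
  have := divergence_smul (ψ := fun _ => c) contDiff_const hT x
  simpa using this

lemma integral_divergence_eq_zero {T : Space n → Space n} (hT : ContDiff ℝ 1 T)
    (hc : HasCompactSupport T) : ∫ x, divergence T x = 0 := by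
  have hd := hc.fderiv ℝ
  have hcf := hT.continuous_fderiv one_ne_zero
  have key : ∀ i : Fin n, ∀ x, (fderiv ℝ T x (EuclideanSpace.single i 1)) i
      = fderiv ℝ (fun y => T y i) x (EuclideanSpace.single i 1) := by
    intro i x
    have h := ((EuclideanSpace.proj (𝕜 := ℝ) i).hasFDerivAt.comp x
      ((hT.differentiable one_ne_zero) x).hasFDerivAt).fderiv
    have h' : (fun y => T y i) = (EuclideanSpace.proj (𝕜 := ℝ) i) ∘ T := rfl
    rw [h', h]
    rfl
  have hint : ∀ i : Fin n,
      Integrable (fun x => (fderiv ℝ T x (EuclideanSpace.single i 1)) i) := by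
    intro i
    refine Continuous.integrable_of_hasCompactSupport (by fun_prop) ?_
    exact hd.comp_left (g := fun L : Space n →L[ℝ] Space n =>
      (L (EuclideanSpace.single i 1)) i) (by simp)
  unfold divergence
  rw [integral_finsetSum _ fun i _ => hint i]
  refine Finset.sum_eq_zero fun i _ => ?_
  have hTi : ContDiff ℝ 1 fun y => T y i :=
    (EuclideanSpace.proj (𝕜 := ℝ) i).contDiff.comp hT
  have hci : HasCompactSupport fun y => T y i :=
    hc.comp_left (g := fun v : Space n => v i) (by simp)
  have := integral_mul_fderiv_eq_neg_fderiv_mul_of_integrable (𝕜 := ℝ) (μ := volume)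
    (f := fun _ : Space n => (1 : ℝ)) (g := fun y => T y i)
    (v := EuclideanSpace.single i (1 : ℝ)) (by simp)
    (by simpa [key] using hint i)
    (by simpa using hTi.continuous.integrable_of_hasCompactSupport hci)
    (fun x _ => differentiableAt_const _)
    (fun x _ => (hTi.differentiable one_ne_zero) x)
  simpa [key] using this

lemma ofReal_setIntegral_divergence_le (E : Set (Space n)) {T : Space n → Space n}
    (hT : ContDiff ℝ 1 T) (hc : HasCompactSupport T) (h1 : ∀ x, ‖T x‖ ≤ 1) :
    ENNReal.ofReal (∫ x in E, divergence T x) ≤ perimeter E :=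
  le_iSup_of_le T (le_iSup_of_le hT (le_iSup_of_le hc (le_iSup_of_le h1 le_rfl)))

lemma setIntegral_divergence_le {E : Set (Space n)} (hP : perimeter E ≠ ⊤)
    {T : Space n → Space n} (hT : ContDiff ℝ 1 T) (hc : HasCompactSupport T) {c : ℝ}
    (h1 : ∀ x, ‖T x‖ ≤ c) :
    ∫ x in E, divergence T x ≤ c * (perimeter E).toReal := by
  have hc0 : 0 ≤ c := (norm_nonneg _).trans (h1 0)
  rcases hc0.eq_or_lt with rfl | hpos
  · have : T = fun _ => 0 := by
      ext1 x; simpa using h1 x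
    subst this
    simp [divergence]
  · have := ofReal_setIntegral_divergence_le E (T := fun x => c⁻¹ • T x) (hT.const_smul _)
      (hc.comp_left (g := fun v : Space n => c⁻¹ • v) (by simp)) (fun x => by
        rw [norm_smul, norm_inv, Real.norm_of_nonneg hc0, inv_mul_le_iff₀ hpos, mul_one]
        exact h1 x)
    rw [ENNReal.ofReal_le_iff_le_toReal hP] at this
    simp_rw [divergence_const_smul hT, integral_const_mul] at this
    rwa [inv_mul_le_iff₀ hpos] at this

lemma perimeter_le {E : Set (Space n)} {C : ℝ≥0∞}
    (h : ∀ T : Space n → Space n, ContDiff ℝ 1 T → HasCompactSupport T → (∀ x, ‖T x‖ ≤ 1) →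
      ENNReal.ofReal (∫ x in E, divergence T x) ≤ C) : perimeter E ≤ C :=
  iSup_le fun T => iSup_le fun hT => iSup_le fun hc => iSup_le fun h1 => h T hT hc h1

lemma perimeter_congr {E F : Set (Space n)} (h : E =ᵐ[volume] F) :
    perimeter E = perimeter F := by
  unfold perimeter
  simp_rw [setIntegral_congr_set h]

/-- Lower semicontinuity of the perimeter: it is a supremum of functionals that are continuous
for convergence in measure. -/
lemma perimeter_le_liminf {E : Set (Space n)} {F : ℕ → Set (Space n)}
    (hE : NullMeasurableSet E) (hF : ∀ k, NullMeasurableSet (F k))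
    (h : Tendsto (fun k => volume (symmDiff E (F k))) atTop (𝓝 0)) :
    perimeter E ≤ liminf (fun k => perimeter (F k)) atTop := by
  refine perimeter_le fun T hT hc h1 => ?_
  have := (ENNReal.continuous_ofReal.tendsto _).comp
    (tendsto_setIntegral_of_symmDiff (integrable_divergence hT hc) hE hF h)
  rw [← this.liminf_eq]
  exact liminf_le_liminf (Eventually.of_forall fun k =>
    ofReal_setIntegral_divergence_le (F k) hT hc h1)

/-- Shrinking does not increase the perimeter. Pulling test fields back by the dilation gives the
factor `c ^ (n - 1)`, of which only `c ^ (n - 1) ≤ 1` is kept. -/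
lemma perimeter_smul_le {E : Set (Space n)} {c : ℝ} (hn : 1 ≤ n) (hc0 : 0 < c) (hc1 : c ≤ 1) :
    perimeter (c • E) ≤ perimeter E := by
  refine perimeter_le fun T hT hc h1 => ?_
  have hTc : ContDiff ℝ 1 fun x => T (c • x) := hT.comp (contDiff_const_smul c)
  have hcc : HasCompactSupport fun x => T (c • x) :=
    hc.comp_homeomorph (Homeomorph.smulOfNeZero c hc0.ne')
  have hdiv : ∀ x, divergence (fun x => T (c • x)) x = c * divergence T (c • x) := by
    intro x
    unfold divergence
    have : fderiv ℝ (fun x => T (c • x)) x = c • fderiv ℝ T (c • x) := by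
      rw [fderiv_comp_smul]
    simp [this, Finset.mul_sum]
  have h2 := Measure.setIntegral_comp_smul volume (divergence T) E hc0.ne'
  rw [finrank_euclideanSpace, Fintype.card_fin, abs_of_pos (by positivity), smul_eq_mul] at h2
  have h3 : ∫ x in c • E, divergence T x
      = c ^ (n - 1) * ∫ x in E, divergence (fun x => T (c • x)) x := by
    simp_rw [hdiv, integral_const_mul, h2]
    obtain ⟨m, rfl⟩ := Nat.exists_eq_add_of_le' hn
    simp only [Nat.add_sub_cancel]
    field_simp
    ring
  have h4 := ofReal_setIntegral_divergence_le E hTc hcc fun x => h1 _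
  rw [h3]
  refine le_trans ?_ h4
  rw [ENNReal.ofReal_mul (by positivity)]
  calc _ ≤ ENNReal.ofReal 1 * _ := by gcongr; exact pow_le_one₀ hc0.le hc1
    _ = _ := by simp

/-! ### Adding a ball -/

/-- The basic estimate for adding a set `B` to `E`: if `ψ ≈ 1_B`, then
`(1 - ψ) 1_E + ψ ≈ 1_{E ∪ B}`, and the total variation of the left-hand side is at most `P(E) + ∫ |∇ψ|`. -/
lemma integral_cutoff_divergence_le {E : Set (Space n)} (hE : NullMeasurableSet E)
    (hP : perimeter E ≠ ⊤) {ψ : Space n → ℝ} (hψ : ContDiff ℝ 1 ψ) (h0 : ∀ x, 0 ≤ ψ x)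
    (h1 : ∀ x, ψ x ≤ 1) (hI : Integrable fun x => ‖fderiv ℝ ψ x‖)
    {T : Space n → Space n} (hT : ContDiff ℝ 1 T) (hc : HasCompactSupport T)
    (hT1 : ∀ x, ‖T x‖ ≤ 1) :
    (∫ x in E, (1 - ψ x) * divergence T x) + ∫ x, ψ x * divergence T x
      ≤ (perimeter E).toReal + ∫ x, ‖fderiv ℝ ψ x‖ := by
  have hψ' : ContDiff ℝ 1 fun x => 1 - ψ x := contDiff_const.sub hψ
  have hA := setIntegral_divergence_le hP (T := fun x => (1 - ψ x) • T x) (hψ'.smul hT)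
    (hc.smul_left (f := fun x => 1 - ψ x)) (c := 1) (fun x => by
      rw [norm_smul, Real.norm_of_nonneg (by linarith [h1 x])]
      exact mul_le_one₀ (by linarith [h0 x]) (norm_nonneg _) (hT1 x))
  have hB := integral_divergence_eq_zero (T := fun x => ψ x • T x) (hψ.smul hT)
    (hc.smul_left (f := ψ))
  have hcd := continuous_divergence hT
  have hcT := hT.continuous
  have hcψ := hψ.continuous
  have hcf := hψ.continuous_fderiv one_ne_zero
  have i1 : Integrable fun x => fderiv ℝ ψ x (T x) := by
    refine Continuous.integrable_of_hasCompactSupport (by fun_prop) ?_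
    exact hc.mono fun x hx => by
      contrapose! hx
      simp only [Function.mem_support, ne_eq, not_not] at hx ⊢
      simp [hx]
  have hcdiv := hasCompactSupport_divergence hc
  have i2 : Integrable fun x => ψ x * divergence T x :=
    Continuous.integrable_of_hasCompactSupport (by fun_prop) hcdiv.mul_left
  have i3 : Integrable fun x => (1 - ψ x) * divergence T x :=
    Continuous.integrable_of_hasCompactSupport (by fun_prop) hcdiv.mul_left
  have e1 : ∀ x, fderiv ℝ (fun x => 1 - ψ x) x = - fderiv ℝ ψ x := fun x => by
    rw [fderiv_const_sub]
  simp_rw [divergence_smul hψ' hT, e1, neg_apply] at hA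
  simp_rw [divergence_smul hψ hT] at hB
  rw [integral_add i2 i1] at hB
  rw [integral_add i3.integrableOn i1.integrableOn.fun_neg, integral_neg] at hA
  have hC : (∫ x in E, fderiv ℝ ψ x (T x)) - ∫ x, fderiv ℝ ψ x (T x) ≤ ∫ x, ‖fderiv ℝ ψ x‖ := by
    rw [← integral_indicator₀ hE, ← integral_sub (i1.indicator₀ hE) i1]
    refine integral_mono ((i1.indicator₀ hE).sub i1) hI fun x => ?_
    have hb : |fderiv ℝ ψ x (T x)| ≤ ‖fderiv ℝ ψ x‖ :=
      ((fderiv ℝ ψ x).le_opNorm (T x)).trans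
        (mul_le_of_le_one_right (norm_nonneg _) (hT1 x))
    by_cases hx : x ∈ E
    · simp [hx]
    · simp only [hx, not_false_eq_true, Set.indicator_of_notMem, zero_sub]
      exact (neg_le_abs _).trans hb
  linarith

/-- The perimeter of `E ∪ B` exceeds that of `E` by at most a bound `C` for the total variations
`∫ |∇ψ_k|` of functions `ψ_k` that approximate the indicator of `B`. -/
lemma perimeter_union_le {E B : Set (Space n)} (hE : NullMeasurableSet E)
    (hB : MeasurableSet B) {ψ : ℕ → Space n → ℝ} (hψ : ∀ k, ContDiff ℝ 1 (ψ k))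
    (h0 : ∀ k x, 0 ≤ ψ k x) (h1 : ∀ k x, ψ k x ≤ 1)
    (hI : ∀ k, Integrable fun x => ‖fderiv ℝ (ψ k) x‖) {C : ℝ}
    (hC : ∀ k, ∫ x, ‖fderiv ℝ (ψ k) x‖ ≤ C)
    (hlim : ∀ x, Tendsto (fun k => ψ k x) atTop (𝓝 (B.indicator 1 x))) :
    perimeter (E ∪ B) ≤ perimeter E + ENNReal.ofReal C := by
  by_cases hP : perimeter E = ⊤
  · simp [hP]
  refine perimeter_le fun T hT hc hT1 => ?_
  have hint := integrable_divergence hT hc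
  have hcψ := fun k => (hψ k).continuous
  have l1 : Tendsto (fun k => ∫ x in E, (1 - ψ k x) * divergence T x) atTop
      (𝓝 (∫ x in E, (1 - B.indicator 1 x) * divergence T x)) := by
    refine tendsto_integral_of_dominated_convergence (fun x => ‖divergence T x‖)
      (fun k => ?_) hint.norm.integrableOn (fun k => ?_) ?_
    · exact ((continuous_const.sub (hcψ k)).mul (continuous_divergence hT)).aestronglyMeasurable
    · refine Eventually.of_forall fun x => ?_
      rw [norm_mul, Real.norm_of_nonneg (by linarith [h1 k x])]
      exact mul_le_of_le_one_left (norm_nonneg _) (by linarith [h0 k x])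
    · exact Eventually.of_forall fun x => ((hlim x).const_sub 1).mul_const _
  have l2 : Tendsto (fun k => ∫ x, ψ k x * divergence T x) atTop
      (𝓝 (∫ x, B.indicator 1 x * divergence T x)) := by
    refine tendsto_integral_of_dominated_convergence (fun x => ‖divergence T x‖)
      (fun k => ?_) hint.norm (fun k => ?_) ?_
    · exact ((hcψ k).mul (continuous_divergence hT)).aestronglyMeasurable
    · refine Eventually.of_forall fun x => ?_
      rw [norm_mul, Real.norm_of_nonneg (h0 k x)]
      exact mul_le_of_le_one_left (norm_nonneg _) (h1 k x)
    · exact Eventually.of_forall fun x => (hlim x).mul_const _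
  have hle := le_of_tendsto' (l1.add l2) fun k =>
    (integral_cutoff_divergence_le hE hP (hψ k) (h0 k) (h1 k) (hI k) hT hc hT1).trans
      (add_le_add_right (hC k) _)
  have hEq : ∫ x in E ∪ B, divergence T x
      = (∫ x in E, (1 - B.indicator 1 x) * divergence T x)
        + ∫ x, B.indicator 1 x * divergence T x := by
    have a1 : (fun x => B.indicator 1 x * divergence T x) = B.indicator (divergence T) := by
      ext x; by_cases hx : x ∈ B <;> simp [hx]
    have a2 : (fun x => (1 - B.indicator 1 x) * divergence T x) = Bᶜ.indicator (divergence T) := by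
      ext x; by_cases hx : x ∈ B <;> simp [hx]
    rw [a1, a2, ← integral_indicator₀ (hE.union hB.nullMeasurableSet), ← integral_indicator₀ hE,
      ← integral_add ((hint.indicator hB.compl).indicator₀ hE) (hint.indicator hB)]
    congr 1
    ext x
    by_cases h1 : x ∈ E <;> by_cases h2 : x ∈ B <;> simp [h1, h2]
  rw [hEq]
  calc _ ≤ ENNReal.ofReal ((perimeter E).toReal + C) := ENNReal.ofReal_le_ofReal hle
    _ ≤ _ := by
      refine ENNReal.ofReal_add_le.trans ?_
      rw [ENNReal.ofReal_toReal hP]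

/-- The derivative of `Real.smoothTransition` is bounded, and vanishes outside `[0, 1]`. -/
lemma exists_bound_deriv_smoothTransition : ∃ L : ℝ, 0 ≤ L ∧
    ∀ t, |deriv Real.smoothTransition t| ≤ (Set.Icc (0 : ℝ) 1).indicator (fun _ => L) t := by
  have hc : Continuous (deriv Real.smoothTransition) :=
    (Real.smoothTransition.contDiff (n := 1)).continuous_deriv le_rfl
  obtain ⟨L, hL⟩ := isCompact_Icc.exists_bound_of_continuousOn (s := Set.Icc (0 : ℝ) 1)
    hc.continuousOn
  refine ⟨L, (norm_nonneg _).trans (hL 0 (by simp)), fun t => ?_⟩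
  by_cases ht : t ∈ Set.Icc (0 : ℝ) 1
  · simpa [ht] using hL t ht
  · rw [Set.indicator_of_notMem ht]
    rw [Set.mem_Icc, not_and_or, not_le, not_le] at ht
    rcases ht with ht | ht
    · have : Real.smoothTransition =ᶠ[𝓝 t] fun _ => 0 := by
        filter_upwards [eventually_lt_nhds ht] with s hs
        exact Real.smoothTransition.zero_of_nonpos hs.le
      simp [this.deriv_eq]
    · have : Real.smoothTransition =ᶠ[𝓝 t] fun _ => 1 := by
        filter_upwards [eventually_gt_nhds ht] with s hs
        exact Real.smoothTransition.one_of_one_le hs.le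
      simp [this.deriv_eq]

/-- The shell on which the cut-off functions used for the ball vary is thin. -/
lemma volume_shell_le [NeZero n] (x₀ : Space n) {r : ℝ} (hr : 0 < r) (k : ℕ) :
    volume (Metric.closedBall x₀ r \ Metric.ball x₀ (r * (1 - 1 / (k + 1))))
      ≤ ENNReal.ofReal (r ^ n * (n / (k + 1)) * volume.real (Metric.ball (0 : Space n) 1)) := by
  have hk : (1 : ℝ) / (k + 1) ≤ 1 := by
    rw [div_le_one (by positivity)]; linarith [(Nat.cast_nonneg k : (0 : ℝ) ≤ k)]
  have hs : 0 ≤ r * (1 - 1 / ((k : ℝ) + 1)) := mul_nonneg hr.le (by linarith)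
  have hsr : r * (1 - 1 / ((k : ℝ) + 1)) ≤ r :=
    mul_le_of_le_one_right hr.le (by linarith [show (0:ℝ) ≤ 1 / (k + 1) by positivity])
  have hsub : Metric.ball x₀ (r * (1 - 1 / ((k : ℝ) + 1))) ⊆ Metric.closedBall x₀ r :=
    (Metric.ball_subset_ball hsr).trans Metric.ball_subset_closedBall
  rw [measure_sdiff hsub measurableSet_ball.nullMeasurableSet measure_ball_lt_top.ne,
    Measure.addHaar_closedBall_eq_addHaar_ball, Measure.addHaar_ball _ _ hr.le,
    Measure.addHaar_ball _ _ hs, finrank_euclideanSpace, Fintype.card_fin,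
    ← ENNReal.ofReal_toReal (measure_ball_lt_top (x := (0 : Space n)) (r := 1)).ne,
    ← ENNReal.ofReal_mul (by positivity), ← ENNReal.ofReal_mul (by positivity),
    ← ENNReal.ofReal_sub _ (by positivity)]
  refine ENNReal.ofReal_le_ofReal ?_
  rw [Measure.real, mul_pow, ← sub_mul]
  refine mul_le_mul_of_nonneg_right ?_ ENNReal.toReal_nonneg
  have hb := one_add_mul_le_pow (a := -(1 / ((k : ℝ) + 1))) (by linarith) n
  have : (1 : ℝ) - (1 + -(1 / (k + 1))) ^ n ≤ n / (k + 1) := by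
    have e : (n : ℝ) * -(1 / (k + 1)) = - (n / (k + 1)) := by ring
    linarith
  have h2 := mul_le_mul_of_nonneg_left this (pow_pos hr n).le
  rw [← sub_eq_add_neg] at h2
  linarith

/-- Adding a ball of radius `r` raises the perimeter by at most a constant times `r ^ (n - 1)`. -/
lemma exists_perimeter_union_ball_le (hn : 1 ≤ n) :
    ∃ C : ℝ, 0 ≤ C ∧ ∀ (E : Set (Space n)), NullMeasurableSet E → ∀ (x₀ : Space n) (r : ℝ), 0 < r →
      perimeter (E ∪ Metric.ball x₀ r) ≤ perimeter E + ENNReal.ofReal (C * r ^ (n - 1)) := by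
  have : NeZero n := ⟨by omega⟩
  obtain ⟨L, hL0, hL⟩ := exists_bound_deriv_smoothTransition
  refine ⟨L * 2 * n * volume.real (Metric.ball (0 : Space n) 1), by positivity,
    fun E hE x₀ r hr => ?_⟩
  -- The cut-off `ψ k` rises from `0` to `1` in a shell of volume `O(r ^ n / k)` inside the ball,
  -- where its gradient is `O(k / r)`. The squared norm keeps it smooth at the centre.
  let q : ℕ → Space n → ℝ := fun k x => (k + 1) * (1 - ‖x - x₀‖ ^ 2 / r ^ 2)
  let ψ : ℕ → Space n → ℝ := fun k x => Real.smoothTransition (q k x)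
  have hq : ∀ k x, HasFDerivAt (q k)
      ((-((k + 1) * 2 / r ^ 2) : ℝ) • innerSL ℝ (x - x₀)) x := by
    intro k x
    have h := ((hasFDerivAt_id x).sub_const x₀).norm_sq
    have h2 := ((h.mul_const ((r ^ 2)⁻¹)).const_sub 1).const_mul ((k : ℝ) + 1)
    refine (h2.congr_fderiv ?_).congr_of_eventuallyEq (Eventually.of_forall fun y => ?_)
    · ext v
      simp
      ring
    · simp [q, div_eq_mul_inv]
  have hψd : ∀ k, ContDiff ℝ 1 (ψ k) := by
    intro k
    refine (Real.smoothTransition.contDiff (n := 1)).comp ?_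
    exact contDiff_const.mul (contDiff_const.sub
      (((contDiff_id.sub contDiff_const).norm_sq ℝ).div_const _))
  have hbound : ∀ k x, ‖fderiv ℝ (ψ k) x‖ ≤ (Metric.closedBall x₀ r \
      Metric.ball x₀ (r * (1 - 1 / (k + 1)))).indicator (fun _ => L * ((k + 1) * 2 / r)) x := by
    intro k x
    have hS : DifferentiableAt ℝ Real.smoothTransition (q k x) :=
      ((Real.smoothTransition.contDiff (n := 1)).differentiable one_ne_zero) _
    have hf := (hS.hasDerivAt.comp_hasFDerivAt x (hq k x)).fderiv
    rw [show fderiv ℝ (ψ k) x = _ from hf, norm_smul, norm_smul, innerSL_apply_norm]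
    have hk1 : (0 : ℝ) < k + 1 := by positivity
    by_cases hx : q k x ∈ Set.Icc (0 : ℝ) 1
    · have h1 := hL (q k x)
      rw [Set.indicator_of_mem hx] at h1
      have hsq1 : ‖x - x₀‖ ^ 2 / r ^ 2 ≤ 1 := by
        have := nonneg_of_mul_nonneg_right hx.1 hk1
        linarith
      have hxr : ‖x - x₀‖ ≤ r := by
        rw [div_le_one (by positivity)] at hsq1
        exact le_of_sq_le_sq hsq1 hr.le
      have hmem : x ∈ Metric.closedBall x₀ r \ Metric.ball x₀ (r * (1 - 1 / (k + 1))) := by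
        refine ⟨by simpa [dist_eq_norm] using hxr, ?_⟩
        rw [Metric.mem_ball, dist_eq_norm, not_lt]
        have h3 : 1 - 1 / ((k : ℝ) + 1) ≤ ‖x - x₀‖ ^ 2 / r ^ 2 := by
          have := hx.2
          simp only [q] at this
          rw [← le_div_iff₀' hk1] at this
          linarith
        have h4 : (‖x - x₀‖ / r) ^ 2 ≤ ‖x - x₀‖ / r := by
          have : ‖x - x₀‖ / r ≤ 1 := (div_le_one hr).2 hxr
          have h0 : 0 ≤ ‖x - x₀‖ / r := by positivity
          nlinarith
        rw [← div_pow] at h3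
        have := h3.trans h4
        rwa [le_div_iff₀ hr, mul_comm] at this
      rw [Set.indicator_of_mem hmem, Real.norm_eq_abs, Real.norm_eq_abs, abs_neg,
        abs_of_nonneg (show (0 : ℝ) ≤ (k + 1) * 2 / r ^ 2 by positivity)]
      have h5 : (k + 1) * 2 / r ^ 2 * ‖x - x₀‖ ≤ ((k : ℝ) + 1) * 2 / r := by
        calc (k + 1) * 2 / r ^ 2 * ‖x - x₀‖ ≤ ((k : ℝ) + 1) * 2 / r ^ 2 * r := by gcongr
          _ = _ := by field_simp
      exact mul_le_mul h1 h5 (by positivity) hL0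
    · have h1 := hL (q k x)
      rw [Set.indicator_of_notMem hx] at h1
      rw [Real.norm_eq_abs, le_antisymm h1 (abs_nonneg _), zero_mul]
      exact Set.indicator_nonneg (fun _ _ => by positivity) _
  have hfin : ∀ k : ℕ, volume (Metric.closedBall x₀ r \
      Metric.ball x₀ (r * (1 - 1 / (k + 1)))) ≠ ⊤ := fun k =>
    ne_top_of_le_ne_top ENNReal.ofReal_ne_top (volume_shell_le x₀ hr k)
  have hind : ∀ k : ℕ, Integrable ((Metric.closedBall x₀ r \
      Metric.ball x₀ (r * (1 - 1 / ((k : ℝ) + 1)))).indicator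
        (fun _ => L * (((k : ℝ) + 1) * 2 / r))) := fun k => by
    rw [integrable_indicator_iff (measurableSet_closedBall.diff measurableSet_ball)]
    exact integrableOn_const (hfin k)
  have hI : ∀ k, Integrable fun x => ‖fderiv ℝ (ψ k) x‖ := fun k =>
    (hind k).mono' ((hψd k).continuous_fderiv one_ne_zero).norm.aestronglyMeasurable
      (Eventually.of_forall fun x => by simpa using hbound k x)
  refine perimeter_union_le hE measurableSet_ball hψd
    (fun k x => Real.smoothTransition.nonneg _) (fun k x => Real.smoothTransition.le_one _)
    hI (fun k => ?_) (fun x => ?_)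
  · refine (integral_mono (hI k) (hind k) (hbound k)).trans ?_
    rw [integral_indicator_const _ (measurableSet_closedBall.diff measurableSet_ball), smul_eq_mul]
    have hv := ENNReal.toReal_le_of_le_ofReal (by positivity) (volume_shell_le x₀ hr k)
    calc _ ≤ (r ^ n * (n / (k + 1)) * volume.real (Metric.ball (0 : Space n) 1))
          * (L * ((k + 1) * 2 / r)) := mul_le_mul_of_nonneg_right hv (by positivity)
      _ = _ := by
        obtain ⟨m, rfl⟩ := Nat.exists_eq_add_of_le' hn
        simp only [Nat.add_sub_cancel]
        field_simp
        ring
  · by_cases hx : x ∈ Metric.ball x₀ r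
    · rw [Set.indicator_of_mem hx]
      have hpos : 0 < 1 - ‖x - x₀‖ ^ 2 / r ^ 2 := by
        rw [Metric.mem_ball, dist_eq_norm] at hx
        rw [sub_pos, div_lt_one (by positivity)]
        gcongr
      obtain ⟨N, hN⟩ := exists_nat_gt (1 / (1 - ‖x - x₀‖ ^ 2 / r ^ 2))
      refine tendsto_const_nhds.congr' ?_
      filter_upwards [eventually_ge_atTop N] with k hk
      refine (Real.smoothTransition.one_of_one_le ?_).symm
      have : (N : ℝ) ≤ k := by exact_mod_cast hk
      rw [div_lt_iff₀ hpos] at hN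
      simp only [q]
      nlinarith
    · rw [Set.indicator_of_notMem hx]
      refine tendsto_const_nhds.congr fun k => ?_
      refine (Real.smoothTransition.zero_of_nonpos ?_).symm
      rw [Metric.mem_ball, dist_eq_norm, not_lt] at hx
      have : 1 ≤ ‖x - x₀‖ ^ 2 / r ^ 2 := by
        rw [one_le_div (by positivity)]; gcongr
      exact mul_nonpos_of_nonneg_of_nonpos (by positivity) (by linarith)

lemma perimeter_empty : perimeter (∅ : Set (Space n)) = 0 := by
  simp [perimeter]

lemma perimeter_ball_ne_top (hn : 1 ≤ n) : perimeter (Metric.ball (0 : Space n) 1) ≠ ⊤ := by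
  obtain ⟨C, -, hC⟩ := exists_perimeter_union_ball_le hn
  have := hC ∅ nullMeasurableSet_empty 0 1 one_pos
  rw [Set.empty_union, perimeter_empty, zero_add] at this
  exact ne_top_of_le_ne_top ENNReal.ofReal_ne_top this

/-! ### Translates of sets of finite perimeter -/

/-- The fundamental theorem of calculus along `t ↦ y - t z`; for each `t` the integrand is the
divergence of the field `-φ(· - t z) z`. -/
lemma setIntegral_translate_sub_le {E : Set (Space n)} (hfin : volume E ≠ ⊤)
    (hP : perimeter E ≠ ⊤) {φ : Space n → ℝ} (hφ : ContDiff ℝ 1 φ) (hc : HasCompactSupport φ)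
    (h1 : ∀ x, ‖φ x‖ ≤ 1) (z : Space n) :
    ∫ y in E, (φ (y - z) - φ y) ≤ ‖z‖ * (perimeter E).toReal := by
  have : IsFiniteMeasure ((volume : Measure (Space n)).restrict E) :=
    isFiniteMeasure_restrict.2 hfin
  have hcf := hφ.continuous_fderiv one_ne_zero
  have hftc : ∀ y, φ (y - z) - φ y = ∫ t in (0 : ℝ)..1, fderiv ℝ φ (y - t • z) (-z) := by
    intro y
    have hd : ∀ t ∈ Set.uIcc (0 : ℝ) 1,
        HasDerivAt (fun t : ℝ => φ (y - t • z)) (fderiv ℝ φ (y - t • z) (-z)) t := by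
      intro t _
      have h2 : HasDerivAt (fun t : ℝ => y - t • z) (-z) t := by
        simpa using ((hasDerivAt_id t).smul_const z).const_sub y
      exact ((hφ.differentiable one_ne_zero) (y - t • z)).hasFDerivAt.comp_hasDerivAt t h2
    rw [intervalIntegral.integral_eq_sub_of_hasDerivAt hd]
    · simp
    · exact Continuous.intervalIntegrable (by fun_prop) _ _
  obtain ⟨M, hM⟩ := (hc.fderiv ℝ).exists_bound_of_continuous hcf
  have hint : Integrable (Function.uncurry fun (t : ℝ) (y : Space n) =>
      fderiv ℝ φ (y - t • z) (-z))
      ((volume.restrict (Set.uIoc (0 : ℝ) 1)).prod (volume.restrict E)) := by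
    have : IsFiniteMeasure (volume.restrict (Set.uIoc (0 : ℝ) 1)) :=
      isFiniteMeasure_restrict.2 (by simp)
    refine Integrable.of_bound (C := M * ‖z‖) ?_ (Eventually.of_forall fun p => ?_)
    · refine Continuous.aestronglyMeasurable ?_
      unfold Function.uncurry
      fun_prop
    · refine (ContinuousLinearMap.le_opNorm _ _).trans ?_
      rw [norm_neg]
      exact mul_le_mul_of_nonneg_right (hM _) (norm_nonneg _)
  simp_rw [hftc]
  rw [← intervalIntegral_integral_swap hint]
  have hle : ∀ t : ℝ, ∫ y in E, fderiv ℝ φ (y - t • z) (-z) ≤ ‖z‖ * (perimeter E).toReal := by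
    intro t
    have hφt : ContDiff ℝ 1 fun y => φ (y - t • z) := hφ.comp (contDiff_id.sub contDiff_const)
    have hct : HasCompactSupport fun y => φ (y - t • z) := by
      simpa [sub_eq_add_neg, Function.comp_def] using
        hc.comp_homeomorph (Homeomorph.addRight (-(t • z)))
    have h2 := setIntegral_divergence_le hP (T := fun y => φ (y - t • z) • (-z))
      (hφt.smul contDiff_const) hct.smul_right (c := ‖z‖) (fun x => by
        rw [norm_smul, norm_neg]
        exact mul_le_of_le_one_left (norm_nonneg _) (h1 _))
    refine le_trans (le_of_eq (integral_congr_ae (Eventually.of_forall fun y => ?_))) h2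
    simp only
    rw [divergence_smul hφt (T := fun _ => -z) contDiff_const, fderiv_comp_sub]
    simp [divergence]
  rw [intervalIntegral.integral_of_le zero_le_one]
  rw [Set.uIoc_of_le zero_le_one] at hint
  calc ∫ t in Set.Ioc (0 : ℝ) 1, ∫ y in E, fderiv ℝ φ (y - t • z) (-z)
      ≤ ∫ t in Set.Ioc (0 : ℝ) 1, ‖z‖ * (perimeter E).toReal :=
        integral_mono hint.integral_prod_left (integrable_const _) hle
    _ = _ := by simp

/-- Translating a bounded set of finite perimeter by `z` changes it by measure at most `|z| P(E)`:
test the previous inequality with mollifications of the sign of `1_{E - z} - 1_E`. -/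
lemma volume_symmDiff_translate_le {E : Set (Space n)} (hE : MeasurableSet E) {M : ℝ}
    (hEM : E ⊆ Metric.ball 0 M) (hP : perimeter E ≠ ⊤) (z : Space n) :
    volume (symmDiff E ((fun y => y + z) ⁻¹' E)) ≤ ENNReal.ofReal (‖z‖ * (perimeter E).toReal) := by
  have hfin : volume E ≠ ⊤ := ne_top_of_le_ne_top measure_ball_lt_top.ne (measure_mono hEM)
  set E' := (fun y => y + z) ⁻¹' E with hE'
  have hE'm : MeasurableSet E' := (measurable_add_const z) hE
  have hE'fin : volume E' ≠ ⊤ := by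
    rw [hE', measure_preimage_add_right]; exact hfin
  -- `s` takes the values `-1`, `0`, `1`, and `s ^ 2` is the indicator of the symmetric difference.
  let s : Space n → ℝ := fun y => E'.indicator 1 y - E.indicator 1 y
  have hs1 : ∀ y, ‖s y‖ ≤ 1 := by
    intro y
    by_cases h1 : y ∈ E' <;> by_cases h2 : y ∈ E <;> simp [s, h1, h2]
  have iE : Integrable (E.indicator (1 : Space n → ℝ)) :=
    (integrable_indicator_iff hE).2 (integrableOn_const hfin)
  have iE' : Integrable (E'.indicator (1 : Space n → ℝ)) :=
    (integrable_indicator_iff hE'm).2 (integrableOn_const hE'fin)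
  have hsint : Integrable s := iE'.sub iE
  have hsc : HasCompactSupport s := by
    refine HasCompactSupport.intro (isCompact_closedBall (0 : Space n) (M + ‖z‖)) fun x hx => ?_
    rw [mem_closedBall_zero_iff, not_le] at hx
    have h1 : x ∉ E := fun h => by
      have := mem_ball_zero_iff.1 (hEM h); linarith [norm_nonneg z]
    have h2 : x ∉ E' := fun h => by
      have h3 := mem_ball_zero_iff.1 (hEM (show x + z ∈ E from h))
      have h4 := norm_sub_le (x + z) z
      rw [add_sub_cancel_right] at h4
      linarith
    simp [s, h1, h2]
  let η : ℕ → ContDiffBump (0 : Space n) := fun j =>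
    ⟨1 / (j + 1), 2 / (j + 1), by positivity, by gcongr; norm_num⟩
  let φ : ℕ → Space n → ℝ := fun j =>
    convolution ((η j).normed volume) s (ContinuousLinearMap.lsmul ℝ ℝ) volume
  have hlim : ∀ᵐ x ∂(volume : Measure (Space n)), Tendsto (fun j => φ j x) atTop (𝓝 (s x)) := by
    refine ContDiffBump.ae_convolution_tendsto_right_of_locallyIntegrable (K := 2) ?_ ?_
      hsint.locallyIntegrable
    · have := (tendsto_one_div_add_atTop_nhds_zero_nat (𝕜 := ℝ)).const_mul 2
      simpa [η, div_eq_mul_inv] using this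
    · exact Eventually.of_forall fun j => by simp [η, div_eq_mul_inv]
  have hφ : ∀ j, ContDiff ℝ 1 (φ j) := fun j =>
    (η j).hasCompactSupport_normed.contDiff_convolution_left _ (n := 1) (η j).contDiff_normed
      hsint.locallyIntegrable
  have hφc : ∀ j, HasCompactSupport (φ j) := fun j =>
    (η j).hasCompactSupport_normed.convolution _ hsc
  have hφ1 : ∀ j x, ‖φ j x‖ ≤ 1 := by
    intro j x
    have := norm_integral_le_of_norm_le (f := fun t => (ContinuousLinearMap.lsmul ℝ ℝ)
      ((η j).normed volume t) (s (x - t))) (μ := volume) (η j).integrable_normed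
      (Eventually.of_forall fun t => by
        rw [ContinuousLinearMap.lsmul_apply, norm_smul,
          Real.norm_of_nonneg ((η j).nonneg_normed t)]
        exact mul_le_of_le_one_right ((η j).nonneg_normed t) (hs1 _))
    rwa [(η j).integral_normed] at this
  have htest : ∀ j, ∫ y, s y * φ j y ≤ ‖z‖ * (perimeter E).toReal := by
    intro j
    refine le_trans (le_of_eq ?_) (setIntegral_translate_sub_le hfin hP (hφ j) (hφc j) (hφ1 j) z)
    have iφ : Integrable (φ j) := (hφ j).continuous.integrable_of_hasCompactSupport (hφc j)
    rw [integral_sub (iφ.comp_sub_right z).integrableOn iφ.integrableOn,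
      ← integral_indicator hE, ← integral_indicator hE]
    have e1 : ∫ y, E.indicator (fun y => φ j (y - z)) y = ∫ y, E'.indicator (φ j) y := by
      rw [← integral_add_right_eq_self _ z]
      congr 1; ext y
      by_cases h : y + z ∈ E
      · have h' : y ∈ E' := h
        simp [h, h']
      · have h' : y ∉ E' := h
        simp [h, h']
    rw [e1, ← integral_sub (iφ.indicator hE'm) (iφ.indicator hE)]
    congr 1; ext y
    by_cases h1 : y ∈ E' <;> by_cases h2 : y ∈ E <;> simp [s, h1, h2]
  have hconv : Tendsto (fun j => ∫ y, s y * φ j y) atTop (𝓝 (∫ y, s y * s y)) := by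
    refine tendsto_integral_of_dominated_convergence (fun y => ‖s y‖) (fun j => ?_) hsint.norm
      (fun j => Eventually.of_forall fun y => ?_) ?_
    · exact hsint.aestronglyMeasurable.mul (hφ j).continuous.aestronglyMeasurable
    · rw [norm_mul]; exact mul_le_of_le_one_right (norm_nonneg _) (hφ1 j y)
    · filter_upwards [hlim] with y hy using hy.const_mul _
  have hfinal := le_of_tendsto' hconv htest
  have hsq : (fun y => s y * s y) = (symmDiff E E').indicator 1 := by
    ext y
    by_cases h1 : y ∈ E' <;> by_cases h2 : y ∈ E <;> simp [s, h1, h2, Set.mem_symmDiff]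
  rw [hsq, integral_indicator_one (hE.symmDiff hE'm)] at hfinal
  rw [← ENNReal.ofReal_toReal (measure_symmDiff_ne_top hfin hE'fin)]
  exact ENNReal.ofReal_le_ofReal hfinal

/-! ### Compactness of sets of bounded perimeter -/

/-- Sets with summable consecutive differences converge in measure (to their limit superior). -/
lemma exists_tendsto_symmDiff_of_tsum_ne_top {X : Type*} [MeasurableSpace X] {μ : Measure X}
    {E : ℕ → Set X} (hE : ∀ k, MeasurableSet (E k))
    (h : ∑' k, μ (symmDiff (E k) (E (k + 1))) ≠ ⊤) :
    MeasurableSet (limsup E atTop) ∧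
      Tendsto (fun k => μ (symmDiff (limsup E atTop) (E k))) atTop (𝓝 0) := by
  refine ⟨MeasurableSet.measurableSet_limsup hE, ?_⟩
  have hsub : ∀ k, symmDiff (limsup E atTop) (E k) ⊆
      ⋃ i, symmDiff (E (i + k)) (E (i + k + 1)) := by
    intro k x hx
    by_contra hcon
    simp only [Set.mem_iUnion, not_exists] at hcon
    have hall : ∀ i, (x ∈ E (i + k) ↔ x ∈ E k) := by
      intro i
      induction i with
      | zero => simp
      | succ i ih =>
        have := hcon i
        rw [Set.mem_symmDiff] at this
        rw [show i + 1 + k = i + k + 1 by ring]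
        tauto
    have hlim : x ∈ limsup E atTop ↔ x ∈ E k := by
      rw [mem_limsup_iff_frequently_mem]
      constructor
      · intro hf
        obtain ⟨j, hj, hjx⟩ := (frequently_atTop.1 hf) k
        obtain ⟨i, rfl⟩ := Nat.exists_eq_add_of_le' hj
        exact (hall i).1 hjx
      · intro hk
        refine Eventually.frequently ?_
        filter_upwards [eventually_ge_atTop k] with j hj
        obtain ⟨i, rfl⟩ := Nat.exists_eq_add_of_le' hj
        exact (hall i).2 hk
    rw [Set.mem_symmDiff] at hx
    tauto
  have h0 := ENNReal.tendsto_sum_nat_add (fun k => μ (symmDiff (E k) (E (k + 1)))) h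
  exact tendsto_of_tendsto_of_tendsto_of_le_of_le tendsto_const_nhds h0 (fun _ => zero_le)
    fun k => (measure_mono (hsub k)).trans (measure_iUnion_le _)

/-- If a sequence of sets is Cauchy in measure, a subsequence converges in measure. -/
lemma exists_subseq_tendsto_symmDiff {X : Type*} [MeasurableSpace X] {μ : Measure X}
    {E : ℕ → Set X} (hE : ∀ k, MeasurableSet (E k))
    (h : ∀ ε : ℝ≥0∞, 0 < ε → ∃ N, ∀ k ≥ N, ∀ l ≥ N, μ (symmDiff (E k) (E l)) ≤ ε) :
    ∃ (σ : ℕ → ℕ) (F : Set X), StrictMono σ ∧ MeasurableSet F ∧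
      Tendsto (fun k => μ (symmDiff F (E (σ k)))) atTop (𝓝 0) := by
  obtain ⟨ε, hε, hsum⟩ := ENNReal.exists_pos_sum_of_countable' one_ne_zero ℕ
  choose N hN using fun k => h (ε k) (hε k)
  obtain ⟨σ, hσ, hσN⟩ := Filter.extraction_forall_of_eventually
    (P := fun k j => N k ≤ j) fun k => eventually_ge_atTop (N k)
  have hs : ∑' k, μ (symmDiff (E (σ k)) (E (σ (k + 1)))) ≠ ⊤ :=
    ne_top_of_le_ne_top (hsum.trans ENNReal.one_lt_top).ne
      (ENNReal.tsum_le_tsum fun k => hN k _ (hσN k) _ ((hσN k).trans (hσ (Nat.lt_succ_self k)).le))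
  obtain ⟨h1, h2⟩ := exists_tendsto_symmDiff_of_tsum_ne_top (fun k => hE (σ k)) hs
  exact ⟨σ, _, hσ, h1, h2⟩

lemma tendsto_volume_symmDiff_ball (x : Space n) (δ : ℝ) :
    Tendsto (fun x' => volume (symmDiff (Metric.ball x' δ) (Metric.ball x δ))) (𝓝 x) (𝓝 0) := by
  let f : C(Space n, C(Space n, Space n)) :=
    ContinuousMap.curry ⟨fun p => p.2 - p.1, by fun_prop⟩
  have hmp : ∀ a, MeasurePreserving (f a) volume volume := fun a =>
    measurePreserving_sub_right volume a
  have hpre : ∀ a, f a ⁻¹' (Metric.ball 0 δ) = Metric.ball a δ := by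
    intro a; ext y
    simp [f, dist_eq_norm]
  have := tendsto_measure_symmDiff_preimage_nhds_zero (f.continuous.tendsto x)
    (Eventually.of_forall hmp) (hmp x)
    (measurableSet_ball (x := (0 : Space n)) (ε := δ)).nullMeasurableSet measure_ball_lt_top.ne
  simpa [hpre] using this

lemma abs_measureReal_inter_sub_le {X : Type*} [MeasurableSpace X] {μ : Measure X} (E : Set X)
    {A B : Set X} (hA : μ A ≠ ⊤) (hB : μ B ≠ ⊤) :
    |μ.real (E ∩ A) - μ.real (E ∩ B)| ≤ μ.real (symmDiff A B) := by
  have hfin := measure_symmDiff_ne_top hA hB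
  have key : ∀ A B : Set X, μ B ≠ ⊤ → μ (symmDiff A B) ≠ ⊤ →
      μ.real (E ∩ A) ≤ μ.real (E ∩ B) + μ.real (symmDiff A B) := by
    intro A B hB hfin
    refine (measureReal_mono (μ := μ) (s₂ := (E ∩ B) ∪ symmDiff A B) (fun x hx => ?_)
      (measure_union_ne_top (measure_inter_ne_top_of_right_ne_top hB) hfin)).trans
        (measureReal_union_le _ _)
    by_cases h : x ∈ B
    · exact Or.inl ⟨hx.1, h⟩
    · exact Or.inr (Or.inl ⟨hx.2, h⟩)
  rw [abs_le]
  have h1 := key A B hB hfin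
  have h2 := key B A hA (by rwa [symmDiff_comm])
  rw [symmDiff_comm] at h2
  constructor <;> linarith

/-- Averaging over balls of radius `δ` moves the indicator of a set of finite perimeter by at most
`δ P(E)` in `L¹`. Here the difference is written, at each `x`, as the measure of the points of
the ball on which the indicator takes the other value. -/
lemma lintegral_volume_ball_xor_le {E : Set (Space n)} (hE : MeasurableSet E) {M : ℝ}
    (hEM : E ⊆ Metric.ball 0 M) (hP : perimeter E ≠ ⊤) (δ : ℝ) :
    ∫⁻ x, volume {z | z ∈ Metric.ball (0 : Space n) δ ∧ x ∈ symmDiff E ((fun y => y + z) ⁻¹' E)}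
      ≤ volume (Metric.ball (0 : Space n) δ) * ENNReal.ofReal (δ * (perimeter E).toReal) := by
  have hS : MeasurableSet {p : Space n × Space n |
      p.2 ∈ Metric.ball (0 : Space n) δ ∧ p.1 ∈ symmDiff E ((fun y => y + p.2) ⁻¹' E)} := by
    refine (measurable_snd measurableSet_ball).inter ?_
    exact (measurable_fst hE).symmDiff ((measurable_fst.add measurable_snd) hE)
  have h := Measure.prod_apply (μ := (volume : Measure (Space n)))
    (ν := (volume : Measure (Space n))) hS
  have h2 := Measure.prod_apply_symm (μ := (volume : Measure (Space n)))
    (ν := (volume : Measure (Space n))) hS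
  have e1 : ∫⁻ x, volume {z | z ∈ Metric.ball (0 : Space n) δ ∧
      x ∈ symmDiff E ((fun y => y + z) ⁻¹' E)} = _ := h.symm.trans h2
  rw [e1]
  calc _ ≤ ∫⁻ z, (Metric.ball (0 : Space n) δ).indicator
        (fun _ => ENNReal.ofReal (δ * (perimeter E).toReal)) z := by
        refine lintegral_mono fun z => ?_
        by_cases hz : z ∈ Metric.ball (0 : Space n) δ
        · rw [Set.indicator_of_mem hz]
          refine (measure_mono (t := symmDiff E ((fun y => y + z) ⁻¹' E)) fun x hx => hx.2).trans ?_
          refine (volume_symmDiff_translate_le hE hEM hP z).trans ?_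
          gcongr
          exact (mem_ball_zero_iff.1 hz).le
        · rw [Set.indicator_of_notMem hz]
          refine le_of_eq (measure_mono_null (t := ∅) (fun x hx => hz hx.1) (by simp))
    _ = _ := by
      rw [lintegral_indicator_const measurableSet_ball, mul_comm]

/-- The measure of the symmetric difference of two sets is controlled by the `L¹` distance of their
averages over balls of radius `δ`, up to an error `δ (P(E) + P(F))`. -/
lemma volume_mul_symmDiff_le {E F : Set (Space n)} (hE : MeasurableSet E) (hF : MeasurableSet F)
    {M : ℝ} (hEM : E ⊆ Metric.ball 0 M) (hFM : F ⊆ Metric.ball 0 M)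
    (hPE : perimeter E ≠ ⊤) (hPF : perimeter F ≠ ⊤) (δ : ℝ) :
    volume (Metric.ball (0 : Space n) δ) * volume (symmDiff E F) ≤
      volume (Metric.ball (0 : Space n) δ) * ENNReal.ofReal (δ * (perimeter E).toReal)
      + volume (Metric.ball (0 : Space n) δ) * ENNReal.ofReal (δ * (perimeter F).toReal)
      + ∫⁻ x in Metric.ball (0 : Space n) M, ENNReal.ofReal
          |volume.real (E ∩ Metric.ball x δ) - volume.real (F ∩ Metric.ball x δ)| := by
  let g : Set (Space n) → Space n → ℝ≥0∞ := fun E x =>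
    volume {z | z ∈ Metric.ball (0 : Space n) δ ∧ x ∈ symmDiff E ((fun y => y + z) ⁻¹' E)}
  have hg : ∀ E : Set (Space n), MeasurableSet E → Measurable (g E) := by
    intro E hE
    have hS : MeasurableSet {p : Space n × Space n |
        p.2 ∈ Metric.ball (0 : Space n) δ ∧ p.1 ∈ symmDiff E ((fun y => y + p.2) ⁻¹' E)} := by
      refine (measurable_snd measurableSet_ball).inter ?_
      exact (measurable_fst hE).symmDiff ((measurable_fst.add measurable_snd) hE)
    exact measurable_measure_prodMk_left hS
  -- `g E x` is the measure of the `z` in the ball for which `x` and `x + z` are separated by `E`.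
  -- At a point `x` of `E` outside `F`, the average of `E` is full up to `g E x` and that of `F` is
  -- at most `g F x`.
  have htr : ∀ (E : Set (Space n)) (x : Space n),
      volume (E ∩ Metric.ball x δ) = volume {z | z ∈ Metric.ball (0 : Space n) δ ∧ x + z ∈ E} := by
    intro E x
    rw [← measure_preimage_add volume x (E ∩ Metric.ball x δ)]
    congr 1; ext z
    simp [dist_eq_norm, and_comm]
  have key : ∀ (E F : Set (Space n)) (x : Space n), x ∈ E → x ∉ F →
      volume (Metric.ball (0 : Space n) δ) ≤ g E x + g F x + ENNReal.ofReal
          |volume.real (E ∩ Metric.ball x δ) - volume.real (F ∩ Metric.ball x δ)| := by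
    intro E F x hxE hxF
    have h1 : volume (Metric.ball (0 : Space n) δ) ≤ g E x + volume (E ∩ Metric.ball x δ) := by
      rw [htr]
      refine (measure_mono fun z hz => ?_).trans (measure_union_le _ _)
      by_cases h : x + z ∈ E
      · exact Or.inr ⟨hz, h⟩
      · exact Or.inl ⟨hz, Or.inl ⟨hxE, h⟩⟩
    have h2 : volume (F ∩ Metric.ball x δ) ≤ g F x := by
      rw [htr]
      exact measure_mono fun z hz => ⟨hz.1, Or.inr ⟨hz.2, hxF⟩⟩
    have h3 : volume (E ∩ Metric.ball x δ) ≤ volume (F ∩ Metric.ball x δ) + ENNReal.ofReal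
          |volume.real (E ∩ Metric.ball x δ) - volume.real (F ∩ Metric.ball x δ)| := by
      rw [← ENNReal.ofReal_toReal (measure_inter_ne_top_of_right_ne_top
          (s := E) (measure_ball_lt_top (μ := volume) (x := x) (r := δ)).ne),
        ← ENNReal.ofReal_toReal (measure_inter_ne_top_of_right_ne_top
          (s := F) (measure_ball_lt_top (μ := volume) (x := x) (r := δ)).ne),
        ← ENNReal.ofReal_add ENNReal.toReal_nonneg (abs_nonneg _)]
      refine ENNReal.ofReal_le_ofReal ?_
      have := le_abs_self (volume.real (E ∩ Metric.ball x δ) - volume.real (F ∩ Metric.ball x δ))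
      simp only [Measure.real] at this ⊢
      linarith
    calc _ ≤ g E x + volume (E ∩ Metric.ball x δ) := h1
      _ ≤ g E x + (g F x + _) := by gcongr; exact h3.trans (by gcongr)
      _ = _ := (add_assoc _ _ _).symm
  calc volume (Metric.ball (0 : Space n) δ) * volume (symmDiff E F)
      = ∫⁻ x, (symmDiff E F).indicator (fun _ => volume (Metric.ball (0 : Space n) δ)) x := by
        rw [lintegral_indicator_const (hE.symmDiff hF)]
    _ ≤ ∫⁻ x, (g E x + g F x + (Metric.ball (0 : Space n) M).indicator (fun x => ENNReal.ofReal
          |volume.real (E ∩ Metric.ball x δ) - volume.real (F ∩ Metric.ball x δ)|) x) := by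
        refine lintegral_mono fun x => ?_
        by_cases hx : x ∈ symmDiff E F
        · rw [Set.indicator_of_mem hx]
          rcases hx with hx | hx
          · rw [Set.indicator_of_mem (hEM hx.1)]
            exact key E F x hx.1 hx.2
          · rw [Set.indicator_of_mem (hFM hx.1), abs_sub_comm, add_comm (g E x)]
            exact key F E x hx.1 hx.2
        · rw [Set.indicator_of_notMem hx]; exact zero_le
    _ = (∫⁻ x, g E x) + (∫⁻ x, g F x) + ∫⁻ x in Metric.ball (0 : Space n) M, ENNReal.ofReal
          |volume.real (E ∩ Metric.ball x δ) - volume.real (F ∩ Metric.ball x δ)| := by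
        rw [lintegral_add_left (f := fun x => g E x + g F x) ((hg E hE).add (hg F hF)),
          lintegral_add_left (hg E hE), lintegral_indicator measurableSet_ball]
    _ ≤ _ := by
        gcongr
        · exact lintegral_volume_ball_xor_le hE hEM hPE δ
        · exact lintegral_volume_ball_xor_le hF hFM hPF δ

lemma continuous_volume_inter_ball (E : Set (Space n)) (δ : ℝ) :
    Continuous fun x => volume.real (E ∩ Metric.ball x δ) := by
  rw [continuous_iff_continuousAt]
  intro x
  refine tendsto_iff_norm_sub_tendsto_zero.2 (squeeze_zero (fun _ => norm_nonneg _)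
    (fun x' => abs_measureReal_inter_sub_le E measure_ball_lt_top.ne measure_ball_lt_top.ne) ?_)
  exact (ENNReal.tendsto_toReal ENNReal.zero_ne_top).comp (tendsto_volume_symmDiff_ball x δ)

/-- For a subsequence, the ball averages converge at every point and for every radius `1 / (m + 1)`:
compactness of a countable product of intervals gives convergence on a dense set of centres, and the
averages are equicontinuous in the centre. -/
lemma exists_subseq_tendsto_volume_inter_ball (E : ℕ → Set (Space n)) {M : ℝ}
    (hEM : ∀ k, E k ⊆ Metric.ball 0 M) :
    ∃ σ : ℕ → ℕ, StrictMono σ ∧ ∀ (m : ℕ) (x : Space n), ∃ a : ℝ,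
      Tendsto (fun k => volume.real (E (σ k) ∩ Metric.ball x (1 / (m + 1)))) atTop (𝓝 a) := by
  let V := volume.real (Metric.ball (0 : Space n) M)
  let d := TopologicalSpace.denseSeq (Space n)
  let Φ : ℕ → (ℕ × ℕ → ℝ) := fun k p => volume.real (E k ∩ Metric.ball (d p.2) (1 / (p.1 + 1)))
  have hcpt : IsCompact (Set.pi Set.univ fun _ : ℕ × ℕ => Set.Icc (0 : ℝ) V) :=
    isCompact_univ_pi fun _ => isCompact_Icc
  have hΦ : ∀ k, Φ k ∈ Set.pi Set.univ fun _ : ℕ × ℕ => Set.Icc (0 : ℝ) V := fun k p _ =>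
    ⟨measureReal_nonneg, measureReal_mono (Set.inter_subset_left.trans (hEM k))
      measure_ball_lt_top.ne⟩
  obtain ⟨a, -, σ, hσ, hlim⟩ := hcpt.tendsto_subseq hΦ
  rw [tendsto_pi_nhds] at hlim
  refine ⟨σ, hσ, fun m x => cauchySeq_tendsto_of_complete ?_⟩
  rw [Metric.cauchySeq_iff']
  intro ε hε
  have hx := (ENNReal.tendsto_toReal ENNReal.zero_ne_top).comp
    (tendsto_volume_symmDiff_ball x (1 / ((m : ℝ) + 1)))
  have hx' : ∀ᶠ x' in 𝓝 x, volume.real (symmDiff (Metric.ball x' (1 / ((m : ℝ) + 1)))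
      (Metric.ball x (1 / ((m : ℝ) + 1)))) < ε / 3 :=
    hx.eventually_lt_const (by simpa using by positivity)
  obtain ⟨i, hi⟩ := (TopologicalSpace.denseRange_denseSeq (Space n)).exists_mem_open
    isOpen_interior (mem_interior_iff_mem_nhds.2 hx' |> fun h => ⟨x, h⟩)
  replace hi := interior_subset hi
  obtain ⟨N, hN⟩ := Metric.cauchySeq_iff'.1 (hlim (m, i)).cauchySeq (ε / 3) (by positivity)
  refine ⟨N, fun k hk => ?_⟩
  have h1 := hN k hk
  have hball : ∀ k, |volume.real (E (σ k) ∩ Metric.ball (d i) (1 / ((m : ℝ) + 1)))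
      - volume.real (E (σ k) ∩ Metric.ball x (1 / ((m : ℝ) + 1)))| < ε / 3 := fun k =>
    (abs_measureReal_inter_sub_le _ measure_ball_lt_top.ne measure_ball_lt_top.ne).trans_lt hi
  have h2 := hball k
  have h3 := hball N
  simp only [Real.dist_eq, Function.comp_apply, Φ] at h1 ⊢
  rw [abs_lt] at *
  constructor <;> linarith [h1.1, h1.2, h2.1, h2.2, h3.1, h3.2]

/-- Convergence of the ball averages in `L¹` of a ball, by dominated convergence. -/
lemma tendsto_lintegral_abs_volume_inter_ball {E : ℕ → Set (Space n)} {M : ℝ}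
    (hEM : ∀ k, E k ⊆ Metric.ball 0 M) {δ : ℝ} {a : Space n → ℝ}
    (ha : ∀ x, Tendsto (fun k => volume.real (E k ∩ Metric.ball x δ)) atTop (𝓝 (a x))) :
    Tendsto (fun k => ∫⁻ x in Metric.ball (0 : Space n) M,
      ENNReal.ofReal |volume.real (E k ∩ Metric.ball x δ) - a x|) atTop (𝓝 0) := by
  let V := volume.real (Metric.ball (0 : Space n) M)
  have hc := fun k => continuous_volume_inter_ball (E k) δ
  have ham : Measurable a := measurable_of_tendsto_metrizable (fun k => (hc k).measurable)
    (tendsto_pi_nhds.2 ha)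
  have hV : ∀ k x, volume.real (E k ∩ Metric.ball x δ) ∈ Set.Icc 0 V := fun k x =>
    ⟨measureReal_nonneg, measureReal_mono (Set.inter_subset_left.trans (hEM k))
      measure_ball_lt_top.ne⟩
  have haV : ∀ x, a x ∈ Set.Icc 0 V := fun x =>
    isClosed_Icc.mem_of_tendsto (ha x) (Eventually.of_forall fun k => hV k x)
  have := tendsto_lintegral_of_dominated_convergence
    (μ := volume.restrict (Metric.ball (0 : Space n) M))
    (F := fun k x => ENNReal.ofReal |volume.real (E k ∩ Metric.ball x δ) - a x|) (f := fun _ => 0)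
    (fun _ => ENNReal.ofReal V) (fun k => by
      have := (hc k).measurable
      fun_prop)
    (fun k => Eventually.of_forall fun x => ENNReal.ofReal_le_ofReal (by
      rw [abs_le]
      constructor <;> linarith [(hV k x).1, (hV k x).2, (haV x).1, (haV x).2]))
    (by
      rw [lintegral_const]
      exact ENNReal.mul_ne_top ENNReal.ofReal_ne_top (by
        rw [Measure.restrict_apply_univ]; exact measure_ball_lt_top.ne))
    (Eventually.of_forall fun x => by
      have h1 : Tendsto (fun k => |volume.real (E k ∩ Metric.ball x δ) - a x|) atTop (𝓝 0) := by
        simpa using ((ha x).sub_const (a x)).abs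
      simpa using ENNReal.tendsto_ofReal h1)
  simpa using this

/-- Compactness: a sequence of subsets of a ball with bounded perimeters has a subsequence that
converges in measure. -/
theorem exists_subseq_tendsto_of_perimeter_le {E : ℕ → Set (Space n)}
    (hE : ∀ k, NullMeasurableSet (E k)) {M : ℝ} (hEM : ∀ k, E k ⊆ Metric.ball 0 M) {C : ℝ≥0∞}
    (hC : C ≠ ⊤) (hP : ∀ k, perimeter (E k) ≤ C) :
    ∃ (σ : ℕ → ℕ) (F : Set (Space n)), StrictMono σ ∧ MeasurableSet F ∧
      Tendsto (fun k => volume (symmDiff F (E (σ k)))) atTop (𝓝 0) := by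
  wlog hEm : ∀ k, MeasurableSet (E k) generalizing E
  · choose E' hsub hm hae using fun k => (hE k).exists_measurable_subset_ae_eq
    obtain ⟨σ, F, hσ, hF, hlim⟩ := this (fun k => (hm k).nullMeasurableSet)
      (fun k => (hsub k).trans (hEM k)) (fun k => (perimeter_congr (hae k)).trans_le (hP k)) hm
    refine ⟨σ, F, hσ, hF, hlim.congr fun k => ?_⟩
    exact measure_congr ((ae_eq_refl F).symmDiff (hae (σ k)))
  obtain ⟨τ, hτ, hτlim⟩ := exists_subseq_tendsto_volume_inter_ball E hEM
  have hcauchy : ∀ ε : ℝ≥0∞, 0 < ε →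
      ∃ N, ∀ k ≥ N, ∀ l ≥ N, volume (symmDiff (E (τ k)) (E (τ l))) ≤ ε := by
    intro ε hε
    have hPtop : ∀ k, perimeter (E k) ≠ ⊤ := fun k => ne_top_of_le_ne_top hC (hP k)
    have hε4 : 0 < ε / 4 := ENNReal.div_pos hε.ne' (by simp)
    -- The radius is chosen so small that averaging costs at most `ε / 4` for each set.
    obtain ⟨m, hm⟩ : ∃ m : ℕ, ENNReal.ofReal (1 / ((m : ℝ) + 1) * C.toReal) ≤ ε / 4 := by
      have h1 := (tendsto_one_div_add_atTop_nhds_zero_nat (𝕜 := ℝ)).mul_const C.toReal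
      rw [zero_mul] at h1
      have h2 := ENNReal.tendsto_ofReal h1
      rw [ENNReal.ofReal_zero] at h2
      exact ((tendsto_order.1 h2).2 _ hε4).exists.imp fun m h => h.le
    set δ : ℝ := 1 / ((m : ℝ) + 1) with hδdef
    have hδ : 0 < δ := by positivity
    set w := volume (Metric.ball (0 : Space n) δ) with hw
    have hw0 : w ≠ 0 := (Metric.measure_ball_pos volume _ hδ).ne'
    have hwt : w ≠ ⊤ := measure_ball_lt_top.ne
    choose a ha using hτlim m
    have hI := tendsto_lintegral_abs_volume_inter_ball (fun k => hEM (τ k)) ha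
    obtain ⟨N, hN⟩ := eventually_atTop.1 ((tendsto_order.1 hI).2 (w * (ε / 4))
      (ENNReal.mul_pos hw0 hε4.ne'))
    refine ⟨N, fun k hk l hl => ?_⟩
    have hmain := volume_mul_symmDiff_le (hEm (τ k)) (hEm (τ l)) (hEM _) (hEM _) (hPtop _)
      (hPtop _) δ
    have hav : ∀ j, ENNReal.ofReal (δ * (perimeter (E j)).toReal) ≤ ε / 4 := fun j =>
      (ENNReal.ofReal_le_ofReal (mul_le_mul_of_nonneg_left
        (ENNReal.toReal_mono hC (hP j)) hδ.le)).trans hm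
    have hlast : ∫⁻ x in Metric.ball (0 : Space n) M, ENNReal.ofReal
        |volume.real (E (τ k) ∩ Metric.ball x δ) - volume.real (E (τ l) ∩ Metric.ball x δ)|
        ≤ w * (ε / 4) + w * (ε / 4) := by
      refine le_trans ?_ (add_le_add (hN k hk).le (hN l hl).le)
      rw [← lintegral_add_right']
      · refine lintegral_mono fun x => ?_
        rw [← ENNReal.ofReal_add (abs_nonneg _) (abs_nonneg _)]
        refine ENNReal.ofReal_le_ofReal ?_
        rw [abs_sub_comm (volume.real (E (τ l) ∩ _))]
        exact abs_sub_le _ _ _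
      · have h1 := (continuous_volume_inter_ball (E (τ l)) δ).measurable
        have ham : Measurable a := measurable_of_tendsto_metrizable
          (fun k => (continuous_volume_inter_ball (E (τ k)) δ).measurable) (tendsto_pi_nhds.2 ha)
        fun_prop
    have h4 : ε / 4 + ε / 4 + (ε / 4 + ε / 4) = ε := by
      have : ε / 4 + ε / 4 = ε / 2 := by
        rw [← two_mul, show (4 : ℝ≥0∞) = 2 * 2 by norm_num, ← mul_div_assoc,
          ENNReal.mul_div_mul_left _ _ (by simp) (by simp)]
      rw [this, ENNReal.add_halves]
    have hfin : w * volume (symmDiff (E (τ k)) (E (τ l))) ≤ w * ε := by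
      refine hmain.trans ?_
      rw [← h4, mul_add, mul_add]
      gcongr
      · exact hav _
      · exact hav _
    exact (ENNReal.mul_le_mul_iff_right hw0 hwt).1 hfin
  obtain ⟨σ, F, hσ, hF, hlim⟩ := exists_subseq_tendsto_symmDiff (fun k => hEm (τ k)) hcauchy
  exact ⟨τ ∘ σ, F, hτ.comp hσ, hF, hlim⟩

/-! ### Square-integrable functions -/

lemma tendsto_eLpNorm_indicator_of_tendsto_measure {X F : Type*} [MeasurableSpace X]
    {μ : Measure X} [NormedAddCommGroup F] {f : X → F} (hf : MemLp f 2 μ)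
    {s : ℕ → Set X} (hs : ∀ k, MeasurableSet (s k))
    (h : Tendsto (fun k => μ (s k)) atTop (𝓝 0)) :
    Tendsto (fun k => eLpNorm ((s k).indicator f) 2 μ) atTop (𝓝 0) := by
  rw [ENNReal.tendsto_nhds_zero]
  intro ε hε
  by_cases hεt : ε = ⊤
  · simp [hεt]
  obtain ⟨δ, hδ, hδs⟩ := hf.eLpNorm_indicator_le one_le_two (by simp) (ENNReal.toReal_pos hε.ne' hεt)
  filter_upwards [(ENNReal.tendsto_nhds_zero.1 h) (ENNReal.ofReal δ) (by simpa using hδ)] with k hk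
  refine (hδs (s k) (hs k) hk).trans ?_
  rw [ENNReal.ofReal_toReal hεt]

section L2

variable {X F : Type*} [MeasurableSpace X] {μ : Measure X} [NormedAddCommGroup F]
  [InnerProductSpace ℝ F]

lemma integral_inner_eq_inner_toLp {f g : X → F} (hf : MemLp f 2 μ) (hg : MemLp g 2 μ) :
    ∫ x, inner ℝ (f x) (g x) ∂μ = inner ℝ (hf.toLp f) (hg.toLp g) := by
  rw [L2.inner_def]
  refine integral_congr_ae ?_
  filter_upwards [hf.coeFn_toLp, hg.coeFn_toLp] with x h1 h2
  rw [h1, h2]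

lemma integrable_inner_of_memLp {f g : X → F} (hf : MemLp f 2 μ) (hg : MemLp g 2 μ) :
    Integrable (fun x => inner ℝ (f x) (g x)) μ := by
  refine (L2.integrable_inner (𝕜 := ℝ) (hf.toLp f) (hg.toLp g)).congr ?_
  filter_upwards [hf.coeFn_toLp, hg.coeFn_toLp] with x h1 h2
  rw [h1, h2]

lemma norm_integral_inner_le {f g : X → F} (hf : MemLp f 2 μ) (hg : MemLp g 2 μ) :
    ‖∫ x, inner ℝ (f x) (g x) ∂μ‖ ≤ (eLpNorm f 2 μ).toReal * (eLpNorm g 2 μ).toReal := by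
  rw [integral_inner_eq_inner_toLp hf hg, ← Lp.norm_toLp f hf, ← Lp.norm_toLp g hg]
  exact norm_inner_le_norm _ _

lemma tendsto_integral_inner {f g : X → F} {φ : ℕ → X → F} (hf : MemLp f 2 μ) (hg : MemLp g 2 μ)
    (hφ : ∀ k, MemLp (φ k) 2 μ)
    (h : Tendsto (fun k => eLpNorm (fun x => φ k x - g x) 2 μ) atTop (𝓝 0)) :
    Tendsto (fun k => ∫ x, inner ℝ (f x) (φ k x) ∂μ) atTop (𝓝 (∫ x, inner ℝ (f x) (g x) ∂μ)) := by
  have h1 := (Lp.tendsto_Lp_iff_tendsto_eLpNorm'' φ hφ g hg).2 h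
  rw [integral_inner_eq_inner_toLp hf hg]
  simp_rw [fun k => integral_inner_eq_inner_toLp hf (hφ k)]
  exact tendsto_const_nhds.inner h1

lemma integrable_mul_of_memLp {f g : X → ℝ} (hf : MemLp f 2 μ) (hg : MemLp g 2 μ) :
    Integrable (fun x => f x * g x) μ := by
  refine (integrable_inner_of_memLp hg hf).congr (Eventually.of_forall fun x => ?_)
  simp

/-- The coefficients `b 1_E` depend continuously on `b` and `E`, as multipliers applied to a fixed
square-integrable function. -/
lemma tendsto_eLpNorm_coefficient_sub {f : X → F} (hf : MemLp f 2 μ) {E : Set X} {E_h : ℕ → Set X}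
    (hE : MeasurableSet E) (hE_h : ∀ h, MeasurableSet (E_h h))
    (hlim : Tendsto (fun h => μ (symmDiff E (E_h h))) atTop (𝓝 0)) {b : ℝ} {b_h : ℕ → ℝ}
    (hb : Tendsto b_h atTop (𝓝 b)) :
    Tendsto (fun h => eLpNorm (fun x =>
      (E.indicator (fun _ => b) x - (E_h h).indicator (fun _ => b_h h) x) • f x) 2 μ)
      atTop (𝓝 0) := by
  have h1 := tendsto_eLpNorm_indicator_of_tendsto_measure hf
    (fun k => hE.symmDiff (hE_h k)) hlim
  have h2 : Tendsto (fun h => ENNReal.ofReal |b - b_h h| * eLpNorm f 2 μ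
      + ENNReal.ofReal |b| * eLpNorm ((symmDiff E (E_h h)).indicator f) 2 μ) atTop (𝓝 0) := by
    have a1 : Tendsto (fun h => ENNReal.ofReal |b - b_h h|) atTop (𝓝 0) := by
      have : Tendsto (fun h => |b - b_h h|) atTop (𝓝 0) := by simpa using (hb.const_sub b).abs
      simpa using ENNReal.tendsto_ofReal this
    have := (ENNReal.Tendsto.mul_const a1 (Or.inr hf.eLpNorm_ne_top)).add
      (ENNReal.Tendsto.const_mul h1 (Or.inr (ENNReal.ofReal_ne_top (r := |b|))))
    simpa using this
  refine tendsto_of_tendsto_of_tendsto_of_le_of_le tendsto_const_nhds h2 (fun _ => zero_le)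
    fun h => ?_
  have e1 : ENNReal.ofReal |b - b_h h| * eLpNorm f 2 μ
      = eLpNorm (fun x => |b - b_h h| * ‖f x‖) 2 μ := by
    have := eLpNorm_const_smul |b - b_h h| (fun x => ‖f x‖) 2 μ
    rw [Real.enorm_eq_ofReal (abs_nonneg _), eLpNorm_norm] at this
    exact this.symm
  have e2 : ENNReal.ofReal |b| * eLpNorm ((symmDiff E (E_h h)).indicator f) 2 μ
      = eLpNorm (fun x => |b| * ‖(symmDiff E (E_h h)).indicator f x‖) 2 μ := by
    have := eLpNorm_const_smul |b| (fun x => ‖(symmDiff E (E_h h)).indicator f x‖) 2 μ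
    rw [Real.enorm_eq_ofReal (abs_nonneg _), eLpNorm_norm] at this
    exact this.symm
  rw [e1, e2]
  refine (eLpNorm_mono_real (g := fun x => |b - b_h h| * ‖f x‖
    + |b| * ‖(symmDiff E (E_h h)).indicator f x‖) fun x => ?_).trans
    (eLpNorm_add_le (hf.1.norm.const_mul _)
      ((hf.1.indicator (hE.symmDiff (hE_h h))).norm.const_mul _) one_le_two)
  rw [norm_smul, Real.norm_eq_abs]
  have h0 : |b_h h| ≤ |b - b_h h| + |b| := by
    have := abs_sub_abs_le_abs_sub (b_h h) b
    rw [abs_sub_comm] at this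
    linarith
  by_cases hx1 : x ∈ E <;> by_cases hx2 : x ∈ E_h h <;>
    simp only [Set.indicator, hx1, hx2, Set.mem_symmDiff, if_true, if_false, not_true_eq_false,
      not_false_eq_true, and_true, and_false, or_false, or_true, sub_zero, zero_sub, abs_neg,
      abs_zero, norm_zero, mul_zero, zero_mul, add_zero, sub_self, le_refl]
  · nlinarith [norm_nonneg (f x), abs_nonneg (b - b_h h)]
  · nlinarith [norm_nonneg (f x), abs_nonneg (b - b_h h)]
  · positivity

end L2

/-! ### The space `D¹` -/

lemma norm_gradient_eq (φ : Space n → ℝ) (x : Space n) : ‖gradient φ x‖ = ‖fderiv ℝ φ x‖ := by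
  simp [gradient]

lemma IsTestFunction.contDiff_one {φ : Space n → ℝ} (hφ : IsTestFunction φ) : ContDiff ℝ 1 φ :=
  hφ.1.of_le (by exact_mod_cast le_top)

lemma IsTestFunction.continuous_gradient {φ : Space n → ℝ} (hφ : IsTestFunction φ) :
    Continuous (gradient φ) :=
  (InnerProductSpace.toDual ℝ (Space n)).symm.continuous.comp
    (hφ.contDiff_one.continuous_fderiv one_ne_zero)

lemma IsTestFunction.memLp {φ : Space n → ℝ} (hφ : IsTestFunction φ) (p : ℝ≥0∞) :
    MemLp φ p volume :=
  hφ.1.continuous.memLp_of_hasCompactSupport hφ.2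

lemma IsTestFunction.gradient_memLp {φ : Space n → ℝ} (hφ : IsTestFunction φ) (p : ℝ≥0∞) :
    MemLp (gradient φ) p volume := by
  refine hφ.continuous_gradient.memLp_of_hasCompactSupport ?_
  exact (hφ.2.fderiv ℝ).comp_left (g := (InnerProductSpace.toDual ℝ (Space n)).symm) (by simp)

lemma gradient_add_smul {φ ψ : Space n → ℝ} (hφ : ContDiff ℝ 1 φ) (hψ : ContDiff ℝ 1 ψ)
    (a b : ℝ) (x : Space n) :
    gradient (fun y => a * φ y + b * ψ y) x = a • gradient φ x + b • gradient ψ x := by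
  have h1 := (hφ.differentiable one_ne_zero) x
  have h2 := (hψ.differentiable one_ne_zero) x
  unfold gradient
  rw [fderiv_fun_add (h1.const_mul a) (h2.const_mul b), fderiv_const_mul h1, fderiv_const_mul h2]
  simp

lemma IsTestFunction.add_smul {φ ψ : Space n → ℝ} (hφ : IsTestFunction φ)
    (hψ : IsTestFunction ψ) (a b : ℝ) : IsTestFunction fun y => a * φ y + b * ψ y :=
  ⟨(contDiff_const.mul hφ.1).add (contDiff_const.mul hψ.1),
    (hφ.2.mul_left (f := fun _ => a)).add (hψ.2.mul_left (f := fun _ => b))⟩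

lemma isTestFunction_zero : IsTestFunction (fun _ : Space n => (0 : ℝ)) :=
  ⟨contDiff_const, HasCompactSupport.zero⟩

lemma IsTestFunction.memD1 {φ : Space n → ℝ} (hφ : IsTestFunction φ) :
    MemD1 φ (gradient φ) :=
  ⟨hφ.memLp _, hφ.gradient_memLp _, fun _ => φ, fun _ => hφ, by simp, by simp⟩

lemma two_le_sobolevExponent (hn : 3 ≤ n) : 2 ≤ sobolevExponent n := by
  have h3 : (3 : ℝ) ≤ n := by exact_mod_cast hn
  have : ENNReal.ofReal 2 ≤ sobolevExponent n := by
    refine ENNReal.ofReal_le_ofReal ?_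
    rw [le_div_iff₀ (by linarith)]
    linarith
  simpa using this

lemma exists_sobolev (hn : 3 ≤ n) : ∃ C : NNReal, ∀ φ : Space n → ℝ, IsTestFunction φ →
    eLpNorm φ (sobolevExponent n) volume ≤ C * eLpNorm (gradient φ) 2 volume := by
  refine ⟨SNormLESNormFDerivOfEqConst ℝ (volume : Measure (Space n)) ((2 : NNReal) : ℝ),
    fun φ hφ => ?_⟩
  have h3 : (3 : ℝ) ≤ n := by exact_mod_cast hn
  have h := eLpNorm_le_eLpNorm_fderiv_of_eq (volume : Measure (Space n)) hφ.contDiff_one hφ.2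
    (p := 2) (p' := Real.toNNReal (2 * (n : ℝ) / ((n : ℝ) - 2))) one_le_two
    (by rw [finrank_euclideanSpace, Fintype.card_fin]; omega)
    (by
      rw [finrank_euclideanSpace, Fintype.card_fin,
        Real.coe_toNNReal _ (div_nonneg (by positivity) (by linarith))]
      have : (n : ℝ) - 2 ≠ 0 := by linarith
      push_cast
      field_simp)
  have e : eLpNorm (fderiv ℝ φ) 2 volume = eLpNorm (gradient φ) 2 volume :=
    eLpNorm_congr_norm_ae (Eventually.of_forall fun x => (norm_gradient_eq φ x).symm)
  rw [← e]
  exact h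

/-- The Sobolev inequality on `D¹`. -/
lemma exists_sobolev_memD1 (hn : 3 ≤ n) : ∃ C : NNReal, ∀ (u : Space n → ℝ) (g : Space n → Space n),
    MemD1 u g → eLpNorm u (sobolevExponent n) volume ≤ C * eLpNorm g 2 volume := by
  obtain ⟨C, hC⟩ := exists_sobolev hn
  have hp : 1 ≤ sobolevExponent n := one_le_two.trans (two_le_sobolevExponent hn)
  refine ⟨C, fun u g h => ?_⟩
  obtain ⟨φ, hφ, h1, h2⟩ := h.approx
  have l : Tendsto (fun k => eLpNorm (fun x => φ k x - u x) (sobolevExponent n) volume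
      + C * (eLpNorm (fun x => gradient (φ k) x - g x) 2 volume + eLpNorm g 2 volume)) atTop
      (𝓝 (0 + C * (0 + eLpNorm g 2 volume))) :=
    h1.add (ENNReal.Tendsto.const_mul (h2.add tendsto_const_nhds) (Or.inr ENNReal.coe_ne_top))
  rw [zero_add, zero_add] at l
  refine ge_of_tendsto' l fun k => ?_
  have e1 : eLpNorm u (sobolevExponent n) volume ≤
      eLpNorm (fun x => φ k x - u x) (sobolevExponent n) volume
        + eLpNorm (φ k) (sobolevExponent n) volume := by
    have := eLpNorm_add_le (p := sobolevExponent n) (μ := volume) (f := fun x => u x - φ k x)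
      (g := φ k) (h.memLp.1.sub ((hφ k).memLp (sobolevExponent n)).1)
      ((hφ k).memLp (sobolevExponent n)).1 hp
    rw [show (fun x => u x - φ k x) + φ k = u by ext x; simp] at this
    rwa [show eLpNorm (fun x => u x - φ k x) (sobolevExponent n) volume
      = eLpNorm (fun x => φ k x - u x) (sobolevExponent n) volume from eLpNorm_sub_comm _ _ _ _]
      at this
  have e2 : eLpNorm (gradient (φ k)) 2 volume ≤
      eLpNorm (fun x => gradient (φ k) x - g x) 2 volume + eLpNorm g 2 volume := by
    have := eLpNorm_add_le (p := 2) (μ := volume) (f := fun x => gradient (φ k) x - g x)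
      (g := g) (((hφ k).gradient_memLp 2).1.sub h.grad_memLp.1) h.grad_memLp.1 one_le_two
    rwa [show (fun x => gradient (φ k) x - g x) + g = gradient (φ k) by ext x; simp] at this
  refine e1.trans ?_
  gcongr
  exact (hC _ (hφ k)).trans (by gcongr)

/-- Hölder's inequality on a ball: `L^{2*}` functions are locally square-integrable. -/
lemma exists_eLpNorm_restrict_ball_le (hn : 3 ≤ n) (M : ℝ) : ∃ C : NNReal, ∀ u : Space n → ℝ,
    AEStronglyMeasurable u volume →
    eLpNorm u 2 (volume.restrict (Metric.ball 0 M)) ≤ C * eLpNorm u (sobolevExponent n) volume := by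
  have hv : (volume.restrict (Metric.ball (0 : Space n) M) Set.univ) ≠ ⊤ := by
    rw [Measure.restrict_apply_univ]; exact measure_ball_lt_top.ne
  have hexp : 0 ≤ 1 / (2 : ℝ≥0∞).toReal - 1 / (sobolevExponent n).toReal := by
    have h2 := two_le_sobolevExponent hn
    have := ENNReal.toReal_mono (by simp [sobolevExponent]) h2
    rw [sub_nonneg]
    exact one_div_le_one_div_of_le (by simp) this
  refine ⟨(volume.restrict (Metric.ball (0 : Space n) M) Set.univ ^
    (1 / (2 : ℝ≥0∞).toReal - 1 / (sobolevExponent n).toReal)).toNNReal, fun u hu => ?_⟩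
  rw [ENNReal.coe_toNNReal (ENNReal.rpow_ne_top_of_nonneg hexp hv), mul_comm]
  refine (eLpNorm_le_eLpNorm_mul_rpow_measure_univ (two_le_sobolevExponent hn) hu.restrict).trans ?_
  gcongr
  exact Measure.restrict_le_self

/-! ### Integrability with the permittivity as a weight -/

lemma permittivity_eq (β : ℝ) (E : Set (Space n)) (x : Space n) :
    permittivity β E x = 1 + E.indicator (fun _ => β - 1) x := by
  by_cases h : x ∈ E <;> simp [permittivity, h]

lemma one_le_permittivity {β : ℝ} (hβ : 1 ≤ β) (E : Set (Space n)) (x : Space n) :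
    1 ≤ permittivity β E x := by
  by_cases h : x ∈ E <;> simp [permittivity, h, hβ]

lemma permittivity_le {β : ℝ} (hβ : 1 ≤ β) (E : Set (Space n)) (x : Space n) :
    permittivity β E x ≤ β := by
  by_cases h : x ∈ E <;> simp [permittivity, h, hβ]

lemma measurable_permittivity (β : ℝ) {E : Set (Space n)} (hE : MeasurableSet E) :
    Measurable (permittivity β E) := by
  rw [show permittivity β E = fun x => 1 + E.indicator (fun _ => β - 1) x from
    funext (permittivity_eq β E)]
  exact measurable_const.add (measurable_const.indicator hE)

lemma memLp_permittivity_smul {β : ℝ} (hβ : 1 ≤ β) {E : Set (Space n)} (hE : MeasurableSet E)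
    {g : Space n → Space n} (hg : MemLp g 2 volume) :
    MemLp (fun x => permittivity β E x • g x) 2 volume := by
  refine hg.of_le_mul (c := β)
    ((measurable_permittivity β hE).aestronglyMeasurable.smul hg.1)
    (Eventually.of_forall fun x => ?_)
  rw [norm_smul, Real.norm_of_nonneg (zero_le_one.trans (one_le_permittivity hβ E x))]
  exact mul_le_mul_of_nonneg_right (permittivity_le hβ E x) (norm_nonneg _)

lemma memLp_sqrt_permittivity_smul {β : ℝ} (hβ : 1 ≤ β) {E : Set (Space n)} (hE : MeasurableSet E)
    {g : Space n → Space n} (hg : MemLp g 2 volume) :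
    MemLp (fun x => √(permittivity β E x) • g x) 2 volume := by
  refine hg.of_le_mul (c := √β)
    ((measurable_permittivity β hE).sqrt.aestronglyMeasurable.smul hg.1)
    (Eventually.of_forall fun x => ?_)
  rw [norm_smul, Real.norm_of_nonneg (Real.sqrt_nonneg _)]
  exact mul_le_mul_of_nonneg_right (Real.sqrt_le_sqrt (permittivity_le hβ E x)) (norm_nonneg _)

lemma memLp_restrict_ball (hn : 3 ≤ n) {u : Space n → ℝ} (hu : MemLp u (sobolevExponent n) volume)
    (M : ℝ) : MemLp u 2 (volume.restrict (Metric.ball 0 M)) := by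
  obtain ⟨C, hC⟩ := exists_eLpNorm_restrict_ball_le hn M
  exact ⟨hu.1.restrict, (hC u hu.1).trans_lt
    (ENNReal.mul_lt_top ENNReal.coe_lt_top hu.2)⟩

lemma memLp_restrict_of_subset_ball (hn : 3 ≤ n) {u : Space n → ℝ}
    (hu : MemLp u (sobolevExponent n) volume) {E : Set (Space n)} {M : ℝ}
    (hEM : E ⊆ Metric.ball 0 M) : MemLp u 2 (volume.restrict E) :=
  (memLp_restrict_ball hn hu M).mono_measure (Measure.restrict_mono_set _ hEM)

lemma tendsto_eLpNorm_restrict (hn : 3 ≤ n) {E : Set (Space n)} {M : ℝ}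
    (hEM : E ⊆ Metric.ball 0 M) {f : ℕ → Space n → ℝ}
    (hf : ∀ k, AEStronglyMeasurable (f k) volume)
    (h : Tendsto (fun k => eLpNorm (f k) (sobolevExponent n) volume) atTop (𝓝 0)) :
    Tendsto (fun k => eLpNorm (f k) 2 (volume.restrict E)) atTop (𝓝 0) := by
  obtain ⟨C, hC⟩ := exists_eLpNorm_restrict_ball_le hn M
  have h' : Tendsto (fun k => C * eLpNorm (f k) (sobolevExponent n) volume) atTop (𝓝 0) := by
    simpa using ENNReal.Tendsto.const_mul h (Or.inr (ENNReal.coe_ne_top (r := C)))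
  refine tendsto_of_tendsto_of_tendsto_of_le_of_le tendsto_const_nhds h' (fun _ => zero_le)
    fun k => le_trans ?_ (hC (f k) (hf k))
  exact eLpNorm_mono_measure _ (Measure.restrict_mono_set _ hEM)

lemma MemD1.const_smul {u : Space n → ℝ} {g : Space n → Space n} (h : MemD1 u g) (c : ℝ) :
    MemD1 (fun x => c * u x) (fun x => c • g x) := by
  obtain ⟨φ, hφ, h1, h2⟩ := h.approx
  have hz := isTestFunction_zero (n := n)
  have hgrad : ∀ k x, gradient (fun y => c * φ k y) x = c • gradient (φ k) x := by
    intro k x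
    have := gradient_add_smul (hφ k).contDiff_one hz.contDiff_one c 0 x
    simpa using this
  refine ⟨h.memLp.const_mul c, h.grad_memLp.const_smul c, fun k x => c * φ k x, fun k => ?_, ?_, ?_⟩
  · simpa using (hφ k).add_smul hz c 0
  · have := ENNReal.Tendsto.const_mul h1 (Or.inr (enorm_ne_top (x := c)))
    rw [mul_zero] at this
    refine this.congr fun k => ?_
    rw [← eLpNorm_const_smul]
    congr 1; ext x
    simp [mul_sub]
  · have := ENNReal.Tendsto.const_mul h2 (Or.inr (enorm_ne_top (x := c)))
    rw [mul_zero] at this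
    refine this.congr fun k => ?_
    rw [← eLpNorm_const_smul]
    congr 1; ext1 x
    simp [hgrad, smul_sub]

/-! ### The equilibrium potential -/

/-- The vector `(√a_E g, K^{-1/2} u)` of the Hilbert space `L²(ℝⁿ; ℝⁿ) × L²(E)`; the weights are
chosen so that its inner products are the values of the bilinear form of the potential equation. -/
noncomputable def energyVector (β K : ℝ) (E : Set (Space n)) {u : Space n → ℝ}
    {g : Space n → Space n}
    (hg : MemLp (fun x => √(permittivity β E x) • g x) 2 volume)
    (hu : MemLp u 2 (volume.restrict E)) :
    WithLp 2 (Lp (Space n) 2 (volume : Measure (Space n)) × Lp ℝ 2 (volume.restrict E)) :=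
  WithLp.toLp 2 (hg.toLp, (√K)⁻¹ • hu.toLp)

lemma inner_energyVector {β K : ℝ} (hβ : 1 ≤ β) (hK : 0 < K) {E : Set (Space n)}
    {u u' : Space n → ℝ} {g g' : Space n → Space n}
    (hg : MemLp (fun x => √(permittivity β E x) • g x) 2 volume)
    (hu : MemLp u 2 (volume.restrict E))
    (hg' : MemLp (fun x => √(permittivity β E x) • g' x) 2 volume)
    (hu' : MemLp u' 2 (volume.restrict E)) :
    inner ℝ (energyVector β K E hg hu) (energyVector β K E hg' hu')
      = (∫ x, permittivity β E x * inner ℝ (g x) (g' x)) + K⁻¹ * ∫ x in E, u x * u' x := by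
  rw [WithLp.prod_inner_apply]
  simp only [energyVector, inner_smul_left, inner_smul_right]
  rw [← integral_inner_eq_inner_toLp hg hg', ← integral_inner_eq_inner_toLp hu hu']
  congr 1
  · refine integral_congr_ae (Eventually.of_forall fun x => ?_)
    simp only [inner_smul_left, inner_smul_right, conj_trivial]
    rw [← mul_assoc, Real.mul_self_sqrt (zero_le_one.trans (one_le_permittivity hβ E x))]
  · rw [conj_trivial, ← mul_assoc, ← mul_inv, Real.mul_self_sqrt hK.le]
    congr 1
    refine integral_congr_ae (Eventually.of_forall fun x => ?_)
    simp [mul_comm]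

/-- `u`, with gradient `g`, is the equilibrium potential of `E`: the weak solution in `D¹` of
`-div (a_E ∇u) = K⁻¹ 1_E (1 - u)`, tested with all of `D¹`. It minimises
`∫ a_E |∇u|² + K⁻¹ ∫_E (1 - u)²`. -/
structure IsPotential (β K : ℝ) (E : Set (Space n)) (u : Space n → ℝ) (g : Space n → Space n) :
    Prop where
  memD1 : MemD1 u g
  equation : ∀ (u' : Space n → ℝ) (g' : Space n → Space n), MemD1 u' g' →
    (∫ x, permittivity β E x * inner ℝ (g x) (g' x)) + K⁻¹ * ∫ x in E, u x * u' x
      = K⁻¹ * ∫ x in E, u' x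

lemma tendsto_energyVector (hn : 3 ≤ n) {β : ℝ} (K : ℝ) (hβ : 1 ≤ β) {E : Set (Space n)}
    (hE : MeasurableSet E) {M : ℝ} (hEM : E ⊆ Metric.ball 0 M) {u : Space n → ℝ}
    {g : Space n → Space n} (h : MemD1 u g) {φ : ℕ → Space n → ℝ} (hφ : ∀ k, IsTestFunction (φ k))
    (h1 : Tendsto (fun k => eLpNorm (fun x => φ k x - u x) (sobolevExponent n) volume) atTop (𝓝 0))
    (h2 : Tendsto (fun k => eLpNorm (fun x => gradient (φ k) x - g x) 2 volume) atTop (𝓝 0)) :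
    Tendsto (fun k => energyVector β K E
        (memLp_sqrt_permittivity_smul hβ hE ((hφ k).gradient_memLp 2))
        (memLp_restrict_of_subset_ball hn ((hφ k).memLp _) hEM)) atTop
      (𝓝 (energyVector β K E (memLp_sqrt_permittivity_smul hβ hE h.grad_memLp)
        (memLp_restrict_of_subset_ball hn h.memLp hEM))) := by
  refine ((WithLp.prod_continuous_toLp 2 _ _).tendsto _).comp (Tendsto.prodMk_nhds ?_ ?_)
  · refine (Lp.tendsto_Lp_iff_tendsto_eLpNorm'' _
      (fun k => memLp_sqrt_permittivity_smul hβ hE ((hφ k).gradient_memLp 2)) _ _).2 ?_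
    have h' : Tendsto (fun k => ENNReal.ofReal (√β) *
        eLpNorm (fun x => gradient (φ k) x - g x) 2 volume) atTop (𝓝 0) := by
      simpa using ENNReal.Tendsto.const_mul h2 (Or.inr (ENNReal.ofReal_ne_top (r := √β)))
    refine tendsto_of_tendsto_of_tendsto_of_le_of_le tendsto_const_nhds h' (fun _ => zero_le)
      fun k => ?_
    refine eLpNorm_le_mul_eLpNorm_of_ae_le_mul (Eventually.of_forall fun x => ?_) 2
    simp only [Pi.sub_apply]
    rw [← smul_sub, norm_smul, Real.norm_of_nonneg (Real.sqrt_nonneg _)]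
    exact mul_le_mul_of_nonneg_right (Real.sqrt_le_sqrt (permittivity_le hβ E x)) (norm_nonneg _)
  · refine Tendsto.const_smul ?_ _
    refine (Lp.tendsto_Lp_iff_tendsto_eLpNorm'' _
      (fun k => memLp_restrict_of_subset_ball hn ((hφ k).memLp _) hEM) _ _).2 ?_
    exact tendsto_eLpNorm_restrict hn hEM (fun k => ((hφ k).memLp (sobolevExponent n)).1.sub
      h.memLp.1) h1

/-- By the Sobolev inequality, test functions that are Cauchy in energy converge in `D¹`. -/
lemma exists_memD1_of_tendsto (hn : 3 ≤ n) {φ : ℕ → Space n → ℝ} (hφ : ∀ k, IsTestFunction (φ k))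
    {g : Space n → Space n} (hg : MemLp g 2 volume)
    (h : Tendsto (fun k => eLpNorm (fun x => gradient (φ k) x - g x) 2 volume) atTop (𝓝 0)) :
    ∃ u : Space n → ℝ, MemD1 u g ∧
      Tendsto (fun k => eLpNorm (fun x => φ k x - u x) (sobolevExponent n) volume) atTop (𝓝 0) := by
  obtain ⟨C, hC⟩ := exists_sobolev hn
  have hp : Fact (1 ≤ sobolevExponent n) := ⟨one_le_two.trans (two_le_sobolevExponent hn)⟩
  have hcG := ((Lp.tendsto_Lp_iff_tendsto_eLpNorm'' _ (fun k => (hφ k).gradient_memLp 2) g hg).2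
    h).cauchySeq
  have hdist : ∀ k l, dist (((hφ k).memLp (sobolevExponent n)).toLp (φ k))
      (((hφ l).memLp (sobolevExponent n)).toLp (φ l)) ≤
      C * dist (((hφ k).gradient_memLp 2).toLp (gradient (φ k)))
        (((hφ l).gradient_memLp 2).toLp (gradient (φ l))) := by
    intro k l
    have ht : IsTestFunction fun y => 1 * φ k y + (-1) * φ l y := (hφ k).add_smul (hφ l) 1 (-1)
    have hS := hC _ ht
    have e1 : (fun y => 1 * φ k y + (-1) * φ l y) = φ k - φ l := by ext y; simp; ring
    have e2 : gradient (φ k - φ l) = gradient (φ k) - gradient (φ l) := by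
      rw [← e1]
      ext1 x
      rw [gradient_add_smul (hφ k).contDiff_one (hφ l).contDiff_one]
      simp [sub_eq_add_neg]
    rw [e1, e2] at hS
    rw [dist_edist, dist_edist, Lp.edist_toLp_toLp, Lp.edist_toLp_toLp]
    have := ENNReal.toReal_mono (ENNReal.mul_ne_top ENNReal.coe_ne_top
      (((hφ k).gradient_memLp 2).sub ((hφ l).gradient_memLp 2)).eLpNorm_ne_top) hS
    rwa [ENNReal.toReal_mul, ENNReal.coe_toReal] at this
  have hcU : CauchySeq fun k => ((hφ k).memLp (sobolevExponent n)).toLp (φ k) := by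
    rw [Metric.cauchySeq_iff] at hcG ⊢
    intro ε hε
    obtain ⟨N, hN⟩ := hcG (ε / (C + 1)) (by positivity)
    refine ⟨N, fun k hk l hl => (hdist k l).trans_lt ?_⟩
    have h1 := hN k hk l hl
    rw [lt_div_iff₀ (by positivity)] at h1
    have h2 : (0 : ℝ) ≤ dist (((hφ k).gradient_memLp 2).toLp (gradient (φ k)))
        (((hφ l).gradient_memLp 2).toLp (gradient (φ l))) := dist_nonneg
    nlinarith
  obtain ⟨U, hU⟩ := cauchySeq_tendsto_of_complete hcU
  have hUm := Lp.memLp U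
  have hlim := (Lp.tendsto_Lp_iff_tendsto_eLpNorm'' _ (fun k => (hφ k).memLp (sobolevExponent n))
    U hUm).1 (by rwa [Lp.toLp_coeFn])
  exact ⟨U, ⟨hUm, hg, φ, hφ, hlim, h⟩, hlim⟩

/-- Existence of the equilibrium potential: project `(0, K^{-1/2})` orthogonally onto the closure of
the vectors `(√a_E ∇φ, K^{-1/2} φ)` with `φ` a test function. -/
theorem exists_isPotential (hn : 3 ≤ n) {β K : ℝ} (hβ : 1 ≤ β) (hK : 0 < K) {E : Set (Space n)}
    (hE : MeasurableSet E) {M : ℝ} (hEM : E ⊆ Metric.ball 0 M) :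
    ∃ u g, IsPotential β K E u g := by
  have hfin : IsFiniteMeasure ((volume : Measure (Space n)).restrict E) :=
    isFiniteMeasure_restrict.2 (ne_top_of_le_ne_top measure_ball_lt_top.ne (measure_mono hEM))
  let mg : ∀ {φ : Space n → ℝ}, IsTestFunction φ →
      MemLp (fun x => √(permittivity β E x) • gradient φ x) 2 volume := fun hφ =>
    memLp_sqrt_permittivity_smul hβ hE (hφ.gradient_memLp 2)
  let mu : ∀ {φ : Space n → ℝ}, IsTestFunction φ → MemLp φ 2 (volume.restrict E) := fun hφ =>
    memLp_restrict_of_subset_ball hn (hφ.memLp _) hEM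
  have hlin : ∀ {φ ψ : Space n → ℝ} (hφ : IsTestFunction φ) (hψ : IsTestFunction ψ) (a b : ℝ),
      energyVector β K E (mg (hφ.add_smul hψ a b)) (mu (hφ.add_smul hψ a b))
        = a • energyVector β K E (mg hφ) (mu hφ) + b • energyVector β K E (mg hψ) (mu hψ) := by
    intro φ ψ hφ hψ a b
    simp only [energyVector, ← WithLp.toLp_smul, ← WithLp.toLp_add, Prod.smul_mk, Prod.mk_add_mk]
    congr 2
    · rw [← MemLp.toLp_const_smul, ← MemLp.toLp_const_smul, ← MemLp.toLp_add]
      congr 1; ext1 x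
      simp only [Pi.add_apply, Pi.smul_apply]
      rw [gradient_add_smul hφ.contDiff_one hψ.contDiff_one, smul_add, smul_comm a, smul_comm b]
    · rw [smul_comm a, smul_comm b, ← smul_add, ← MemLp.toLp_const_smul a (mu hφ),
        ← MemLp.toLp_const_smul b (mu hψ), ← MemLp.toLp_add]
      rfl
  let S : Submodule ℝ (WithLp 2 (Lp (Space n) 2 (volume : Measure (Space n)) ×
      Lp ℝ 2 (volume.restrict E))) :=
    { carrier := {x | ∃ (φ : Space n → ℝ) (hφ : IsTestFunction φ),
        energyVector β K E (mg hφ) (mu hφ) = x}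
      add_mem' := by
        rintro _ _ ⟨φ, hφ, rfl⟩ ⟨ψ, hψ, rfl⟩
        exact ⟨_, hφ.add_smul hψ 1 1, (hlin hφ hψ 1 1).trans (by rw [one_smul, one_smul])⟩
      zero_mem' := ⟨_, isTestFunction_zero.add_smul isTestFunction_zero 0 0,
        (hlin isTestFunction_zero isTestFunction_zero 0 0).trans (by
          rw [zero_smul, add_zero])⟩
      smul_mem' := by
        rintro c _ ⟨φ, hφ, rfl⟩
        exact ⟨_, hφ.add_smul hφ c 0, (hlin hφ hφ c 0).trans (by rw [zero_smul, add_zero])⟩ }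
  let e := energyVector β K E (u := fun _ => (1 : ℝ)) (g := fun _ => 0) (by simp) (memLp_const 1)
  let p := S.topologicalClosure.starProjection e
  have hp : p ∈ closure (S : Set _) := S.topologicalClosure.starProjection_apply_mem e
  have horth : e - p ∈ S.topologicalClosureᗮ := Submodule.sub_starProjection_mem_orthogonal e
  obtain ⟨x, hxS, hx⟩ := mem_closure_iff_seq_limit.1 hp
  choose φ hφ hφx using hxS
  -- The first component of the projection is `√a_E g`, where `g` is the limit of the gradients.
  let P := (WithLp.ofLp p).1
  let g : Space n → Space n := fun x => (√(permittivity β E x))⁻¹ • P x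
  have hsq : ∀ x, 1 ≤ √(permittivity β E x) := fun x =>
    Real.one_le_sqrt.2 (one_le_permittivity hβ E x)
  have hgm : MemLp g 2 volume := by
    refine (Lp.memLp P).of_le
      ((measurable_permittivity β hE).sqrt.inv.aestronglyMeasurable.smul (Lp.aestronglyMeasurable P))
      (Eventually.of_forall fun x => ?_)
    rw [norm_smul, norm_inv, Real.norm_of_nonneg (Real.sqrt_nonneg _)]
    exact mul_le_of_le_one_left (norm_nonneg _) (inv_le_one_of_one_le₀ (hsq x))
  have hPlim : Tendsto (fun k => (mg (hφ k)).toLp _) atTop (𝓝 P) := by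
    have := ((WithLp.prod_continuous_ofLp 2 _ _).tendsto p).comp hx
    have := (continuous_fst.tendsto _).comp this
    refine this.congr fun k => ?_
    simp only [Function.comp_apply, ← hφx]
    rfl
  have hglim : Tendsto (fun k => eLpNorm (fun x => gradient (φ k) x - g x) 2 volume)
      atTop (𝓝 0) := by
    have := (Lp.tendsto_Lp_iff_tendsto_eLpNorm'' _ (fun k => mg (hφ k)) P (Lp.memLp P)).1
      (by rwa [Lp.toLp_coeFn])
    refine tendsto_of_tendsto_of_tendsto_of_le_of_le tendsto_const_nhds this (fun _ => zero_le)
      fun k => eLpNorm_mono fun x => ?_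
    have e1 : gradient (φ k) x - g x = (√(permittivity β E x))⁻¹ •
        (√(permittivity β E x) • gradient (φ k) x - P x) := by
      rw [smul_sub, inv_smul_smul₀ (by linarith [hsq x])]
    rw [e1, norm_smul, norm_inv, Real.norm_of_nonneg (Real.sqrt_nonneg _)]
    exact mul_le_of_le_one_left (norm_nonneg _) (inv_le_one_of_one_le₀ (hsq x))
  obtain ⟨u, hu, hulim⟩ := exists_memD1_of_tendsto hn hφ hgm hglim
  have hpu : p = energyVector β K E (memLp_sqrt_permittivity_smul hβ hE hu.grad_memLp)
      (memLp_restrict_of_subset_ball hn hu.memLp hEM) := by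
    refine tendsto_nhds_unique hx ?_
    refine (tendsto_energyVector hn K hβ hE hEM hu hφ hulim hglim).congr fun k => hφx k
  refine ⟨u, g, hu, fun u' g' h' => ?_⟩
  obtain ⟨ψ, hψ, hψ1, hψ2⟩ := h'.approx
  have hlim := tendsto_energyVector hn K hβ hE hEM h' hψ hψ1 hψ2
  have hmem : energyVector β K E (memLp_sqrt_permittivity_smul hβ hE h'.grad_memLp)
      (memLp_restrict_of_subset_ball hn h'.memLp hEM) ∈ S.topologicalClosure :=
    mem_closure_of_tendsto hlim (Eventually.of_forall fun k => ⟨ψ k, hψ k, rfl⟩)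
  have h0 := Submodule.inner_left_of_mem_orthogonal hmem horth
  rw [inner_sub_left, sub_eq_zero, hpu, inner_energyVector hβ hK, inner_energyVector hβ hK] at h0
  simpa using h0.symm

/-! ### The electrostatic energy as the reciprocal of a total charge -/

/-- The capacity-like quantity `K⁻¹ ∫_E (1 - u)`, for `u` the equilibrium potential. It is the
minimum of `∫ a_E |∇u|² + K⁻¹ ∫_E (1 - u)²`, and the reciprocal of the electrostatic energy. -/
noncomputable def totalCharge (K : ℝ) (E : Set (Space n)) (u : Space n → ℝ) : ℝ :=
  K⁻¹ * ∫ x in E, (1 - u x)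

lemma integrable_permittivity_mul_inner {β : ℝ} (hβ : 1 ≤ β) {E : Set (Space n)}
    (hE : MeasurableSet E) {g g' : Space n → Space n} (hg : MemLp g 2 volume)
    (hg' : MemLp g' 2 volume) :
    Integrable fun x => permittivity β E x * inner ℝ (g x) (g' x) := by
  refine (integrable_inner_of_memLp (memLp_permittivity_smul hβ hE hg) hg').congr
    (Eventually.of_forall fun x => ?_)
  simp [inner_smul_left]

lemma isFiniteMeasure_restrict_of_subset_ball {E : Set (Space n)} {M : ℝ}
    (hEM : E ⊆ Metric.ball 0 M) : IsFiniteMeasure ((volume : Measure (Space n)).restrict E) :=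
  isFiniteMeasure_restrict.2 (ne_top_of_le_ne_top measure_ball_lt_top.ne (measure_mono hEM))

lemma IsPotential.totalCharge_eq_sub (hn : 3 ≤ n) {β K : ℝ} {E : Set (Space n)} {M : ℝ}
    (hEM : E ⊆ Metric.ball 0 M) {u : Space n → ℝ} {g : Space n → Space n}
    (h : IsPotential β K E u g) :
    totalCharge K E u = K⁻¹ * volume.real E - K⁻¹ * ∫ x in E, u x := by
  have := isFiniteMeasure_restrict_of_subset_ball hEM
  have hu := (memLp_restrict_of_subset_ball hn h.memD1.memLp hEM).integrable one_le_two
  unfold totalCharge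
  rw [integral_sub (integrable_const 1) hu]
  simp [mul_sub]

/-- Testing the equation of the potential with a function `w` of `D¹`. -/
lemma IsPotential.totalCharge_eq (hn : 3 ≤ n) {β K : ℝ} {E : Set (Space n)} {M : ℝ}
    (hEM : E ⊆ Metric.ball 0 M) {u : Space n → ℝ} {g : Space n → Space n}
    (h : IsPotential β K E u g) {w : Space n → ℝ} {gw : Space n → Space n} (hw : MemD1 w gw) :
    totalCharge K E u = (∫ x, permittivity β E x * inner ℝ (g x) (gw x))
      + K⁻¹ * ∫ x in E, (1 - u x) * (1 - w x) := by
  have := isFiniteMeasure_restrict_of_subset_ball hEM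
  have hu2 := memLp_restrict_of_subset_ball hn h.memD1.memLp hEM
  have hw2 := memLp_restrict_of_subset_ball hn hw.memLp hEM
  have hu := hu2.integrable one_le_two
  have hwi := hw2.integrable one_le_two
  have huw := integrable_mul_of_memLp hu2 hw2
  have e := h.equation w gw hw
  have e2 : ∫ x in E, (1 - u x) * (1 - w x)
      = (∫ x in E, (1 - u x)) - (∫ x in E, w x) + ∫ x in E, u x * w x := by
    have i1 : Integrable (fun x => 1 - u x) (volume.restrict E) := (integrable_const 1).sub hu
    have i2 : Integrable (fun x => 1 - u x - w x) (volume.restrict E) := i1.sub hwi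
    rw [← integral_sub i1 hwi, ← integral_add i2 huw]
    refine integral_congr_ae (Eventually.of_forall fun x => ?_)
    simp only
    ring
  rw [e2]
  unfold totalCharge
  linear_combination -e

lemma IsPotential.totalCharge_eq_energy (hn : 3 ≤ n) {β K : ℝ} {E : Set (Space n)} {M : ℝ}
    (hEM : E ⊆ Metric.ball 0 M) {u : Space n → ℝ} {g : Space n → Space n}
    (h : IsPotential β K E u g) :
    totalCharge K E u = (∫ x, permittivity β E x * ‖g x‖ ^ 2)
      + K⁻¹ * ∫ x in E, (1 - u x) ^ 2 := by
  rw [h.totalCharge_eq hn hEM h.memD1]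
  simp only [real_inner_self_eq_norm_sq, sq]

lemma IsPotential.eLpNorm_grad_le (hn : 3 ≤ n) {β K : ℝ} (hβ : 1 ≤ β) (hK : 0 < K)
    {E : Set (Space n)} (hE : MeasurableSet E) {M : ℝ}
    (hEM : E ⊆ Metric.ball 0 M) {u : Space n → ℝ} {g : Space n → Space n}
    (h : IsPotential β K E u g) :
    (eLpNorm g 2 volume).toReal ^ 2 ≤ totalCharge K E u := by
  rw [h.totalCharge_eq_energy hn hEM]
  have h1 : (eLpNorm g 2 volume).toReal ^ 2 = ∫ x, ‖g x‖ ^ 2 := by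
    have := integral_inner_eq_inner_toLp h.memD1.grad_memLp h.memD1.grad_memLp
    rw [real_inner_self_eq_norm_sq, Lp.norm_toLp] at this
    rw [← this]
    simp
  have h2 : ∫ x, ‖g x‖ ^ 2 ≤ ∫ x, permittivity β E x * ‖g x‖ ^ 2 := by
    refine integral_mono ?_ ?_ fun x => ?_
    · simpa using integrable_inner_of_memLp h.memD1.grad_memLp h.memD1.grad_memLp
    · simpa using integrable_permittivity_mul_inner hβ hE h.memD1.grad_memLp h.memD1.grad_memLp
    · exact le_mul_of_one_le_left (sq_nonneg _) (one_le_permittivity hβ E x)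
  have h3 : 0 ≤ K⁻¹ * ∫ x in E, (1 - u x) ^ 2 :=
    mul_nonneg (inv_nonneg.2 hK.le) (integral_nonneg fun x => sq_nonneg _)
  rw [h1]
  linarith

/-- The total charge vanishes only if the potential does (Sobolev), which forces `|E| = 0`. -/
lemma IsPotential.totalCharge_pos (hn : 3 ≤ n) {β K : ℝ} (hβ : 1 ≤ β) (hK : 0 < K)
    {E : Set (Space n)} (hE : MeasurableSet E) {M : ℝ}
    (hEM : E ⊆ Metric.ball 0 M) (hE0 : volume E ≠ 0) {u : Space n → ℝ} {g : Space n → Space n}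
    (h : IsPotential β K E u g) : 0 < totalCharge K E u := by
  have h1 := h.eLpNorm_grad_le hn hβ hK hE hEM
  refine lt_of_le_of_ne ((sq_nonneg _).trans h1) fun h0 => ?_
  rw [← h0] at h1
  have h2 : (eLpNorm g 2 volume).toReal = 0 := by nlinarith
  have h3 : eLpNorm g 2 volume = 0 := by
    rcases (ENNReal.toReal_eq_zero_iff _).1 h2 with h | h'
    · exact h
    · exact absurd h' h.memD1.grad_memLp.eLpNorm_ne_top
  obtain ⟨C, hC⟩ := exists_sobolev_memD1 hn
  have h4 := hC u g h.memD1
  rw [h3, mul_zero, nonpos_iff_eq_zero, eLpNorm_eq_zero_iff h.memD1.memLp.1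
    (zero_lt_two.trans_le (two_le_sobolevExponent hn)).ne'] at h4
  rw [h.totalCharge_eq_sub hn hEM, integral_congr_ae (ae_restrict_of_ae h4)] at h0
  simp only [Pi.zero_apply, integral_zero, mul_zero, sub_zero] at h0
  have h5 : volume.real E = 0 := by
    rcases mul_eq_zero.1 h0.symm with h | h
    · exact absurd h (inv_ne_zero hK.ne')
    · exact h
  rcases (ENNReal.toReal_eq_zero_iff _).1 h5 with h | h
  · exact hE0 h
  · exact ne_top_of_le_ne_top measure_ball_lt_top.ne (measure_mono hEM) h

/-- The optimal charge distribution is `(1 - u) 1_E`, normalised to have total charge one. -/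
lemma IsPotential.admissible (hn : 3 ≤ n) {β K : ℝ}
    {E : Set (Space n)} (hE : MeasurableSet E) {M : ℝ}
    (hEM : E ⊆ Metric.ball 0 M) {u : Space n → ℝ} {g : Space n → Space n}
    (h : IsPotential β K E u g) (hm : 0 < totalCharge K E u) :
    Admissible β E (fun x => (totalCharge K E u)⁻¹ * u x) (fun x => (totalCharge K E u)⁻¹ • g x)
      (E.indicator fun x => (totalCharge K E u)⁻¹ * (K⁻¹ * (1 - u x))) := by
  have := isFiniteMeasure_restrict_of_subset_ball hEM
  have hu2 := memLp_restrict_of_subset_ball hn h.memD1.memLp hEM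
  refine ⟨h.memD1.const_smul _, ?_, ?_, ?_, ?_⟩
  · rw [memLp_indicator_iff_restrict hE]
    exact (((memLp_const 1).sub hu2).const_mul _).const_mul _
  · exact Eventually.of_forall fun x hx => Set.indicator_of_notMem hx _
  · rw [integral_indicator hE, integral_const_mul, integral_const_mul]
    exact inv_mul_cancel₀ hm.ne'
  · intro φ hφ
    have hφ2 : MemLp φ 2 (volume.restrict E) := hφ.memLp 2 |>.restrict E
    have e := h.equation φ _ hφ.memD1
    have e1 : ∫ x, permittivity β E x * inner ℝ ((totalCharge K E u)⁻¹ • g x) (gradient φ x)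
        = (totalCharge K E u)⁻¹ * ∫ x, permittivity β E x * inner ℝ (g x) (gradient φ x) := by
      rw [← integral_const_mul]
      refine integral_congr_ae (Eventually.of_forall fun x => ?_)
      simp only [inner_smul_left, conj_trivial]
      ring
    have e2 : ∫ x, E.indicator (fun x => (totalCharge K E u)⁻¹ * (K⁻¹ * (1 - u x))) x * φ x
        = (totalCharge K E u)⁻¹ * (K⁻¹ * ((∫ x in E, φ x) - ∫ x in E, u x * φ x)) := by
      rw [← integral_sub (hφ2.integrable one_le_two) (integrable_mul_of_memLp hu2 hφ2),
        ← integral_const_mul, ← integral_const_mul, ← integral_indicator hE]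
      refine integral_congr_ae (Eventually.of_forall fun x => ?_)
      by_cases hx : x ∈ E
      · simp [hx]; ring
      · simp [hx]
    rw [e1, e2]
    congr 1
    linear_combination e

/-- The equation of an admissible pair can be tested with every function of `D¹`. -/
lemma Admissible.equation_memD1 (hn : 3 ≤ n) {β : ℝ} (hβ : 1 ≤ β) {E : Set (Space n)}
    (hE : MeasurableSet E) {M : ℝ} (hEM : E ⊆ Metric.ball 0 M) {w : Space n → ℝ}
    {gw : Space n → Space n} {ρ : Space n → ℝ} (h : Admissible β E w gw ρ) {u : Space n → ℝ}
    {g : Space n → Space n} (hu : MemD1 u g) :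
    ∫ x, permittivity β E x * inner ℝ (gw x) (g x) = ∫ x in E, ρ x * u x := by
  obtain ⟨φ, hφ, h1, h2⟩ := hu.approx
  have l1 := tendsto_integral_inner (memLp_permittivity_smul hβ hE h.memD1.grad_memLp)
    hu.grad_memLp (fun k => (hφ k).gradient_memLp 2) h2
  have l2 := tendsto_integral_inner (h.memLp.restrict E)
    (memLp_restrict_of_subset_ball hn hu.memLp hEM)
    (fun k => ((hφ k).memLp 2).restrict E)
    (tendsto_eLpNorm_restrict hn hEM
      (fun k => ((hφ k).memLp (sobolevExponent n)).1.sub hu.memLp.1) h1)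
  have e : ∀ k, ∫ x, inner ℝ (permittivity β E x • gw x) (gradient (φ k) x)
      = ∫ x in E, inner ℝ (ρ x) (φ k x) := by
    intro k
    have := h.equation (φ k) (hφ k)
    simp only [inner_smul_left, conj_trivial]
    rw [this, ← integral_indicator hE]
    refine integral_congr_ae ?_
    filter_upwards [h.eq_zero] with x hx
    by_cases hxE : x ∈ E
    · simp [hxE, mul_comm]
    · simp [hxE, hx hxE]
  simp_rw [e] at l1
  have := tendsto_nhds_unique l1 l2
  simpa [inner_smul_left, mul_comm] using this

/-- Every admissible pair has energy at least the reciprocal of the total charge: expand the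
energy of its difference from the optimal pair. -/
lemma Admissible.inv_totalCharge_le (hn : 3 ≤ n) {β K : ℝ} (hβ : 1 ≤ β) (hK : 0 < K)
    {E : Set (Space n)} (hE : MeasurableSet E) {M : ℝ} (hEM : E ⊆ Metric.ball 0 M)
    {u : Space n → ℝ} {g : Space n → Space n} (h : IsPotential β K E u g)
    (hm : 0 < totalCharge K E u) {w : Space n → ℝ}
    {gw : Space n → Space n} {ρ : Space n → ℝ} (hw : Admissible β E w gw ρ) :
    (totalCharge K E u)⁻¹ ≤
      (∫ x, permittivity β E x * ‖gw x‖ ^ 2) + K * ∫ x in E, ρ x ^ 2 := by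
  have := isFiniteMeasure_restrict_of_subset_ball hEM
  set m := totalCharge K E u with hmdef
  have hu2 := memLp_restrict_of_subset_ball hn h.memD1.memLp hEM
  have hv2 : MemLp (fun x => 1 - u x) 2 (volume.restrict E) := (memLp_const 1).sub hu2
  have hρ2 := hw.memLp.restrict E
  have hg := h.memD1.grad_memLp
  have hgw := hw.memD1.grad_memLp
  have e1 := hw.equation_memD1 hn hβ hE hEM h.memD1
  have e2 := h.totalCharge_eq_energy hn hEM
  have hone : ∫ x in E, ρ x = 1 := by
    rw [← hw.integral_eq_one, ← integral_indicator hE]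
    refine integral_congr_ae ?_
    filter_upwards [hw.eq_zero] with x hx
    by_cases hxE : x ∈ E
    · simp [hxE]
    · simp [hxE, hx hxE]
  have e3 : ∫ x in E, ρ x * (1 - u x) = 1 - ∫ x in E, ρ x * u x := by
    have := integral_sub (hρ2.integrable one_le_two) (integrable_mul_of_memLp hρ2 hu2)
    rw [hone] at this
    simpa [mul_sub] using this
  have i1 : Integrable fun x => permittivity β E x * ‖gw x‖ ^ 2 := by
    simpa using integrable_permittivity_mul_inner hβ hE hgw hgw
  have i2 : Integrable fun x => permittivity β E x * ‖g x‖ ^ 2 := by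
    simpa using integrable_permittivity_mul_inner hβ hE hg hg
  have i3 := integrable_permittivity_mul_inner hβ hE hgw hg
  have j1 : Integrable (fun x => ρ x ^ 2) (volume.restrict E) := by
    simpa [sq] using integrable_mul_of_memLp hρ2 hρ2
  have j2 : Integrable (fun x => (1 - u x) ^ 2) (volume.restrict E) := by
    simpa [sq] using integrable_mul_of_memLp hv2 hv2
  have j3 := integrable_mul_of_memLp hρ2 hv2
  -- `p1` and `p2` are the two parts of the energy of the difference from the optimal pair.
  have p1 : 0 ≤ ∫ x, permittivity β E x * ‖gw x - m⁻¹ • g x‖ ^ 2 :=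
    integral_nonneg fun x =>
      mul_nonneg (zero_le_one.trans (one_le_permittivity hβ E x)) (sq_nonneg _)
  have p2 : 0 ≤ ∫ x in E, (ρ x - m⁻¹ * (K⁻¹ * (1 - u x))) ^ 2 :=
    integral_nonneg fun x => sq_nonneg _
  have q1 : ∫ x, permittivity β E x * ‖gw x - m⁻¹ • g x‖ ^ 2
      = (∫ x, permittivity β E x * ‖gw x‖ ^ 2)
        - 2 * m⁻¹ * (∫ x, permittivity β E x * inner ℝ (gw x) (g x))
        + m⁻¹ ^ 2 * ∫ x, permittivity β E x * ‖g x‖ ^ 2 := by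
    have i4 : Integrable fun x => permittivity β E x * ‖gw x‖ ^ 2
        - 2 * m⁻¹ * (permittivity β E x * inner ℝ (gw x) (g x)) := i1.sub (i3.const_mul _)
    rw [← integral_const_mul, ← integral_const_mul, ← integral_sub i1 (i3.const_mul _),
      ← integral_add i4 (i2.const_mul _)]
    refine integral_congr_ae (Eventually.of_forall fun x => ?_)
    simp only
    rw [norm_sub_sq_real, inner_smul_right, norm_smul, mul_pow, Real.norm_eq_abs, sq_abs]
    ring
  have q2 : ∫ x in E, (ρ x - m⁻¹ * (K⁻¹ * (1 - u x))) ^ 2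
      = (∫ x in E, ρ x ^ 2) - 2 * m⁻¹ * K⁻¹ * (∫ x in E, ρ x * (1 - u x))
        + m⁻¹ ^ 2 * K⁻¹ ^ 2 * ∫ x in E, (1 - u x) ^ 2 := by
    have j4 : Integrable (fun x => ρ x ^ 2 - 2 * m⁻¹ * K⁻¹ * (ρ x * (1 - u x)))
        (volume.restrict E) := j1.sub (j3.const_mul _)
    rw [← integral_const_mul, ← integral_const_mul, ← integral_sub j1 (j3.const_mul _),
      ← integral_add j4 (j2.const_mul _)]
    refine integral_congr_ae (Eventually.of_forall fun x => ?_)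
    simp only
    ring
  rw [q1, e1] at p1
  rw [q2, e3] at p2
  have p3 := mul_nonneg hK.le p2
  have hKK : K * K⁻¹ = 1 := mul_inv_cancel₀ hK.ne'
  have hmm : m⁻¹ * m = 1 := inv_mul_cancel₀ hm.ne'
  have total : 0 ≤ (∫ x, permittivity β E x * ‖gw x‖ ^ 2) + K * (∫ x in E, ρ x ^ 2)
      - 2 * m⁻¹ + m⁻¹ ^ 2 * m := by
    refine (add_nonneg p1 p3).trans (le_of_eq ?_)
    rw [← hmdef] at e2
    linear_combination (-2 * m⁻¹ * (1 - ∫ x in E, ρ x * u x) +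
      m⁻¹ ^ 2 * K⁻¹ * ∫ x in E, (1 - u x) ^ 2) * hKK - m⁻¹ ^ 2 * e2
  have : m⁻¹ ^ 2 * m = m⁻¹ := by rw [sq, mul_assoc, hmm, mul_one]
  linarith

/-- The electrostatic energy is the reciprocal of the total charge of the equilibrium potential. -/
theorem IsPotential.electrostaticEnergy_eq (hn : 3 ≤ n) {β K : ℝ} (hβ : 1 ≤ β) (hK : 0 < K)
    {E : Set (Space n)} (hE : MeasurableSet E) {M : ℝ} (hEM : E ⊆ Metric.ball 0 M)
    (hE0 : volume E ≠ 0) {u : Space n → ℝ} {g : Space n → Space n} (h : IsPotential β K E u g) :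
    electrostaticEnergy β K E = (((totalCharge K E u)⁻¹ : ℝ) : EReal) := by
  have hm := h.totalCharge_pos hn hβ hK hE hEM hE0
  refine le_antisymm ?_ ?_
  · refine iInf_le_of_le _ (iInf_le_of_le _ (iInf_le_of_le _
      (iInf_le_of_le (h.admissible hn hE hEM hm) ?_)))
    rw [EReal.coe_le_coe_iff]
    set m := totalCharge K E u with hmdef
    have e1 : ∫ x, permittivity β E x * ‖m⁻¹ • g x‖ ^ 2
        = m⁻¹ ^ 2 * ∫ x, permittivity β E x * ‖g x‖ ^ 2 := by
      rw [← integral_const_mul]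
      refine integral_congr_ae (Eventually.of_forall fun x => ?_)
      simp only
      rw [norm_smul, mul_pow, Real.norm_eq_abs, sq_abs]
      ring
    have e2 : ∫ x in E, (E.indicator (fun x => m⁻¹ * (K⁻¹ * (1 - u x))) x) ^ 2
        = m⁻¹ ^ 2 * K⁻¹ ^ 2 * ∫ x in E, (1 - u x) ^ 2 := by
      rw [← integral_const_mul]
      refine setIntegral_congr_fun hE fun x hx => ?_
      simp only [Set.indicator_of_mem hx]
      ring
    have e3 := h.totalCharge_eq_energy hn hEM
    have hKK : K * K⁻¹ = 1 := mul_inv_cancel₀ hK.ne'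
    have hmm : m⁻¹ * m = 1 := inv_mul_cancel₀ hm.ne'
    rw [e1, e2]
    refine le_of_eq ?_
    rw [← hmdef] at e3
    linear_combination (m⁻¹ ^ 2 * K⁻¹ * ∫ x in E, (1 - u x) ^ 2) * hKK - m⁻¹ ^ 2 * e3 + m⁻¹ * hmm
  · refine le_iInf fun w => le_iInf fun gw => le_iInf fun ρ => le_iInf fun hw => ?_
    rw [EReal.coe_le_coe_iff]
    exact hw.inv_totalCharge_le hn hβ hK hE hEM h hm

/-! ### Continuity of the electrostatic energy -/

lemma IsPotential.totalCharge_le (hn : 3 ≤ n) {β K : ℝ} (hβ : 1 ≤ β) (hK : 0 < K)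
    {E : Set (Space n)} {M : ℝ} (hEM : E ⊆ Metric.ball 0 M) {u : Space n → ℝ}
    {g : Space n → Space n} (h : IsPotential β K E u g) :
    totalCharge K E u ≤ K⁻¹ * volume.real (Metric.ball (0 : Space n) M) := by
  rw [h.totalCharge_eq_sub hn hEM, ← h.equation u g h.memD1]
  have h1 : 0 ≤ ∫ x, permittivity β E x * inner ℝ (g x) (g x) := integral_nonneg fun x =>
    mul_nonneg (zero_le_one.trans (one_le_permittivity hβ E x)) real_inner_self_nonneg
  have h2 : 0 ≤ K⁻¹ * ∫ x in E, u x * u x :=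
    mul_nonneg (inv_nonneg.2 hK.le) (integral_nonneg fun x => mul_self_nonneg _)
  have h3 : K⁻¹ * volume.real E ≤ K⁻¹ * volume.real (Metric.ball (0 : Space n) M) :=
    mul_le_mul_of_nonneg_left (measureReal_mono hEM measure_ball_lt_top.ne) (inv_nonneg.2 hK.le)
  linarith

/-- Testing the equation of each of two potentials with the other one expresses the difference of
the total charges through the differences of the coefficients only. -/
lemma IsPotential.totalCharge_sub_eq (hn : 3 ≤ n) {β β' K K' : ℝ} (hβ : 1 ≤ β) (hβ' : 1 ≤ β')
    {E E' : Set (Space n)} (hE : MeasurableSet E) (hE' : MeasurableSet E') {M : ℝ}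
    (hEM : E ⊆ Metric.ball 0 M) (hEM' : E' ⊆ Metric.ball 0 M) {u u' : Space n → ℝ}
    {g g' : Space n → Space n} (h : IsPotential β K E u g) (h' : IsPotential β' K' E' u' g') :
    totalCharge K E u - totalCharge K' E' u'
      = (∫ x, inner ℝ ((E.indicator (fun _ => β - 1) x - E'.indicator (fun _ => β' - 1) x) • g x)
          (g' x))
        + ∫ x in Metric.ball (0 : Space n) M, inner ℝ
          ((E.indicator (fun _ => K⁻¹) x - E'.indicator (fun _ => K'⁻¹) x) • (1 - u x))
          (1 - u' x) := by
  rw [h.totalCharge_eq hn hEM h'.memD1, h'.totalCharge_eq hn hEM' h.memD1]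
  have hg := h.memD1.grad_memLp
  have hg' := h'.memD1.grad_memLp
  have : IsFiniteMeasure ((volume : Measure (Space n)).restrict (Metric.ball 0 M)) :=
    isFiniteMeasure_restrict_of_subset_ball subset_rfl
  have hv : MemLp (fun x => 1 - u x) 2 (volume.restrict (Metric.ball 0 M)) :=
    (memLp_const 1).sub (memLp_restrict_ball hn h.memD1.memLp M)
  have hv' : MemLp (fun x => 1 - u' x) 2 (volume.restrict (Metric.ball 0 M)) :=
    (memLp_const 1).sub (memLp_restrict_ball hn h'.memD1.memLp M)
  have hvv := integrable_mul_of_memLp hv hv'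
  have e1 : (∫ x, permittivity β E x * inner ℝ (g x) (g' x))
      - (∫ x, permittivity β' E' x * inner ℝ (g' x) (g x))
      = ∫ x, inner ℝ ((E.indicator (fun _ => β - 1) x - E'.indicator (fun _ => β' - 1) x) • g x)
          (g' x) := by
    rw [← integral_sub (integrable_permittivity_mul_inner hβ hE hg hg')
      (integrable_permittivity_mul_inner hβ' hE' hg' hg)]
    refine integral_congr_ae (Eventually.of_forall fun x => ?_)
    simp only
    rw [permittivity_eq, permittivity_eq, real_inner_comm (g x) (g' x), inner_smul_left,
      conj_trivial]
    rw [real_inner_comm]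
    ring
  have key : ∀ {F : Set (Space n)} (_ : MeasurableSet F) (_ : F ⊆ Metric.ball 0 M) (c : ℝ),
      c * ∫ x in F, (1 - u x) * (1 - u' x)
        = ∫ x in Metric.ball (0 : Space n) M,
          F.indicator (fun _ => c) x * ((1 - u x) * (1 - u' x)) := by
    intro F hF hFM c
    rw [← integral_const_mul, ← integral_indicator hF, ← integral_indicator measurableSet_ball]
    refine integral_congr_ae (Eventually.of_forall fun x => ?_)
    by_cases hx : x ∈ F
    · rw [Set.indicator_of_mem hx, Set.indicator_of_mem (hFM hx), Set.indicator_of_mem hx]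
    · by_cases hx' : x ∈ Metric.ball (0 : Space n) M <;>
        simp only [Set.indicator, hx, hx', if_true, if_false, zero_mul]
  have hint : ∀ {F : Set (Space n)} (_ : MeasurableSet F) (c : ℝ),
      Integrable (fun x => F.indicator (fun _ => c) x * ((1 - u x) * (1 - u' x)))
        (volume.restrict (Metric.ball 0 M)) := by
    intro F hF c
    refine hvv.bdd_mul (c := |c|) (measurable_const.indicator hF).aestronglyMeasurable
      (Eventually.of_forall fun x => ?_)
    by_cases hx : x ∈ F <;> simp [hx]
  have e2 : K⁻¹ * (∫ x in E, (1 - u x) * (1 - u' x)) - K'⁻¹ * (∫ x in E', (1 - u' x) * (1 - u x))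
      = ∫ x in Metric.ball (0 : Space n) M, inner ℝ
          ((E.indicator (fun _ => K⁻¹) x - E'.indicator (fun _ => K'⁻¹) x) • (1 - u x))
          (1 - u' x) := by
    rw [show (fun x => (1 - u' x) * (1 - u x)) = fun x => (1 - u x) * (1 - u' x) from
      funext fun x => mul_comm _ _, key hE hEM, key hE' hEM', ← integral_sub (hint hE _) (hint hE' _)]
    refine integral_congr_ae (Eventually.of_forall fun x => ?_)
    simp
    ring
  rw [← e1, ← e2]
  ring

/-- The total charge is continuous with respect to the coefficients and to convergence of sets in
measure. -/
theorem tendsto_totalCharge (hn : 3 ≤ n) {β K : ℝ} {β_h K_h : ℕ → ℝ} (hβ : 1 ≤ β)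
    (hβ_h : ∀ h, 1 ≤ β_h h) (hK : 0 < K) (hK_h : ∀ h, 0 < K_h h)
    (hβ_lim : Tendsto β_h atTop (𝓝 β)) (hK_lim : Tendsto K_h atTop (𝓝 K))
    {E : Set (Space n)} {E_h : ℕ → Set (Space n)} (hE : MeasurableSet E)
    (hE_h : ∀ h, MeasurableSet (E_h h)) {M : ℝ} (hEM : E ⊆ Metric.ball 0 M)
    (hEM_h : ∀ h, E_h h ⊆ Metric.ball 0 M)
    (hlim : Tendsto (fun h => volume (symmDiff E (E_h h))) atTop (𝓝 0))
    {u : Space n → ℝ} {g : Space n → Space n} (hu : IsPotential β K E u g)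
    {u_h : ℕ → Space n → ℝ} {g_h : ℕ → Space n → Space n}
    (hu_h : ∀ h, IsPotential (β_h h) (K_h h) (E_h h) (u_h h) (g_h h)) :
    Tendsto (fun h => totalCharge (K_h h) (E_h h) (u_h h)) atTop (𝓝 (totalCharge K E u)) := by
  set V := volume.real (Metric.ball (0 : Space n) M)
  set μM := (volume : Measure (Space n)).restrict (Metric.ball 0 M) with hμM
  have : IsFiniteMeasure μM := isFiniteMeasure_restrict_of_subset_ball subset_rfl
  have hv : ∀ {w : Space n → ℝ} {gw : Space n → Space n}, MemD1 w gw →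
      MemLp (fun x => 1 - w x) 2 μM := fun hw =>
    (memLp_const 1).sub (memLp_restrict_ball hn hw.memLp M)
  have hKinv : Tendsto (fun h => (K_h h)⁻¹) atTop (𝓝 K⁻¹) := hK_lim.inv₀ hK.ne'
  let A : ℕ → ℝ≥0∞ := fun h => eLpNorm (fun x =>
    (E.indicator (fun _ => β - 1) x - (E_h h).indicator (fun _ => β_h h - 1) x) • g x) 2 volume
  let A' : ℕ → ℝ≥0∞ := fun h => eLpNorm (fun x =>
    (E.indicator (fun _ => K⁻¹) x - (E_h h).indicator (fun _ => (K_h h)⁻¹) x) • (1 - u x)) 2 μM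
  have hA : Tendsto A atTop (𝓝 0) := tendsto_eLpNorm_coefficient_sub hu.memD1.grad_memLp hE hE_h
    hlim (hβ_lim.sub_const 1)
  have hA' : Tendsto A' atTop (𝓝 0) := by
    refine tendsto_eLpNorm_coefficient_sub (hv hu.memD1) hE hE_h ?_ hKinv
    exact tendsto_of_tendsto_of_tendsto_of_le_of_le tendsto_const_nhds hlim (fun _ => zero_le)
      fun h => Measure.restrict_apply_le _ _
  -- A bound for the gradients and the potentials, uniform in `h`.
  obtain ⟨C, hC⟩ := exists_sobolev_memD1 hn
  obtain ⟨C', hC'⟩ := exists_eLpNorm_restrict_ball_le hn M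
  let D := √((K⁻¹ + 1) * V)
  let D' := (eLpNorm (fun _ : Space n => (1 : ℝ)) 2 μM).toReal + C' * (C * D)
  have hD : ∀ᶠ h in atTop, (eLpNorm (g_h h) 2 volume).toReal ≤ D := by
    filter_upwards [hKinv.eventually_le_const (lt_add_one K⁻¹)] with h hh
    refine Real.le_sqrt_of_sq_le ?_
    refine ((hu_h h).eLpNorm_grad_le hn (hβ_h h) (hK_h h) (hE_h h) (hEM_h h)).trans
      (((hu_h h).totalCharge_le hn (hβ_h h) (hK_h h) (hEM_h h)).trans ?_)
    exact mul_le_mul_of_nonneg_right hh measureReal_nonneg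
  have hD' : ∀ᶠ h in atTop, (eLpNorm (fun x => 1 - u_h h x) 2 μM).toReal ≤ D' := by
    filter_upwards [hD] with h hh
    have hm := (hu_h h).memD1
    have hg := hm.grad_memLp.eLpNorm_ne_top
    have b1 : eLpNorm (u_h h) 2 μM ≤ C' * (C * eLpNorm (g_h h) 2 volume) :=
      (hC' _ hm.memLp.1).trans (by gcongr; exact hC _ _ hm)
    have b2 := eLpNorm_sub_le (μ := μM) (p := 2) (f := fun _ => (1 : ℝ)) (g := u_h h)
      aestronglyMeasurable_const hm.memLp.1.restrict one_le_two
    have b3 := b2.trans (add_le_add_right b1 _)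
    have htop : (C' : ℝ≥0∞) * (C * eLpNorm (g_h h) 2 volume) ≠ ⊤ :=
      ENNReal.mul_ne_top ENNReal.coe_ne_top (ENNReal.mul_ne_top ENNReal.coe_ne_top hg)
    have h1top : eLpNorm (fun _ : Space n => (1 : ℝ)) 2 μM ≠ ⊤ := (memLp_const 1).eLpNorm_ne_top
    have b4 := ENNReal.toReal_mono (ENNReal.add_ne_top.2 ⟨h1top, htop⟩) b3
    rw [ENNReal.toReal_add h1top htop, ENNReal.toReal_mul, ENNReal.toReal_mul, ENNReal.coe_toReal,
      ENNReal.coe_toReal] at b4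
    refine b4.trans ?_
    simp only [D']
    gcongr
  have hsq : Tendsto (fun h => (A h).toReal * D + (A' h).toReal * D') atTop (𝓝 0) := by
    have t1 := (ENNReal.tendsto_toReal ENNReal.zero_ne_top).comp hA
    have t2 := (ENNReal.tendsto_toReal ENNReal.zero_ne_top).comp hA'
    simpa using (t1.mul_const D).add (t2.mul_const D')
  rw [tendsto_iff_norm_sub_tendsto_zero]
  refine squeeze_zero' (Eventually.of_forall fun _ => norm_nonneg _) ?_ hsq
  have hcoeff : ∀ (c c' : ℝ) (h : ℕ), Measurable fun x =>
      E.indicator (fun _ => c) x - (E_h h).indicator (fun _ => c') x := fun c c' h =>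
    (measurable_const.indicator hE).sub (measurable_const.indicator (hE_h h))
  filter_upwards [hD, hD'] with h h1 h2
  have hmem1 : MemLp (fun x => (E.indicator (fun _ => β - 1) x
      - (E_h h).indicator (fun _ => β_h h - 1) x) • g x) 2 volume := by
    refine ((memLp_permittivity_smul hβ hE hu.memD1.grad_memLp).sub
      (memLp_permittivity_smul (hβ_h h) (hE_h h) hu.memD1.grad_memLp)).congr_norm
      ?_ (Eventually.of_forall fun x => ?_)
    · exact (hcoeff (β - 1) (β_h h - 1) h).aestronglyMeasurable.smul hu.memD1.grad_memLp.1
    · rw [Pi.sub_apply, ← sub_smul, permittivity_eq, permittivity_eq]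
      congr 2
      ring
  have hmem2 : MemLp (fun x => (E.indicator (fun _ => K⁻¹) x
      - (E_h h).indicator (fun _ => (K_h h)⁻¹) x) • (1 - u x)) 2 μM := by
    refine (hv hu.memD1).of_le_mul (c := K⁻¹ + (K_h h)⁻¹) ?_ (Eventually.of_forall fun x => ?_)
    · exact (hcoeff K⁻¹ (K_h h)⁻¹ h).aestronglyMeasurable.smul (hv hu.memD1).1
    · rw [norm_smul]
      refine mul_le_mul_of_nonneg_right ?_ (norm_nonneg _)
      have p1 := inv_pos.2 hK
      have p2 := inv_pos.2 (hK_h h)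
      rw [Real.norm_eq_abs, abs_le]
      by_cases hx : x ∈ E <;> by_cases hx' : x ∈ E_h h <;> simp only [Set.indicator, hx, hx',
        if_true, if_false] <;> constructor <;> linarith
  rw [norm_sub_rev, hu.totalCharge_sub_eq hn hβ (hβ_h h) hE (hE_h h) hEM (hEM_h h) (hu_h h)]
  refine (norm_add_le _ _).trans (add_le_add ?_ ?_)
  · exact (norm_integral_inner_le hmem1 (hu_h h).memD1.grad_memLp).trans
      (mul_le_mul_of_nonneg_left h1 ENNReal.toReal_nonneg)
  · exact (norm_integral_inner_le hmem2 (hv (hu_h h).memD1)).trans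
      (mul_le_mul_of_nonneg_left h2 ENNReal.toReal_nonneg)

/-- The electrostatic energy is continuous with respect to the parameters and to convergence in
measure of uniformly bounded sets. -/
theorem tendsto_electrostaticEnergy (hn : 3 ≤ n) {β K : ℝ} {β_h K_h : ℕ → ℝ} (hβ : 1 ≤ β)
    (hβ_h : ∀ h, 1 ≤ β_h h) (hK : 0 < K) (hK_h : ∀ h, 0 < K_h h)
    (hβ_lim : Tendsto β_h atTop (𝓝 β)) (hK_lim : Tendsto K_h atTop (𝓝 K))
    {E : Set (Space n)} {E_h : ℕ → Set (Space n)} (hE : MeasurableSet E)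
    (hE_h : ∀ h, MeasurableSet (E_h h)) {M : ℝ} (hEM : E ⊆ Metric.ball 0 M)
    (hEM_h : ∀ h, E_h h ⊆ Metric.ball 0 M) (hE0 : volume E ≠ 0) (hE0_h : ∀ h, volume (E_h h) ≠ 0)
    (hlim : Tendsto (fun h => volume (symmDiff E (E_h h))) atTop (𝓝 0)) :
    Tendsto (fun h => (electrostaticEnergy (β_h h) (K_h h) (E_h h)).toReal) atTop
      (𝓝 (electrostaticEnergy β K E).toReal) := by
  obtain ⟨u, g, hu⟩ := exists_isPotential hn hβ hK hE hEM
  choose u_h g_h hu_h using fun h => exists_isPotential hn (hβ_h h) (hK_h h) (hE_h h) (hEM_h h)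
  rw [hu.electrostaticEnergy_eq hn hβ hK hE hEM hE0, EReal.toReal_coe]
  simp_rw [fun h => (hu_h h).electrostaticEnergy_eq hn (hβ_h h) (hK_h h) (hE_h h) (hEM_h h)
    (hE0_h h), EReal.toReal_coe]
  exact (tendsto_totalCharge hn hβ hβ_h hK hK_h hβ_lim hK_lim hE hE_h hEM hEM_h hlim hu hu_h).inv₀
    (hu.totalCharge_pos hn hβ hK hE hEM hE0).ne'

lemma coe_toReal_electrostaticEnergy (hn : 3 ≤ n) {β K : ℝ} (hβ : 1 ≤ β) (hK : 0 < K)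
    {E : Set (Space n)} (hE : MeasurableSet E) {M : ℝ} (hEM : E ⊆ Metric.ball 0 M)
    (hE0 : volume E ≠ 0) :
    ((electrostaticEnergy β K E).toReal : EReal) = electrostaticEnergy β K E ∧
      0 ≤ (electrostaticEnergy β K E).toReal := by
  obtain ⟨u, g, hu⟩ := exists_isPotential hn hβ hK hE hEM
  rw [hu.electrostaticEnergy_eq hn hβ hK hE hEM hE0, EReal.toReal_coe]
  exact ⟨rfl, (inv_pos.2 (hu.totalCharge_pos hn hβ hK hE hEM hE0)).le⟩

/-! ### Invariance under modification by null sets -/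

lemma permittivity_ae_eq (β : ℝ) {E F : Set (Space n)} (h : E =ᵐ[volume] F) :
    permittivity β E =ᵐ[volume] permittivity β F := by
  filter_upwards [h.mem_iff] with x hx
  by_cases hE : x ∈ E
  · simp [permittivity, hE, hx.1 hE]
  · have hF : x ∉ F := fun h => hE (hx.2 h)
    simp [permittivity, hE, hF]

lemma Admissible.congr {β : ℝ} {E F : Set (Space n)} (h : E =ᵐ[volume] F) {u : Space n → ℝ}
    {g : Space n → Space n} {ρ : Space n → ℝ} (hE : Admissible β E u g ρ) :
    Admissible β F u g ρ := by
  refine ⟨hE.memD1, hE.memLp, ?_, hE.integral_eq_one, fun φ hφ => ?_⟩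
  · filter_upwards [hE.eq_zero, h.mem_iff] with x hx hEF hxF
    exact hx fun hxE => hxF (hEF.1 hxE)
  · rw [← hE.equation φ hφ]
    refine integral_congr_ae ?_
    filter_upwards [permittivity_ae_eq β h] with x hx
    rw [hx]

lemma electrostaticEnergy_congr (β K : ℝ) {E F : Set (Space n)} (h : E =ᵐ[volume] F) :
    electrostaticEnergy β K E = electrostaticEnergy β K F := by
  unfold electrostaticEnergy
  have hadm : ∀ u g ρ, Admissible β E u g ρ ↔ Admissible β F u g ρ := fun u g ρ =>
    ⟨fun hE => hE.congr h, fun hF => hF.congr h.symm⟩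
  have hint : ∀ g : Space n → Space n, ∫ x, permittivity β E x * ‖g x‖ ^ 2
      = ∫ x, permittivity β F x * ‖g x‖ ^ 2 := fun g => by
    refine integral_congr_ae ?_
    filter_upwards [permittivity_ae_eq β h] with x hx
    rw [hx]
  simp_rw [hadm, hint, setIntegral_congr_set h]

lemma energy_congr (β K Q : ℝ) {E F : Set (Space n)} (h : E =ᵐ[volume] F) :
    energy β K Q E = energy β K Q F := by
  unfold energy
  rw [perimeter_congr h, electrostaticEnergy_congr β K h]

/-! ### Recovery sequences -/

lemma tendsto_measure_of_symmDiff {X : Type*} [MeasurableSpace X] {μ : Measure X} {E : Set X}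
    {E_h : ℕ → Set X} (hE : MeasurableSet E) (hE_h : ∀ h, MeasurableSet (E_h h))
    (h : Tendsto (fun h => μ (symmDiff E (E_h h))) atTop (𝓝 0)) :
    Tendsto (fun h => μ (E_h h)) atTop (𝓝 (μ E)) := by
  let S : MeasuredSets μ := ⟨E, hE⟩
  let T : ℕ → MeasuredSets μ := fun h => ⟨E_h h, hE_h h⟩
  have hT : Tendsto T atTop (𝓝 S) := by
    rw [tendsto_iff_edist_tendsto_0]
    refine h.congr fun k => ?_
    rw [symmDiff_comm]
    rfl
  exact (MeasuredSets.continuous_measure.tendsto S).comp hT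

lemma volume_smul_of_pos {c : ℝ} (hc : 0 < c) (F : Set (Space n)) :
    volume (c • F) = ENNReal.ofReal (c ^ n) * volume F := by
  rw [Measure.addHaar_smul, finrank_euclideanSpace, Fintype.card_fin, abs_of_pos (by positivity)]

/-- A set of finite measure depends continuously on dilation, in measure: approximate the set by a
compact set from inside and an open set from outside. -/
lemma tendsto_volume_symmDiff_smul {F : Set (Space n)} (hF : MeasurableSet F) {R : ℝ}
    (hFR : F ⊆ Metric.ball 0 R) {c : ℕ → ℝ} (hc0 : ∀ h, 0 < c h) (hc1 : ∀ h, c h ≤ 1)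
    (hc : Tendsto c atTop (𝓝 1)) :
    Tendsto (fun h => volume (symmDiff F (c h • F))) atTop (𝓝 0) := by
  have hfin : volume F ≠ ⊤ := ne_top_of_le_ne_top measure_ball_lt_top.ne (measure_mono hFR)
  have hcF : ∀ h, MeasurableSet (c h • F) := fun h => hF.const_smul_of_ne_zero (hc0 h).ne'
  have hcfin : ∀ h, volume (c h • F) ≠ ⊤ := fun h => by
    rw [volume_smul_of_pos (hc0 h)]
    exact ENNReal.mul_ne_top ENNReal.ofReal_ne_top hfin
  have h1 : Tendsto (fun h => volume (c h • F \ F)) atTop (𝓝 0) := by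
    rw [ENNReal.tendsto_nhds_zero]
    intro ε hε
    have hε2 : ε / 2 ≠ 0 := (ENNReal.half_pos hε.ne').ne'
    obtain ⟨K, hKF, hK, hKε⟩ := hF.exists_isCompact_sdiff_lt hfin hε2
    obtain ⟨U, hFU, hU, -, hUε⟩ := hF.exists_isOpen_sdiff_lt hfin hε2
    obtain ⟨δ, hδ, hδU⟩ := hK.exists_thickening_subset_open hU (hKF.trans hFU)
    have hcR : Tendsto (fun h => |c h - 1| * R) atTop (𝓝 0) := by
      simpa using ((hc.sub_const 1).abs).mul_const R
    filter_upwards [hcR.eventually_lt_const hδ] with h hh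
    have hsub : c h • F \ F ⊆ c h • (F \ K) ∪ (U \ F) := by
      rintro _ ⟨⟨x, hx, rfl⟩, hxF⟩
      by_cases hxK : x ∈ K
      · refine Or.inr ⟨hδU (Metric.mem_thickening_iff.2 ⟨x, hxK, ?_⟩), hxF⟩
        have hxR := (mem_ball_zero_iff.1 (hFR hx)).le
        simp only [dist_eq_norm]
        rw [show c h • x - x = (c h - 1) • x by rw [sub_smul, one_smul], norm_smul]
        exact (mul_le_mul_of_nonneg_left hxR (norm_nonneg _)).trans_lt hh
      · exact Or.inl ⟨x, ⟨hx, hxK⟩, rfl⟩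
    calc volume (c h • F \ F) ≤ volume (c h • (F \ K)) + volume (U \ F) :=
          (measure_mono hsub).trans (measure_union_le _ _)
      _ ≤ ε / 2 + ε / 2 := by
          refine add_le_add ?_ hUε.le
          rw [volume_smul_of_pos (hc0 h)]
          refine (mul_le_of_le_one_left zero_le ?_).trans hKε.le
          rw [ENNReal.ofReal_le_one]
          exact pow_le_one₀ (hc0 h).le (hc1 h)
      _ = ε := ENNReal.add_halves ε
  have h2 : Tendsto (fun h => volume F - volume (c h • F) + volume (c h • F \ F)) atTop (𝓝 0) := by
    have hv : Tendsto (fun h => volume (c h • F)) atTop (𝓝 (volume F)) := by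
      simp_rw [fun h => volume_smul_of_pos (hc0 h) F]
      have : Tendsto (fun h => ENNReal.ofReal (c h ^ n)) atTop (𝓝 1) := by
        simpa using ENNReal.tendsto_ofReal (hc.pow n)
      simpa using ENNReal.Tendsto.mul_const this (Or.inr hfin)
    have := (ENNReal.Tendsto.sub (tendsto_const_nhds (x := volume F)) hv (Or.inl hfin)).add h1
    simpa using this
  have h3 := h2.add h1
  rw [add_zero] at h3
  refine tendsto_of_tendsto_of_tendsto_of_le_of_le tendsto_const_nhds h3 (fun _ => zero_le)
    fun h => ?_
  have hle : volume (F \ c h • F) ≤ volume F - volume (c h • F) + volume (c h • F \ F) := by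
    have e1 : volume (F \ c h • F) + volume (c h • F) = volume F + volume (c h • F \ F) := by
      rw [← measure_union Set.disjoint_sdiff_left (hcF h),
        ← measure_union Set.disjoint_sdiff_right ((hcF h).diff hF), Set.sdiff_union_self,
        Set.union_sdiff_self, Set.union_comm]
    have e2 : volume F ≤ volume F - volume (c h • F) + volume (c h • F) := le_tsub_add
    have e3 : volume (F \ c h • F) + volume (c h • F)
        ≤ volume F - volume (c h • F) + volume (c h • F \ F) + volume (c h • F) := by
      rw [e1, add_right_comm]
      gcongr
    exact (ENNReal.add_le_add_iff_right (hcfin h)).1 e3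
  exact (measure_union_le _ _).trans (add_le_add_left hle _)

/-- The measure of `A ∪ B_r(x₀)` takes every value between its values at `r = 0` and `r = δ`, since
its increments are bounded by those of the measure of the ball. -/
lemma exists_volume_union_ball_eq (hn : 1 ≤ n) {A : Set (Space n)} (hA : volume A ≠ ⊤)
    (x₀ : Space n) {δ : ℝ} (hδ : 0 ≤ δ) {v : ℝ≥0∞} (h0 : volume A ≤ v)
    (h1 : v ≤ volume (A ∪ Metric.ball x₀ δ)) :
    ∃ r ∈ Set.Icc 0 δ, volume (A ∪ Metric.ball x₀ r) = v := by
  have : NeZero n := ⟨by omega⟩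
  have hfin : ∀ r, volume (A ∪ Metric.ball x₀ r) ≠ ⊤ := fun r =>
    measure_union_ne_top hA measure_ball_lt_top.ne
  let G : ℝ → ℝ := fun r => volume.real (A ∪ Metric.ball x₀ r)
  let H : ℝ → ℝ := fun r => r ^ n * volume.real (Metric.ball (0 : Space n) 1)
  have hH : ∀ r, 0 ≤ r → H r = volume.real (Metric.ball x₀ r) := by
    intro r hr
    rw [Measure.real, Measure.addHaar_ball _ _ hr, ENNReal.toReal_mul, finrank_euclideanSpace,
      Fintype.card_fin, ENNReal.toReal_ofReal (by positivity)]
    rfl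
  have hstep : ∀ r s, 0 ≤ r → r ≤ s → G s - G r ∈ Set.Icc 0 (H s - H r) := by
    intro r s hr hrs
    have hball : Metric.ball x₀ r ⊆ Metric.ball x₀ s := Metric.ball_subset_ball hrs
    refine ⟨sub_nonneg.2 (measureReal_mono (Set.union_subset_union_right _ hball) (hfin s)), ?_⟩
    rw [hH s (hr.trans hrs), hH r hr, ← measureReal_sdiff hball measurableSet_ball
      measure_ball_lt_top.ne, sub_le_iff_le_add']
    refine (measureReal_mono (fun x hx => ?_) (measure_union_ne_top (hfin r)
      (measure_ne_top_of_subset Set.sdiff_subset measure_ball_lt_top.ne))).trans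
        (measureReal_union_le _ _)
    rcases hx with hx | hx
    · exact Or.inl (Or.inl hx)
    · by_cases hxr : x ∈ Metric.ball x₀ r
      · exact Or.inl (Or.inr hxr)
      · exact Or.inr ⟨hx, hxr⟩
  have habs : ∀ r s, 0 ≤ r → 0 ≤ s → |G s - G r| ≤ |H s - H r| := by
    intro r s hr hs
    rcases le_total r s with h | h
    · have := hstep r s hr h
      exact abs_le_abs_of_nonneg this.1 this.2
    · have := hstep s r hs h
      rw [abs_sub_comm, abs_sub_comm (H s)]
      exact abs_le_abs_of_nonneg this.1 this.2
  have hcont : ContinuousOn G (Set.Icc 0 δ) := by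
    intro r hr
    have hHc : Continuous H := by fun_prop
    have ht : Tendsto (fun s => |H s - H r|) (𝓝[Set.Icc 0 δ] r) (𝓝 0) := by
      have : Tendsto (fun s => |H s - H r|) (𝓝 r) (𝓝 |H r - H r|) :=
        ((hHc.tendsto r).sub_const _).abs
      rw [sub_self, abs_zero] at this
      exact this.mono_left nhdsWithin_le_nhds
    refine tendsto_iff_norm_sub_tendsto_zero.2 (squeeze_zero' (Eventually.of_forall fun _ =>
      norm_nonneg _) ?_ ht)
    filter_upwards [self_mem_nhdsWithin] with s hs
    exact habs r s hr.1 hs.1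
  have hv : v ≠ ⊤ := ne_top_of_le_ne_top (hfin δ) h1
  obtain ⟨r, hr, hGr⟩ := intermediate_value_Icc hδ hcont (show v.toReal ∈ Set.Icc (G 0) (G δ) by
    refine ⟨?_, ENNReal.toReal_mono (hfin δ) h1⟩
    simp only [G, Metric.ball_zero, Set.union_empty]
    exact ENNReal.toReal_mono hv h0)
  refine ⟨r, hr, ?_⟩
  rw [← ENNReal.ofReal_toReal (hfin r), ← ENNReal.ofReal_toReal hv]
  congr 1

/-- Outside a competitor for the radius `R > 1` there is room for a small ball. -/
lemma exists_ball_outside {F : Set (Space n)} (hn : 1 ≤ n) {R : ℝ} (hR : 1 < R)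
    (hF : IsCompetitor R F) {ε : ℝ} (hε : 0 < ε) :
    ∃ (x₀ : Space n) (δ R' : ℝ), 0 < δ ∧ δ ≤ ε ∧ R' < R ∧ Metric.ball x₀ δ ⊆ Metric.ball 0 R' ∧
      volume F < volume (F ∪ Metric.ball x₀ δ) := by
  have : NeZero n := ⟨by omega⟩
  have hfin : volume F ≠ ⊤ := by rw [hF.volume_eq]; exact measure_ball_lt_top.ne
  have hpos : volume (Metric.ball (0 : Space n) R \ F) ≠ 0 := by
    intro h0
    have h1 : volume (Metric.ball (0 : Space n) R) ≤ volume F := by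
      have h2 : volume (Metric.ball (0 : Space n) R) ≤
          volume (Metric.ball (0 : Space n) R \ F) + volume F :=
        (measure_mono (by rw [Set.sdiff_union_self]; exact Set.subset_union_left)).trans
          (measure_union_le _ _)
      rwa [h0, zero_add] at h2
    rw [hF.volume_eq, Measure.addHaar_ball _ _ (by linarith), finrank_euclideanSpace,
      Fintype.card_fin] at h1
    have hb0 : volume (Metric.ball (0 : Space n) 1) ≠ 0 :=
      (Metric.measure_ball_pos volume _ one_pos).ne'
    have h2 : ENNReal.ofReal (R ^ n) * volume (Metric.ball (0 : Space n) 1)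
        ≤ 1 * volume (Metric.ball (0 : Space n) 1) := by rwa [one_mul]
    rw [ENNReal.mul_le_mul_iff_left hb0 measure_ball_lt_top.ne, ENNReal.ofReal_le_one] at h2
    exact absurd h2 (not_le.2 (one_lt_pow₀ hR (by omega)))
  -- `x₀` is chosen such that every ball around it meets the complement of `F` in positive measure.
  obtain ⟨x₀, hx₀, hx₀'⟩ := exists_mem_forall_mem_nhdsWithin_pos_measure hpos
  have hx₀R : ‖x₀‖ < R := mem_ball_zero_iff.1 hx₀.1
  have hδ0 : 0 < min ε ((R - ‖x₀‖) / 2) := lt_min hε (by linarith)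
  refine ⟨x₀, min ε ((R - ‖x₀‖) / 2), ‖x₀‖ + (R - ‖x₀‖) / 2, hδ0, min_le_left _ _,
    by linarith, fun y hy => ?_, ?_⟩
  · rw [mem_ball_zero_iff]
    have h1 : ‖y - x₀‖ < (R - ‖x₀‖) / 2 := by
      rw [← dist_eq_norm]
      exact (Metric.mem_ball.1 hy).trans_le (min_le_right _ _)
    have h2 := norm_add_le x₀ (y - x₀)
    rw [add_sub_cancel] at h2
    linarith
  · have h1 : 0 < volume (Metric.ball x₀ (min ε ((R - ‖x₀‖) / 2)) ∩
        (Metric.ball (0 : Space n) R \ F)) :=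
      hx₀' _ (Filter.inter_mem (mem_nhdsWithin_of_mem_nhds (Metric.ball_mem_nhds _ hδ0))
        self_mem_nhdsWithin)
    have h2 : volume F < volume F + volume (Metric.ball x₀ (min ε ((R - ‖x₀‖) / 2)) ∩
        (Metric.ball (0 : Space n) R \ F)) := ENNReal.lt_add_right hfin h1.ne'
    refine h2.trans_le ?_
    rw [← measure_union₀' hF.measurable]
    · refine measure_mono (Set.union_subset_union_right _ Set.inter_subset_left)
    · refine Disjoint.aedisjoint (Set.disjoint_left.2 fun x hx hx' => hx'.2.2 hx)

/-- A competitor `F` for the radius `R` is approximated by competitors for radii `R_h → R`, with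
almost no increase of the perimeter: shrink `F` by the factor `min 1 (R_h / R)` and restore the
volume by adding a small ball. For `R = 1`, where there is no room for a ball, no change is needed since
`R_h ≥ 1`. -/
theorem exists_recovery (hn : 2 ≤ n) {R : ℝ} {R_h : ℕ → ℝ} (hR : 1 ≤ R) (hR_h : ∀ h, 1 ≤ R_h h)
    (hR_lim : Tendsto R_h atTop (𝓝 R)) {F : Set (Space n)} (hF : IsCompetitor R F)
    (hFm : MeasurableSet F) {ε : ℝ} (hε : 0 < ε) :
    ∃ F_h : ℕ → Set (Space n), (∀ h, MeasurableSet (F_h h)) ∧ (∀ h, IsCompetitor (R_h h) (F_h h)) ∧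
      Tendsto (fun h => volume (symmDiff F (F_h h))) atTop (𝓝 0) ∧
      ∀ᶠ h in atTop, perimeter (F_h h) ≤ perimeter F + ENNReal.ofReal ε := by
  rcases hR.eq_or_lt with rfl | hR1
  · exact ⟨fun _ => F, fun _ => hFm, fun h => ⟨hF.measurable,
      hF.subset_ball.trans (Metric.ball_subset_ball (hR_h h)), hF.volume_eq⟩, by simp,
      Eventually.of_forall fun h => le_self_add⟩
  have hn1 : 1 ≤ n := by omega
  have hR0 : 0 < R := by linarith
  have hfin : volume F ≠ ⊤ := by rw [hF.volume_eq]; exact measure_ball_lt_top.ne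
  obtain ⟨C, hC0, hC⟩ := exists_perimeter_union_ball_le (n := n) hn1
  obtain ⟨x₀, δ, R', hδ, hδε, hR', hsub, hvol⟩ := exists_ball_outside hn1 hR1 hF
    (ε := min 1 (ε / (C + 1))) (lt_min one_pos (by positivity))
  have hCδ : ∀ r ∈ Set.Icc 0 δ, C * r ^ (n - 1) ≤ ε := by
    intro r hr
    have h1 : r ≤ 1 := hr.2.trans (hδε.trans (min_le_left _ _))
    have h2 : r ≤ ε / (C + 1) := hr.2.trans (hδε.trans (min_le_right _ _))
    have h3 : r ^ (n - 1) ≤ r := pow_le_of_le_one hr.1 h1 (by omega)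
    rw [le_div_iff₀ (by linarith)] at h2
    nlinarith [mul_le_mul_of_nonneg_left h3 hC0, hr.1]
  let c : ℕ → ℝ := fun h => min 1 (R_h h / R)
  have hc0 : ∀ h, 0 < c h := fun h =>
    lt_min one_pos (div_pos (by linarith [hR_h h]) hR0)
  have hc1 : ∀ h, c h ≤ 1 := fun h => min_le_left _ _
  have hc : Tendsto c atTop (𝓝 1) := by
    have := (tendsto_const_nhds (x := (1 : ℝ))).min (hR_lim.div_const R)
    rwa [div_self hR0.ne', min_self] at this
  have hcF : ∀ h, MeasurableSet (c h • F) := fun h => hFm.const_smul_of_ne_zero (hc0 h).ne'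
  have hcvol : ∀ h, volume (c h • F) ≤ volume F := fun h => by
    rw [volume_smul_of_pos (hc0 h)]
    refine mul_le_of_le_one_left zero_le ?_
    rw [ENNReal.ofReal_le_one]
    exact pow_le_one₀ (hc0 h).le (hc1 h)
  have hcsub : ∀ h, c h • F ⊆ Metric.ball 0 (R_h h) := by
    rintro h _ ⟨x, hx, rfl⟩
    have hx := mem_ball_zero_iff.1 (hF.subset_ball hx)
    rw [mem_ball_zero_iff]
    simp only [norm_smul, Real.norm_of_nonneg (hc0 h).le]
    calc c h * ‖x‖ < c h * R := mul_lt_mul_of_pos_left hx (hc0 h)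
      _ ≤ R_h h / R * R := mul_le_mul_of_nonneg_right (min_le_right _ _) hR0.le
      _ = R_h h := div_mul_cancel₀ _ hR0.ne'
  have hdil := tendsto_volume_symmDiff_smul hFm hF.subset_ball hc0 hc1 hc
  -- Eventually a radius `r ≤ δ` restores the volume.
  have hev : ∀ᶠ h in atTop, volume F ≤ volume (c h • F ∪ Metric.ball x₀ δ) ∧ R' < R_h h := by
    have h1 : Tendsto (fun h => volume (c h • F ∪ Metric.ball x₀ δ)) atTop
        (𝓝 (volume (F ∪ Metric.ball x₀ δ))) := by
      refine tendsto_measure_of_symmDiff (hFm.union measurableSet_ball)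
        (fun h => (hcF h).union measurableSet_ball) ?_
      refine tendsto_of_tendsto_of_tendsto_of_le_of_le tendsto_const_nhds hdil (fun _ => zero_le)
        fun h => measure_mono fun x hx => ?_
      simp only [Set.mem_symmDiff, Set.mem_union] at hx ⊢
      tauto
    filter_upwards [h1.eventually_const_lt hvol, hR_lim.eventually_const_lt hR'] with h h2 h3
    exact ⟨h2.le, h3⟩
  have hex : ∀ h, ∃ G : Set (Space n), MeasurableSet G ∧ IsCompetitor (R_h h) G ∧
      (volume F ≤ volume (c h • F ∪ Metric.ball x₀ δ) ∧ R' < R_h h →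
        volume (symmDiff F G) ≤ 2 * volume (symmDiff F (c h • F)) ∧
        perimeter G ≤ perimeter F + ENNReal.ofReal ε) := by
    intro h
    by_cases hh : volume F ≤ volume (c h • F ∪ Metric.ball x₀ δ) ∧ R' < R_h h
    · have hcfin := ne_top_of_le_ne_top hfin (hcvol h)
      obtain ⟨r, hr, hrv⟩ := exists_volume_union_ball_eq hn1 hcfin x₀ hδ.le (hcvol h) hh.1
      have hGm : MeasurableSet (c h • F ∪ Metric.ball x₀ r) := (hcF h).union measurableSet_ball
      refine ⟨c h • F ∪ Metric.ball x₀ r, hGm, ⟨hGm.nullMeasurableSet, ?_, ?_⟩, fun _ => ⟨?_, ?_⟩⟩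
      · refine Set.union_subset (hcsub h) ?_
        exact (Metric.ball_subset_ball hr.2).trans (hsub.trans (Metric.ball_subset_ball hh.2.le))
      · rw [hrv, hF.volume_eq]
      · -- The added part has measure `|F| - |c F|`, so it is controlled by the dilation as well.
        have h1 : volume (symmDiff (c h • F) (c h • F ∪ Metric.ball x₀ r))
            ≤ volume (symmDiff F (c h • F)) := by
          rw [symmDiff_of_le (show c h • F ≤ c h • F ∪ Metric.ball x₀ r from Set.subset_union_left),
            measure_sdiff Set.subset_union_left (hcF h).nullMeasurableSet hcfin, hrv]
          exact le_measure_sdiff.trans (measure_mono Set.subset_union_left)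
        refine (measure_symmDiff_le F (c h • F) _).trans ?_
        rw [two_mul]
        gcongr
      · have hsm := perimeter_smul_le (E := F) hn1 (hc0 h) (hc1 h)
        rcases hr.1.eq_or_lt with h0 | h0
        · rw [← h0, Metric.ball_zero, Set.union_empty]
          exact hsm.trans le_self_add
        · refine (hC _ (hcF h).nullMeasurableSet x₀ r h0).trans ?_
          gcongr
          exact hCδ r hr
    · exact ⟨Metric.ball 0 1, measurableSet_ball, ⟨measurableSet_ball.nullMeasurableSet,
        Metric.ball_subset_ball (hR_h h), rfl⟩, fun h' => absurd h' hh⟩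
  choose G hGm hGc hG using hex
  refine ⟨G, hGm, hGc, ?_, hev.mono fun h hh => (hG h hh).2⟩
  have h2 : Tendsto (fun h => 2 * volume (symmDiff F (c h • F))) atTop (𝓝 0) := by
    simpa using ENNReal.Tendsto.const_mul hdil (Or.inr (by simp))
  exact tendsto_of_tendsto_of_tendsto_of_le_of_le' tendsto_const_nhds h2
    (Eventually.of_forall fun _ => zero_le) (hev.mono fun h hh => (hG h hh).1)

/-! ### Convergence of minimizers -/

/-- The term `Q² 𝒢_{β,K}(E)` as an element of `[0, ∞)`; this is faithful for bounded sets `E` of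
positive measure, where `𝒢_{β,K}(E)` is finite. -/
noncomputable def chargeEnergy (β K Q : ℝ) (E : Set (Space n)) : ℝ≥0∞ :=
  ENNReal.ofReal (Q ^ 2 * (electrostaticEnergy β K E).toReal)

lemma energy_eq_coe (hn : 3 ≤ n) {β K : ℝ} (Q : ℝ) (hβ : 1 ≤ β) (hK : 0 < K)
    {E : Set (Space n)} (hE : MeasurableSet E) {M : ℝ} (hEM : E ⊆ Metric.ball 0 M)
    (hE0 : volume E ≠ 0) :
    energy β K Q E = ((perimeter E + chargeEnergy β K Q E : ℝ≥0∞) : EReal) := by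
  obtain ⟨h1, h2⟩ := coe_toReal_electrostaticEnergy hn hβ hK hE hEM hE0
  rw [energy, chargeEnergy, EReal.coe_ennreal_add, EReal.coe_ennreal_ofReal,
    max_eq_left (by positivity), EReal.coe_mul, h1]

lemma tendsto_chargeEnergy (hn : 3 ≤ n) {β K Q : ℝ} {β_h K_h Q_h : ℕ → ℝ} (hβ : 1 ≤ β)
    (hβ_h : ∀ h, 1 ≤ β_h h) (hK : 0 < K) (hK_h : ∀ h, 0 < K_h h)
    (hβ_lim : Tendsto β_h atTop (𝓝 β)) (hK_lim : Tendsto K_h atTop (𝓝 K))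
    (hQ_lim : Tendsto Q_h atTop (𝓝 Q))
    {E : Set (Space n)} {E_h : ℕ → Set (Space n)} (hE : MeasurableSet E)
    (hE_h : ∀ h, MeasurableSet (E_h h)) {M : ℝ} (hEM : E ⊆ Metric.ball 0 M)
    (hEM_h : ∀ h, E_h h ⊆ Metric.ball 0 M) (hE0 : volume E ≠ 0) (hE0_h : ∀ h, volume (E_h h) ≠ 0)
    (hlim : Tendsto (fun h => volume (symmDiff E (E_h h))) atTop (𝓝 0)) :
    Tendsto (fun h => chargeEnergy (β_h h) (K_h h) (Q_h h) (E_h h)) atTop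
      (𝓝 (chargeEnergy β K Q E)) :=
  ENNReal.tendsto_ofReal ((hQ_lim.pow 2).mul
    (tendsto_electrostaticEnergy hn hβ hβ_h hK hK_h hβ_lim hK_lim hE hE_h hEM hEM_h hE0 hE0_h hlim))

lemma IsCompetitor.volume_ne_zero {R : ℝ} {E : Set (Space n)} (hE : IsCompetitor R E) :
    volume E ≠ 0 := by
  rw [hE.volume_eq]
  exact (Metric.measure_ball_pos volume 0 one_pos).ne'

lemma isCompetitor_ball {R : ℝ} (hR : 1 ≤ R) : IsCompetitor R (Metric.ball (0 : Space n) 1) :=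
  ⟨measurableSet_ball.nullMeasurableSet, Metric.ball_subset_ball hR, rfl⟩

lemma IsCompetitor.exists_measurableSet {R : ℝ} {E : Set (Space n)} (hE : IsCompetitor R E) :
    ∃ F, MeasurableSet F ∧ F =ᵐ[volume] E ∧ IsCompetitor R F := by
  obtain ⟨F, hsub, hm, hae⟩ := hE.measurable.exists_measurable_subset_ae_eq
  exact ⟨F, hm, hae, hm.nullMeasurableSet, hsub.trans hE.subset_ball,
    (measure_congr hae).trans hE.volume_eq⟩

lemma IsMinimizer.congr {β K Q R : ℝ} {E F : Set (Space n)} (hE : IsMinimizer β K Q R E)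
    (hF : IsCompetitor R F) (h : F =ᵐ[volume] E) : IsMinimizer β K Q R F :=
  ⟨hF, fun G hG => (energy_congr β K Q h).trans_le (hE.2 G hG)⟩

lemma IsMinimizer.perimeter_add_le (hn : 3 ≤ n) {β K Q R : ℝ} (hβ : 1 ≤ β) (hK : 0 < K)
    {E F : Set (Space n)} (hE : IsMinimizer β K Q R E) (hEm : MeasurableSet E)
    (hF : IsCompetitor R F) (hFm : MeasurableSet F) :
    perimeter E + chargeEnergy β K Q E ≤ perimeter F + chargeEnergy β K Q F := by
  have := hE.2 F hF
  rwa [energy_eq_coe hn Q hβ hK hEm hE.1.subset_ball hE.1.volume_ne_zero,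
    energy_eq_coe hn Q hβ hK hFm hF.subset_ball hF.volume_ne_zero,
    EReal.coe_ennreal_le_coe_ennreal_iff] at this

/-- Minimizers have bounded perimeters: compare them with the unit ball. -/
lemma exists_perimeter_le_of_isMinimizer (hn : 3 ≤ n) {β K Q : ℝ} {β_h K_h Q_h R_h : ℕ → ℝ}
    (hβ : 1 ≤ β) (hβ_h : ∀ h, 1 ≤ β_h h) (hK : 0 < K) (hK_h : ∀ h, 0 < K_h h)
    (hR_h : ∀ h, 1 ≤ R_h h) (hβ_lim : Tendsto β_h atTop (𝓝 β)) (hK_lim : Tendsto K_h atTop (𝓝 K))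
    (hQ_lim : Tendsto Q_h atTop (𝓝 Q)) {E_h : ℕ → Set (Space n)}
    (hE_h : ∀ h, IsMinimizer (β_h h) (K_h h) (Q_h h) (R_h h) (E_h h))
    (hEm_h : ∀ h, MeasurableSet (E_h h)) : ∃ C : ℝ≥0∞, C ≠ ⊤ ∧ ∀ h, perimeter (E_h h) ≤ C := by
  let B : Set (Space n) := Metric.ball 0 1
  have hB0 : volume B ≠ 0 := (isCompetitor_ball (n := n) le_rfl).volume_ne_zero
  have hlim : Tendsto (fun h => Q_h h ^ 2 * (electrostaticEnergy (β_h h) (K_h h) B).toReal) atTop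
      (𝓝 (Q ^ 2 * (electrostaticEnergy β K B).toReal)) :=
    (hQ_lim.pow 2).mul (tendsto_electrostaticEnergy hn hβ hβ_h hK hK_h hβ_lim hK_lim
      (E_h := fun _ => B) measurableSet_ball (fun _ => measurableSet_ball) subset_rfl
      (fun _ => subset_rfl) hB0 (fun _ => hB0) (by simp))
  obtain ⟨c, hc⟩ := hlim.bddAbove_range
  refine ⟨perimeter B + ENNReal.ofReal c,
    ENNReal.add_ne_top.2 ⟨perimeter_ball_ne_top (by omega), ENNReal.ofReal_ne_top⟩, fun h => ?_⟩
  calc perimeter (E_h h) ≤ perimeter (E_h h) + chargeEnergy (β_h h) (K_h h) (Q_h h) (E_h h) :=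
        le_self_add
    _ ≤ perimeter B + chargeEnergy (β_h h) (K_h h) (Q_h h) B :=
        (hE_h h).perimeter_add_le hn (hβ_h h) (hK_h h) (hEm_h h) (isCompetitor_ball (hR_h h))
          measurableSet_ball
    _ ≤ perimeter B + ENNReal.ofReal c := by
        gcongr
        exact ENNReal.ofReal_le_ofReal (hc ⟨h, rfl⟩)

/-- A limit in measure of competitors is a competitor, up to a null set. -/
lemma exists_isCompetitor_of_tendsto (hn : 1 ≤ n) {R : ℝ} {R_h : ℕ → ℝ} (hR : 1 ≤ R)
    (hR_lim : Tendsto R_h atTop (𝓝 R)) {E : Set (Space n)} {E_h : ℕ → Set (Space n)}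
    (hE : MeasurableSet E) (hE_h : ∀ h, IsCompetitor (R_h h) (E_h h))
    (hEm_h : ∀ h, MeasurableSet (E_h h))
    (hlim : Tendsto (fun h => volume (symmDiff E (E_h h))) atTop (𝓝 0)) :
    ∃ F, MeasurableSet F ∧ F =ᵐ[volume] E ∧ IsCompetitor R F := by
  have : NeZero n := ⟨by omega⟩
  have hk : ∀ k : ℕ, volume (E \ Metric.ball 0 (R + 1 / (k + 1))) = 0 := by
    intro k
    have hpos : (0 : ℝ) < 1 / (k + 1) := by positivity
    refine le_antisymm (ge_of_tendsto hlim ?_) zero_le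
    filter_upwards [hR_lim.eventually_lt_const (show R < R + 1 / (k + 1) by linarith)] with h hh
    refine measure_mono fun x hx => Or.inl ⟨hx.1, fun hxh => hx.2 ?_⟩
    exact Metric.ball_subset_ball hh.le ((hE_h h).subset_ball hxh)
  have hball : volume (E \ Metric.ball 0 R) = 0 := by
    refine measure_mono_null (t := (⋃ k : ℕ, E \ Metric.ball 0 (R + 1 / (k + 1))) ∪
      Metric.sphere 0 R) ?_ (measure_union_null (measure_iUnion_null hk)
        (Measure.addHaar_sphere_of_ne_zero _ _ (by linarith)))
    intro x hx
    rcases eq_or_ne ‖x‖ R with h | h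
    · exact Or.inr (mem_sphere_zero_iff_norm.2 h)
    · have hxR : R < ‖x‖ := lt_of_le_of_ne (by simpa using hx.2) h.symm
      obtain ⟨k, hk⟩ := exists_nat_one_div_lt (sub_pos.2 hxR)
      refine Or.inl (Set.mem_iUnion.2 ⟨k, hx.1, fun hxk => ?_⟩)
      have := mem_ball_zero_iff.1 hxk
      linarith
  have hae : (E ∩ Metric.ball 0 R : Set (Space n)) =ᵐ[volume] E := by
    refine (Set.inter_subset_left.eventuallyLE).antisymm ?_
    rw [ae_le_set, Set.sdiff_self_inter]
    exact hball
  refine ⟨_, hE.inter measurableSet_ball, hae, (hE.inter measurableSet_ball).nullMeasurableSet,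
    Set.inter_subset_right, ?_⟩
  rw [measure_congr hae]
  have h1 := tendsto_measure_of_symmDiff hE hEm_h hlim
  simp_rw [fun h => (hE_h h).volume_eq] at h1
  exact tendsto_nhds_unique h1 tendsto_const_nhds

/-- The comparison of minimizers with recovery sequences. The electrostatic terms converge, so
taking a recovery sequence of the limit `E` itself bounds the limit superior of the perimeters,
and taking one of an arbitrary competitor gives minimality. -/
lemma isMinimizer_of_tendsto (hn : 3 ≤ n) {β K Q R : ℝ} {β_h K_h Q_h R_h : ℕ → ℝ}
    (hβ : 1 ≤ β) (hβ_h : ∀ h, 1 ≤ β_h h) (hK : 0 < K) (hK_h : ∀ h, 0 < K_h h)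
    (hR : 1 ≤ R) (hR_h : ∀ h, 1 ≤ R_h h)
    (hβ_lim : Tendsto β_h atTop (𝓝 β)) (hK_lim : Tendsto K_h atTop (𝓝 K))
    (hQ_lim : Tendsto Q_h atTop (𝓝 Q)) (hR_lim : Tendsto R_h atTop (𝓝 R))
    {E : Set (Space n)} {E_h : ℕ → Set (Space n)}
    (hE_h : ∀ h, IsMinimizer (β_h h) (K_h h) (Q_h h) (R_h h) (E_h h))
    (hEm_h : ∀ h, MeasurableSet (E_h h)) (hE : IsCompetitor R E) (hEm : MeasurableSet E)
    (hlim : Tendsto (fun h => volume (symmDiff E (E_h h))) atTop (𝓝 0)) :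
    IsMinimizer β K Q R E ∧
      Tendsto (fun h => energy (β_h h) (K_h h) (Q_h h) (E_h h)) atTop (𝓝 (energy β K Q E)) ∧
      Tendsto (fun h => perimeter (E_h h)) atTop (𝓝 (perimeter E)) := by
  obtain ⟨M, hM⟩ := hR_lim.bddAbove_range
  have hM_h : ∀ h, R_h h ≤ M := fun h => hM ⟨h, rfl⟩
  have hRM : R ≤ M := le_of_tendsto' hR_lim hM_h
  have hcont : ∀ {F : Set (Space n)} {F_h : ℕ → Set (Space n)}, IsCompetitor R F →
      MeasurableSet F → (∀ h, IsCompetitor (R_h h) (F_h h)) → (∀ h, MeasurableSet (F_h h)) →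
      Tendsto (fun h => volume (symmDiff F (F_h h))) atTop (𝓝 0) →
      Tendsto (fun h => chargeEnergy (β_h h) (K_h h) (Q_h h) (F_h h)) atTop
        (𝓝 (chargeEnergy β K Q F)) := fun hF hFm hF_h hFm_h h =>
    tendsto_chargeEnergy hn hβ hβ_h hK hK_h hβ_lim hK_lim hQ_lim hFm hFm_h
      (hF.subset_ball.trans (Metric.ball_subset_ball hRM))
      (fun h => (hF_h h).subset_ball.trans (Metric.ball_subset_ball (hM_h h)))
      hF.volume_ne_zero (fun h => (hF_h h).volume_ne_zero) h
  have hq := hcont hE hEm (fun h => (hE_h h).1) hEm_h hlim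
  have hqfin : ∀ (β K Q : ℝ) (F : Set (Space n)), chargeEnergy β K Q F ≠ ⊤ :=
    fun _ _ _ _ => ENNReal.ofReal_ne_top
  have hcomp : ∀ F : Set (Space n), IsCompetitor R F → MeasurableSet F → ∀ ε : ℝ, 0 < ε →
      ∃ s : ℕ → ℝ≥0∞, Tendsto s atTop (𝓝 (perimeter F + ENNReal.ofReal ε + chargeEnergy β K Q F)) ∧
        ∀ᶠ h in atTop,
          perimeter (E_h h) + chargeEnergy (β_h h) (K_h h) (Q_h h) (E_h h) ≤ s h := by
    intro F hF hFm ε hε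
    obtain ⟨F_h, hFm_h, hF_h, hFlim, hP⟩ := exists_recovery (by omega) hR hR_h hR_lim hF hFm hε
    refine ⟨fun h => perimeter F + ENNReal.ofReal ε +
      chargeEnergy (β_h h) (K_h h) (Q_h h) (F_h h),
      tendsto_const_nhds.add (hcont hF hFm hF_h hFm_h hFlim), hP.mono fun h hh => ?_⟩
    refine ((hE_h h).perimeter_add_le hn (hβ_h h) (hK_h h) (hEm_h h) (hF_h h) (hFm_h h)).trans ?_
    exact add_le_add hh le_rfl
  have hliminf := perimeter_le_liminf hEm.nullMeasurableSet
    (fun h => (hEm_h h).nullMeasurableSet) hlim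
  have hlimsup : limsup (fun h => perimeter (E_h h)) atTop ≤ perimeter E := by
    refine ENNReal.le_of_forall_pos_le_add fun ε hε _ => ?_
    obtain ⟨s, hs, hle⟩ := hcomp E hE hEm ε hε
    have h1 := ENNReal.Tendsto.sub hs hq (Or.inr (hqfin _ _ _ _))
    rw [ENNReal.add_sub_cancel_right (hqfin _ _ _ _), ENNReal.ofReal_coe_nnreal] at h1
    rw [← h1.limsup_eq]
    exact limsup_le_limsup (hle.mono fun h hh =>
      ENNReal.le_sub_of_add_le_right (hqfin _ _ _ _) hh)
  have hp : Tendsto (fun h => perimeter (E_h h)) atTop (𝓝 (perimeter E)) :=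
    tendsto_of_le_liminf_of_limsup_le hliminf hlimsup
  have hpq := hp.add hq
  refine ⟨⟨hE, fun F hF => ?_⟩, ?_, hp⟩
  · obtain ⟨F', hFm', hae, hF'⟩ := hF.exists_measurableSet
    rw [← energy_congr β K Q hae, energy_eq_coe hn Q hβ hK hEm hE.subset_ball hE.volume_ne_zero,
      energy_eq_coe hn Q hβ hK hFm' hF'.subset_ball hF'.volume_ne_zero,
      EReal.coe_ennreal_le_coe_ennreal_iff]
    refine ENNReal.le_of_forall_pos_le_add fun ε hε _ => ?_
    obtain ⟨s, hs, hle⟩ := hcomp F' hF' hFm' ε hε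
    have := le_of_tendsto_of_tendsto hpq hs hle
    rwa [ENNReal.ofReal_coe_nnreal, add_right_comm] at this
  · rw [energy_eq_coe hn Q hβ hK hEm hE.subset_ball hE.volume_ne_zero]
    simp_rw [fun h => energy_eq_coe hn (Q_h h) (hβ_h h) (hK_h h) (hEm_h h) (hE_h h).1.subset_ball
      (hE_h h).1.volume_ne_zero]
    exact (continuous_coe_ennreal_ereal.tendsto _).comp hpq

end ChargedDrop

theorem mainTheorem8 (n : ℕ) (hn : 3 ≤ n)
    (β_h K_h Q_h R_h : ℕ → ℝ) (β K Q R : ℝ)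
    (hβ_h : ∀ h, 1 ≤ β_h h) (hR_h : ∀ h, 1 ≤ R_h h)
    (hK : 0 < K) (hβ : 1 ≤ β) (hR : 1 ≤ R) (hQ : 0 ≤ Q)
    (hK_lim : Tendsto K_h atTop (𝓝 K)) (hβ_lim : Tendsto β_h atTop (𝓝 β))
    (hR_lim : Tendsto R_h atTop (𝓝 R)) (hQ_lim : Tendsto Q_h atTop (𝓝 Q))
    (E_h : ℕ → Set (ChargedDrop.Space n))
    (hE_h : ∀ h, ChargedDrop.IsMinimizer (β_h h) (K_h h) (Q_h h) (R_h h) (E_h h)) :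
    ∃ (σ : ℕ → ℕ) (E : Set (ChargedDrop.Space n)), StrictMono σ ∧
      ChargedDrop.perimeter E < ⊤ ∧
      Tendsto (fun h => volume (symmDiff E (E_h (σ h)))) atTop (𝓝 0) ∧
      ChargedDrop.IsMinimizer β K Q R E ∧
      Tendsto (fun h => ChargedDrop.energy (β_h (σ h)) (K_h (σ h)) (Q_h (σ h)) (E_h (σ h)))
        atTop (𝓝 (ChargedDrop.energy β K Q E)) ∧
      Tendsto (fun h => ChargedDrop.perimeter (E_h (σ h))) atTop
        (𝓝 (ChargedDrop.perimeter E)) := by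
  -- The sets may be taken Borel, at the cost of null sets.
  choose G hGm hae hGc using fun h => (hE_h h).1.exists_measurableSet
  have hG : ∀ h, ChargedDrop.IsMinimizer (β_h h) (K_h h) (Q_h h) (R_h h) (G h) := fun h =>
    (hE_h h).congr (hGc h) (hae h)
  -- Only the limit `K` is positive by assumption, so finitely many `h` are discarded.
  obtain ⟨N, hN⟩ := eventually_atTop.1 (hK_lim.eventually_const_lt hK)
  have hK' : ∀ h, 0 < K_h (h + N) := fun h => hN _ (Nat.le_add_left _ _)
  have hshift : Tendsto (fun h => h + N) atTop atTop := tendsto_add_atTop_nat N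
  obtain ⟨C, hC, hPC⟩ := ChargedDrop.exists_perimeter_le_of_isMinimizer hn hβ
    (fun h => hβ_h (h + N)) hK hK' (fun h => hR_h (h + N)) (hβ_lim.comp hshift)
    (hK_lim.comp hshift) (hQ_lim.comp hshift) (fun h => hG (h + N)) (fun h => hGm (h + N))
  obtain ⟨M, hM⟩ := hR_lim.bddAbove_range
  obtain ⟨τ, E₀, hτ, hE₀m, hE₀⟩ := ChargedDrop.exists_subseq_tendsto_of_perimeter_le
    (E := fun h => G (h + N)) (M := M) (fun h => (hGm _).nullMeasurableSet)
    (fun h => (hGc _).subset_ball.trans (Metric.ball_subset_ball (hM ⟨_, rfl⟩))) hC hPC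
  have hσlim : Tendsto (fun h => τ h + N) atTop atTop := hshift.comp hτ.tendsto_atTop
  obtain ⟨E, hEm, hEae, hE⟩ := ChargedDrop.exists_isCompetitor_of_tendsto (by omega) hR
    (hR_lim.comp hσlim) hE₀m (fun h => hGc (τ h + N)) (fun h => hGm (τ h + N)) hE₀
  have hlim : Tendsto (fun h => volume (symmDiff E (G (τ h + N)))) atTop (𝓝 0) :=
    hE₀.congr fun h => measure_congr (hEae.symm.symmDiff (ae_eq_refl _))
  obtain ⟨hmin, hen, hper⟩ := ChargedDrop.isMinimizer_of_tendsto hn hβ (fun h => hβ_h (τ h + N)) hK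
    (fun h => hK' (τ h)) hR (fun h => hR_h (τ h + N)) (hβ_lim.comp hσlim) (hK_lim.comp hσlim)
    (hQ_lim.comp hσlim) (hR_lim.comp hσlim) (fun h => hG (τ h + N)) (fun h => hGm (τ h + N)) hE hEm
    hlim
  refine ⟨fun h => τ h + N, E, fun a b hab => Nat.add_lt_add_right (hτ hab) N, ?_, ?_, hmin, ?_, ?_⟩
  · exact (le_of_tendsto' hper fun h => hPC (τ h)).trans_lt hC.lt_top
  · exact hlim.congr fun h => measure_congr ((ae_eq_refl _).symmDiff (hae _))
  · exact hen.congr fun h => ChargedDrop.energy_congr _ _ _ (hae _)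
  · exact hper.congr fun h => ChargedDrop.perimeter_congr (hae _)
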